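/- **Setting.** Let $\mathcal B\subset\mathbb R^d$ ($d\ge1$) be a bounded domain with $\mathcal H^{d-1}(\partial\mathcal B)<\infty$, and assume: (A1) $e:\mathbb R^{d\times d}\times\mathbb R^k\times\mathbb R^{k\times d}\to[0,\infty)$ is a quadratic form with $\lambda(|U|^2+|\nu|^2+|N|^2)\le e(U,\nu,N)\le\Lambda(|U|^2+|\nu|^2+|N|^2)$ for some $\lambda,\Lambda>0$; (A2) $w\in C^1(\mathbb R^d\times\mathbb R^k,[0,\infty))$ and $|\nabla w(u,\nu)|\le\Xi_1(1+|u|+|\nu|)$ for some $\Xi_1>0$; (A3) $\mathsf t\in L^2(\partial\mathcal B,\mathcal H^{d-1})$ is applied on a closed set $\partial\mathcal B_{\mathsf t}\subseteq\partial\mathcal B$; homogeneous conditions are prescribed for $u$ on $\partial\mathcal B_u:=\overline{\partial\mathcal B\setminus\partial\mathcal B_{\mathsf t}}$ and for $\nu$ on a closed set $\partial\mathcal B_\nu\subseteq\partial\mathcal B$. Let $\mathcal T$ be a finite conforming triangulation of $\overline{\mathcal B}$ by $d$-simplices $K$, with nodes $a$ (the vertices of the simplices) and piecewise affine nodal shape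 functions $\mathcal N_a$. For nodal values $u=(u_a)\in\mathbb R^D$, $\nu=(\nu_a)\in\mathbb R^M$ ($u_a\in\mathbb R^d$, $\nu_a\in\mathbb R^k$) put $u_K=\sum_a\mathcal N_au_a$ and $\nu_K=\sum_a\mathcal N_a\nu_a$ on $K$, and $$V_K(u,\nu)=\int_K e(\nabla u_K,\nu_K,\nabla\nu_K)\,dx+\int_K w(u_K,\nu_K)\,dx-\int_{\partial K\cap\partial\mathcal B_{\mathsf t}}\mathsf t\cdot u_K\,d\mathcal H^{d-1}.$$ Let $m_{K,a},\overline\rho_{K,a},\eta_{K,a}>0$ ($a\in K$) be the coefficients of the diagonal mass matrices and of the dissipation (for instance $\eta_{K,a}=\eta>0$), and $\overline\rho_a=\sum_{K\ni a}\overline\rho_{K,a}$, $\eta_a=\sum_{K\ni a}\eta_{K,a}$. Let $I=(t_0,t_f)$ be bounded. A pair $(u,\nu)$ of functions of time is called admissible if $u_a\equiv0$ for $a\in\partial\mathcal B_u$ and $\nu_a\equiv0$ for $a\in\partial\mathcal B_\nu$. *Semi-discrete principle.* Let $$\mathcal A_{\mathcal T}(u,\nu)=\sum_K\int_I\Big(\sum_{a\in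 K}\big(\tfrac{m_{K,a}}2|\dot u_a|^2+\tfrac{\overline\rho_{K,a}}2|\dot\nu_a|^2\big)-V_K(u(t),\nu(t))\Big)dt,\qquad \mathcal D_{\mathcal T}(\dot\nu)[\phi]=\sum_K\int_I\sum_{a\in K}\eta_{K,a}\,\dot\nu_a\cdot\phi_a\,dt.$$ An admissible $(u,\nu)\in H^1(I,\mathbb R^{D}\times\mathbb R^M)$ solves the semi-discrete principle if $\delta\mathcal A_{\mathcal T}(u,\nu)[\varphi,\phi]+\mathcal D_{\mathcal T}(\dot\nu)[\phi]=0$ for all admissible $(\varphi,\phi)\in H^1_0(I,\mathbb R^{D}\times\mathbb R^M)$, where $\delta$ denotes the first variation. *Discrete principle.* An asynchronous time set $\Theta$ consists of finite sets $\Theta_K=\{t_0=t_K^0<\dots<t_K^{N_K}=t_f\}$, one for each $K$, with $\Theta_K\cap\Theta_{K'}=\{t_0,t_f\}$ for $K\ne K'$. Let $\Theta_a=\bigcup_{K\ni a}\Theta_K=\{t_a^0<t_a^1<\dots<t_a^{N_a}\}$, let $T_\Theta$ be the maximal elemental step $t_K^{j+1}-t_K^j$, and let $\tau_\Theta$ be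 the ratio of the maximal to the minimal elemental step. Let $\mathcal Y_\Theta$ be the set of admissible continuous $(u,\nu)$ on $\overline I$ such that $u_a,\nu_a$ are affine between consecutive instants of $\Theta_a$; $\dot u_a(t_a^i),\dot\nu_a(t_a^i)$ are the slopes on $[t_a^i,t_a^{i+1})$. On $\mathcal Y_\Theta$ let $$\mathcal A_{\mathcal T,\Theta}(u,\nu)=\sum_K\sum_{j=0}^{N_K-1}\Big(\sum_{a\in K}\sum_{t_a^i\in[t_K^j,t_K^{j+1})}(t_a^{i+1}-t_a^i)\big(\tfrac{m_{K,a}}2|\dot u_a(t_a^i)|^2+\tfrac{\overline\rho_{K,a}}2|\dot\nu_a(t_a^i)|^2\big)-(t_K^{j+1}-t_K^j)V_K\big((u,\nu)(t_K^j)\big)\Big),$$ $$\mathcal D_{\mathcal T,\Theta}(\dot\nu)[\phi]=\sum_a\sum_{i=1}^{N_a}\eta_a\,(\nu_a(t_a^i)-\nu_a(t_a^{i-1}))\cdot\phi_a(t_a^{i-1}).$$ $(u,\nu)\in\mathcal Y_\Theta$ solves the discrete principle relative to $\Theta$ if $\delta\mathcal A_{\mathcal T,\Theta}(u,\nu)[\varphi,\phi]+\mathcal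 D_{\mathcal T,\Theta}(\dot\nu)[\phi]=0$ for all $(\varphi,\phi)\in\mathcal Y_\Theta$ vanishing at $t_0$ and $t_f$. **Theorem.** Let $(\Theta_h)_{h\in\mathbb N}$ be asynchronous time sets for $I$ with $T_{\Theta_h}\to0$, and let $(u_h(t_0),\nu_h(t_0))$, $(\dot u_h(t_0),\dot\nu_h(t_0))$ be initial data, vanishing at the nodes where homogeneous conditions are prescribed, such that $$\sup_h\big(\tau_{\Theta_h}+|u_h(t_0)|+|\nu_h(t_0)|+|\dot u_h(t_0)|+|\dot\nu_h(t_0)|\big)<\infty.$$ Then, for every $h$ such that $\eta_a(t_a^{i+1}-t_a^i)\ne\overline\rho_a$ for all nodes $a\notin\partial\mathcal B_\nu$ and all $t_a^i\in(\Theta_h)_a$ with $t_0<t_a^i<t_f$, and in particular for all sufficiently large $h$, the discrete principle relative to $\Theta_h$ has a unique solution $(u_h,\nu_h)$ on $\overline I$ with the given initial data. Moreover, there exists $(u,\nu)\in W^{2,\infty}(I,\mathbb R^{D}\times\mathbb R^M)$ solving the semi-discrete principle such that, up to a subsequence, $(u_h,\nu_h)\to(u,\nu)$ uniformly on $\overline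 I$ and $(\dot u_h,\dot\nu_h)\to(\dot u,\dot\nu)$ in $L^p(I,\mathbb R^{D}\times\mathbb R^M)$ for every $p\in[1,\infty)$. -/

import Mathlib

open MeasureTheory Set Filter Topology
open scoped ENNReal

noncomputable section

namespace AVI

/-- `ℝⁿ` with its Euclidean structure. -/
abbrev Vec (n : ℕ) := EuclideanSpace ℝ (Fin n)

/-! ### The body: domain, energies, loads -/

/-- The data of a linearized complex body in `ℝᵈ` whose morphological descriptors lie in `ℝᵏ`.
`energy` is the elastic density `e(U, ν, N)`, `potential` the density `w(u, ν)` of the external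
actions, `tractionBdry` the part `∂B_t` of the boundary that carries the traction, `microBdry` the
part `∂B_ν` on which the homogeneous condition for `ν` is prescribed. -/
structure ComplexBody (d k : ℕ) where
  domain : Set (Vec d)
  energy : QuadraticForm ℝ
    (Matrix (Fin d) (Fin d) ℝ × Vec k × Matrix (Fin k) (Fin d) ℝ)
  potential : Vec d × Vec k → ℝ
  traction : Vec d → Vec d
  tractionBdry : Set (Vec d)
  microBdry : Set (Vec d)

/-- Square of the Euclidean (Frobenius) norm of a matrix. -/
def frobSq {m n : ℕ} (A : Matrix (Fin m) (Fin n) ℝ) : ℝ := ∑ i, ∑ j, A i j ^ 2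

namespace ComplexBody

variable {d k : ℕ} (𝓑 : ComplexBody d k)

/-- The part `∂B_u` of the boundary on which the homogeneous condition for `u` is prescribed. -/
def dispBdry : Set (Vec d) := closure (frontier 𝓑.domain \ 𝓑.tractionBdry)

/-- The body occupies a bounded domain whose boundary has finite `(d-1)`-dimensional measure
(`μHE[d-1]` is the Hausdorff measure, normalized as surface area). -/
structure IsBoundedDomain : Prop where
  isOpen : IsOpen 𝓑.domain
  isConnected : IsConnected 𝓑.domain
  isBounded : Bornology.IsBounded 𝓑.domain
  boundary_finite : μHE[d - 1] (frontier 𝓑.domain) < ∞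

/-- (A1): the elastic density is a coercive, continuous quadratic form. -/
def A1 : Prop :=
  ∃ lam Lam : ℝ, 0 < lam ∧ 0 < Lam ∧
    ∀ (U : Matrix (Fin d) (Fin d) ℝ) (ν : Vec k) (N : Matrix (Fin k) (Fin d) ℝ),
      lam * (frobSq U + ‖ν‖ ^ 2 + frobSq N) ≤ 𝓑.energy (U, ν, N) ∧
      𝓑.energy (U, ν, N) ≤ Lam * (frobSq U + ‖ν‖ ^ 2 + frobSq N)

/-- (A2): the external potential is `C¹`, nonnegative, with gradient of linear growth. -/
def A2 : Prop :=
  ContDiff ℝ 1 𝓑.potential ∧ (∀ p, 0 ≤ 𝓑.potential p) ∧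
    ∃ Xi : ℝ, 0 < Xi ∧ ∀ (u : Vec d) (ν : Vec k),
      ‖fderiv ℝ 𝓑.potential (u, ν)‖ ≤ Xi * (1 + ‖u‖ + ‖ν‖)

/-- (A3): the traction is square integrable on the boundary, and the loaded part `∂B_t` and the
part `∂B_ν` are closed subsets of the boundary. -/
structure A3 : Prop where
  traction_memLp : MemLp 𝓑.traction 2 ((μHE[d - 1]).restrict (frontier 𝓑.domain))
  tractionBdry_closed : IsClosed 𝓑.tractionBdry
  tractionBdry_subset : 𝓑.tractionBdry ⊆ frontier 𝓑.domain
  microBdry_closed : IsClosed 𝓑.microBdry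
  microBdry_subset : 𝓑.microBdry ⊆ frontier 𝓑.domain

end ComplexBody

/-! ### Tessellations and piecewise affine finite elements -/

/-- A (conforming) triangulation of `B ⊆ ℝᵈ`. An element is given by the set of its `d + 1`
vertices; the element itself is the closed simplex spanned by them. -/
structure Tessellation {d : ℕ} (B : Set (Vec d)) where
  elements : Finset (Finset (Vec d))
  card_eq : ∀ K ∈ elements, K.card = d + 1
  indep : ∀ K ∈ elements, AffineIndependent ℝ ((↑) : K → Vec d)
  conforming : ∀ K ∈ elements, ∀ L ∈ elements,
    convexHull ℝ (K : Set (Vec d)) ∩ convexHull ℝ (L : Set (Vec d)) =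
      convexHull ℝ ((K : Set (Vec d)) ∩ (L : Set (Vec d)))
  cover : ⋃ K ∈ elements, convexHull ℝ (K : Set (Vec d)) = closure B

namespace Tessellation

variable {d : ℕ} {B : Set (Vec d)} (T : Tessellation B)

/-- The type of elements. -/
abbrev Elem := {K : Finset (Vec d) // K ∈ T.elements}

open Classical in
/-- The finite set of nodes: the vertices of the elements. -/
def nodes : Finset (Vec d) := T.elements.biUnion id

/-- The type of nodes. -/
abbrev Node := {a : Vec d // a ∈ T.nodes}

/-- Nodal vectors: `ℝ^{n #T}` with its Euclidean norm. -/
abbrev NodalVec (n : ℕ) := PiLp 2 (fun _ : T.Node => Vec n)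

/-- The closed simplex of an element. -/
def simplex (K : T.Elem) : Set (Vec d) := convexHull ℝ (K.1 : Set (Vec d))

/-- The vertices of an element as an affine basis of `ℝᵈ`; its coordinate functions are the
barycentric coordinates of the element. -/
def affineBasis (K : T.Elem) : AffineBasis K.1 ℝ (Vec d) :=
  ⟨(↑), T.indep K.1 K.2,
    (T.indep K.1 K.2).affineSpan_eq_top_iff_card_eq_finrank_add_one.2 (by
      simpa using T.card_eq K.1 K.2)⟩

open Classical in
/-- The restriction to the element `K` of the nodal shape function of the node `a` (the continuous
function, affine on every element, with value `1` at `a` and `0` at the other nodes). -/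
def shape (K : T.Elem) (a : T.Node) (x : Vec d) : ℝ :=
  if h : a.1 ∈ K.1 then (T.affineBasis K).coord ⟨a.1, h⟩ x else 0

/-- The finite element field `∑ₐ Nₐ(x) qₐ` on the element `K`. -/
def field {n : ℕ} (K : T.Elem) (q : T.NodalVec n) (x : Vec d) : Vec n :=
  ∑ a : T.Node, T.shape K a x • q a

/-- The gradient (Jacobian matrix) of the finite element field on the element `K`. -/
def gradField {n : ℕ} (K : T.Elem) (q : T.NodalVec n) (x : Vec d) :
    Matrix (Fin n) (Fin d) ℝ :=
  Matrix.of fun i j => fderiv ℝ (T.field K q) x (EuclideanSpace.single j 1) i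

/-- The coefficients of the diagonal (lumped) mass and dissipation matrices: the elemental masses
`m_{K,a}`, the elemental substructural inertias `ρ̄_{K,a}`, and the elemental dissipation
coefficients `η_{K,a}`, for the nodes `a` of `K`. -/
structure Coefficients where
  mass : T.Elem → T.Node → ℝ
  inertia : T.Elem → T.Node → ℝ
  diss : T.Elem → T.Node → ℝ
  mass_pos : ∀ K a, a.1 ∈ K.1 → 0 < mass K a
  inertia_pos : ∀ K a, a.1 ∈ K.1 → 0 < inertia K a
  diss_pos : ∀ K a, a.1 ∈ K.1 → 0 < diss K a

open Classical in
/-- The nodes of an element. -/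
def nodesOf (K : T.Elem) : Finset T.Node := Finset.univ.filter fun a => a.1 ∈ K.1

open Classical in
/-- The elements that contain a node. -/
def elemsAt (a : T.Node) : Finset T.Elem := Finset.univ.filter fun K => a.1 ∈ K.1

variable {T} in
/-- Nodal substructural inertia `ρ̄ₐ`. -/
def Coefficients.nodalInertia (c : T.Coefficients) (a : T.Node) : ℝ :=
  ∑ K ∈ T.elemsAt a, c.inertia K a

variable {T} in
/-- Nodal dissipation coefficient `ηₐ`. -/
def Coefficients.nodalDiss (c : T.Coefficients) (a : T.Node) : ℝ :=
  ∑ K ∈ T.elemsAt a, c.diss K a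

end Tessellation

/-! ### Sobolev functions of time

On a bounded interval, a function is in `W^{1,p}` if and only if it has a representative that is
absolutely continuous on the closed interval with classical derivative in `L^p`; functions of
time are always identified with that representative. -/

/-- `u ∈ W^{1,p}((t₀, t₁); E)`. -/
def MemW1 {E : Type*} [NormedAddCommGroup E] [NormedSpace ℝ E]
    (p : ℝ≥0∞) (t₀ t₁ : ℝ) (u : ℝ → E) : Prop :=
  AbsolutelyContinuousOnInterval u t₀ t₁ ∧ MemLp (deriv u) p (volume.restrict (Ioo t₀ t₁))

/-- `u ∈ W^{1,p}₀((t₀, t₁); E)`. -/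
def MemW1Zero {E : Type*} [NormedAddCommGroup E] [NormedSpace ℝ E]
    (p : ℝ≥0∞) (t₀ t₁ : ℝ) (u : ℝ → E) : Prop :=
  MemW1 p t₀ t₁ u ∧ u t₀ = 0 ∧ u t₁ = 0

/-- `u ∈ W^{2,p}((t₀, t₁); E)`: `u` and its derivative are in `W^{1,p}`. -/
def MemW2 {E : Type*} [NormedAddCommGroup E] [NormedSpace ℝ E]
    (p : ℝ≥0∞) (t₀ t₁ : ℝ) (u : ℝ → E) : Prop :=
  MemW1 p t₀ t₁ u ∧
    ∃ v : ℝ → E, MemW1 p t₀ t₁ v ∧ deriv u =ᵐ[volume.restrict (Ioo t₀ t₁)] v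

/-! ### The problem discretized in space -/

section SemiDiscrete

variable {d k : ℕ} (𝓑 : ComplexBody d k) (T : Tessellation 𝓑.domain)

/-- The potential energy `V_K` of the element `K` as a function of the nodal values. -/
def elemPotential (K : T.Elem) (u : T.NodalVec d) (ν : T.NodalVec k) : ℝ :=
  (∫ x in T.simplex K, 𝓑.energy (T.gradField K u x, T.field K ν x, T.gradField K ν x))
    + (∫ x in T.simplex K, 𝓑.potential (T.field K u x, T.field K ν x))
    - ∫ x in frontier (T.simplex K) ∩ 𝓑.tractionBdry,
        inner ℝ (𝓑.traction x) (T.field K u x) ∂(μHE[d - 1])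

variable {𝓑 T} in
/-- The semi-discrete action on the time interval `(t₀, t₁)`. -/
def action (c : T.Coefficients) (t₀ t₁ : ℝ)
    (u : ℝ → T.NodalVec d) (ν : ℝ → T.NodalVec k) : ℝ :=
  ∑ K : T.Elem, ∫ t in t₀..t₁,
    ((∑ a ∈ T.nodesOf K, (c.mass K a / 2 * ‖deriv u t a‖ ^ 2
        + c.inertia K a / 2 * ‖deriv ν t a‖ ^ 2))
      - elemPotential 𝓑 T K (u t) (ν t))

variable {𝓑 T} in
/-- The semi-discrete dissipation. -/
def dissipation (c : T.Coefficients) (t₀ t₁ : ℝ) (ν ψ : ℝ → T.NodalVec k) : ℝ :=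
  ∑ K : T.Elem, ∫ t in t₀..t₁,
    ∑ a ∈ T.nodesOf K, c.diss K a * inner ℝ (deriv ν t a) (ψ t a)

/-- The homogeneous boundary conditions at the nodes, at all times of `[t₀, t₁]`. -/
def NodalBC (t₀ t₁ : ℝ) (u : ℝ → T.NodalVec d) (ν : ℝ → T.NodalVec k) : Prop :=
  ∀ t ∈ Icc t₀ t₁, ∀ a : T.Node,
    (a.1 ∈ 𝓑.dispBdry → u t a = 0) ∧ (a.1 ∈ 𝓑.microBdry → ν t a = 0)

variable {𝓑 T} in
/-- `(u, ν)` satisfies the semi-discrete (in space) d'Alembert-Lagrange principle: it is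
admissible, and the first variation `δA(u, ν)[φ, ψ]`, the derivative at `ε = 0` of the action along
`(u, ν) + ε (φ, ψ)`, exists and is `-D(ν')[ψ]`, for all admissible `(φ, ψ)` in `H¹₀`. -/
structure IsStationary (c : T.Coefficients) (t₀ t₁ : ℝ)
    (u : ℝ → T.NodalVec d) (ν : ℝ → T.NodalVec k) : Prop where
  memH1_left : MemW1 2 t₀ t₁ u
  memH1_right : MemW1 2 t₀ t₁ ν
  nodalBC : NodalBC 𝓑 T t₀ t₁ u ν
  stationary : ∀ (φ : ℝ → T.NodalVec d) (ψ : ℝ → T.NodalVec k),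
    MemW1Zero 2 t₀ t₁ φ → MemW1Zero 2 t₀ t₁ ψ → NodalBC 𝓑 T t₀ t₁ φ ψ →
      HasDerivAt (fun ε : ℝ => action c t₀ t₁ (u + ε • φ) (ν + ε • ψ))
        (-dissipation c t₀ t₁ ν ψ) 0

end SemiDiscrete

/-! ### Asynchronous time sets -/

/-- The first instant of `S` after `t` (used only if there is one). -/
def nextTime (S : Finset ℝ) (t : ℝ) : ℝ := sInf {s : ℝ | s ∈ S ∧ t < s}

/-- The rate of change of `f` from the instant `t` to the next instant of `S`. -/
def rate {E : Type*} [AddCommGroup E] [Module ℝ E] (S : Finset ℝ) (f : ℝ → E) (t : ℝ) : E :=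
  (nextTime S t - t)⁻¹ • (f (nextTime S t) - f t)

/-- A family of elemental time sets for the interval `(t₀, t₁)`: finite subsets of `[t₀, t₁]`
containing the end-points; different elements have no other instant in common. -/
structure TimeSet {d : ℕ} {B : Set (Vec d)} (T : Tessellation B) (t₀ t₁ : ℝ) where
  times : T.Elem → Finset ℝ
  start_mem : ∀ K, t₀ ∈ times K
  end_mem : ∀ K, t₁ ∈ times K
  subset_Icc : ∀ K, ∀ t ∈ times K, t ∈ Icc t₀ t₁
  async : ∀ K L, K ≠ L → ∀ t, t ∈ times K → t ∈ times L → t = t₀ ∨ t = t₁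

namespace TimeSet

section Basic

variable {d : ℕ} {B : Set (Vec d)} {T : Tessellation B} {t₀ t₁ : ℝ} (Θ : TimeSet T t₀ t₁)

open Classical in
/-- The nodal time set `Θₐ`: the union of the time sets of the elements containing `a`. -/
def nodalTimes (a : T.Node) : Finset ℝ := (T.elemsAt a).biUnion Θ.times

/-- The elemental time steps. -/
def steps : Set ℝ :=
  {δ | ∃ K, ∃ t ∈ Θ.times K, t < t₁ ∧ δ = nextTime (Θ.times K) t - t}

/-- `T_Θ`, the maximal elemental time step. -/
def maxStep : ℝ := sSup Θ.steps

/-- The asynchronicity ratio `τ_Θ` of the maximal to the minimal elemental time step. -/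
def ratio : ℝ := sSup Θ.steps / sInf Θ.steps

/-- At no node without a boundary condition for `ν` is `ηₐ` times a nodal time step starting at an
interior nodal instant equal to `ρ̄ₐ`. -/
def Nondegenerate (c : T.Coefficients) (S : Set (Vec d)) : Prop :=
  ∀ a : T.Node, a.1 ∉ S → ∀ t ∈ Θ.nodalTimes a, t₀ < t → t < t₁ →
    c.nodalDiss a * (nextTime (Θ.nodalTimes a) t - t) ≠ c.nodalInertia a

/-- Each nodal component of `q` is affine between consecutive instants of its nodal time set. -/
def PiecewiseAffine {n : ℕ} (q : ℝ → T.NodalVec n) : Prop :=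
  ∀ a : T.Node, ∀ t ∈ Θ.nodalTimes a, t < t₁ → ∀ s ∈ Icc t (nextTime (Θ.nodalTimes a) t),
    q s a = q t a + (s - t) • rate (Θ.nodalTimes a) (fun r => q r a) t

end Basic

section Discrete

variable {d k : ℕ} {𝓑 : ComplexBody d k} {T : Tessellation 𝓑.domain} {t₀ t₁ : ℝ}
  (Θ : TimeSet T t₀ t₁) (c : T.Coefficients)

/-- The space `Y_Θ`. -/
def MemY (u : ℝ → T.NodalVec d) (ν : ℝ → T.NodalVec k) : Prop :=
  Θ.PiecewiseAffine u ∧ Θ.PiecewiseAffine ν ∧ NodalBC 𝓑 T t₀ t₁ u ν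

/-- The contribution to the action sum of the element `K` and of the time interval from the instant
`s` of its time set to the next one. -/
def elemAction (K : T.Elem) (s : ℝ) (u : ℝ → T.NodalVec d) (ν : ℝ → T.NodalVec k) : ℝ :=
  (∑ a ∈ T.nodesOf K,
    ∑ t ∈ Θ.nodalTimes a with s ≤ t ∧ t < nextTime (Θ.times K) s,
      (c.mass K a / 2 * (nextTime (Θ.nodalTimes a) t - t)
          * ‖rate (Θ.nodalTimes a) (fun r => u r a) t‖ ^ 2
        + c.inertia K a / 2 * (nextTime (Θ.nodalTimes a) t - t)
          * ‖rate (Θ.nodalTimes a) (fun r => ν r a) t‖ ^ 2))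
    - (nextTime (Θ.times K) s - s) * elemPotential 𝓑 T K (u s) (ν s)

/-- The fully discrete action sum. -/
def discreteAction (u : ℝ → T.NodalVec d) (ν : ℝ → T.NodalVec k) : ℝ :=
  ∑ K : T.Elem, ∑ s ∈ Θ.times K with s < t₁, Θ.elemAction c K s u ν

/-- The fully discretized dissipation. -/
def discreteDissipation (ν ψ : ℝ → T.NodalVec k) : ℝ :=
  ∑ a : T.Node, ∑ t ∈ Θ.nodalTimes a with t < t₁,
    c.nodalDiss a * inner ℝ (ν (nextTime (Θ.nodalTimes a) t) a - ν t a) (ψ t a)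

/-- `(u, ν)` satisfies the discrete d'Alembert-Lagrange principle. -/
structure IsDiscreteSolution (u : ℝ → T.NodalVec d) (ν : ℝ → T.NodalVec k) : Prop where
  memY : Θ.MemY u ν
  stationary : ∀ (φ : ℝ → T.NodalVec d) (ψ : ℝ → T.NodalVec k),
    Θ.MemY φ ψ → φ t₀ = 0 → φ t₁ = 0 → ψ t₀ = 0 → ψ t₁ = 0 →
      HasDerivAt (fun ε : ℝ => Θ.discreteAction c (u + ε • φ) (ν + ε • ψ))
        (-Θ.discreteDissipation c ν ψ) 0

/-- `(u, ν)` has initial values `(u₀, ν₀)` and initial velocities `(v₀, ξ₀)`. -/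
def HasInitialData (u₀ v₀ : T.NodalVec d) (ν₀ ξ₀ : T.NodalVec k)
    (u : ℝ → T.NodalVec d) (ν : ℝ → T.NodalVec k) : Prop :=
  u t₀ = u₀ ∧ ν t₀ = ν₀ ∧
    ∀ a : T.Node, rate (Θ.nodalTimes a) (fun r => u r a) t₀ = v₀ a ∧
      rate (Θ.nodalTimes a) (fun r => ν r a) t₀ = ξ₀ a

end Discrete

end TimeSet

/-- The initial data satisfy the homogeneous boundary conditions at the nodes. -/
def CompatibleData {d k : ℕ} (𝓑 : ComplexBody d k) (T : Tessellation 𝓑.domain)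
    (u₀ v₀ : T.NodalVec d) (ν₀ ξ₀ : T.NodalVec k) : Prop :=
  ∀ a : T.Node, (a.1 ∈ 𝓑.dispBdry → u₀ a = 0 ∧ v₀ a = 0) ∧
    (a.1 ∈ 𝓑.microBdry → ν₀ a = 0 ∧ ξ₀ a = 0)

end AVI

end

/-! Listing the Cartesian components of all nodal values as scalar degrees of freedom turns both
principles into finite systems of equations in time. Let m and η be the mass and the damping
coefficient of a degree of freedom, with η = 0 for the components of u. Summation by parts, tested
with hat functions, shows that the discrete principle amounts to one equation for each free degree
of freedom and each interior instant t of its grid (`isDiscreteSolution_iff`): m (r(t) - r(t⁻)) = η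
(x(t⁺) - x(t)) - J(t). Here t⁻ and t⁺ are the neighbouring instants, r(t) is the slope on [t, t⁺),
and J(t) is the sum of elemental step times gradient of the elemental potential over the elements
that have t as an instant.

J(t) depends only on values at time t, so x(t⁺) is the only new unknown. Since x(t⁺) - x(t) = (t⁺ -
t) r(t), the coefficient of r(t) is m - η (t⁺ - t), and it is nonzero exactly under the
nondegeneracy condition. Marching through the instants in increasing order then gives existence
(`exists_values`) and uniqueness (`IsTrajectory.eqOn`).

For the convergence, the elemental potentials have continuous gradients of linear growth
(`linearGradientGrowth_dofPotential`). Summed over the instants in (s, s'], the balances telescope,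
and the steps add up to s' - s within one maximal step T. Hence velocities vary by at most a
constant times the size of the solution times s' - s + 2T (`exists_velocity_estimate`). On short
time windows the size therefore at most doubles, which bounds it uniformly in the grids
(`exists_uniform_bound`). The step velocities are then equi-Lipschitz up to an error of order T, and
a variant of the Arzelà-Ascoli theorem (`exists_subseq_tendstoUniformlyOn`) yields uniform limits X
and V with V Lipschitz and X' = V.

The sums of impulses are Riemann sums of the forces, so X and V satisfy the balance of momentum
integrated in time (`exists_limit`). Integrated by parts against test functions in H¹₀, this balance
is the semi-discrete principle (`isStationary`). The Lipschitz bound on V is the W^{2,∞} regularity,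
and uniform convergence of the step velocities, which are almost everywhere the derivatives, implies
convergence in Lᵖ. -/

noncomputable section

namespace AVI

/-! ### Finite time grids -/

/-- The last instant of `S` before `t`. -/
def prevTime (S : Finset ℝ) (t : ℝ) : ℝ := sSup {s : ℝ | s ∈ S ∧ s < t}

/-- The last instant of `S` not after `t`. -/
def lastTime (S : Finset ℝ) (t : ℝ) : ℝ := sSup {s : ℝ | s ∈ S ∧ s ≤ t}

/-- The right-continuous step function of the rates of change of `f` along `S`. -/
def stepRate {E : Type*} [AddCommGroup E] [Module ℝ E] (S : Finset ℝ) (f : ℝ → E) (t : ℝ) : E :=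
  rate S f (lastTime S t)

/-- `f` is affine between consecutive instants of `S`, up to the instant `t₁`. -/
def AffineAlong (S : Finset ℝ) (t₁ : ℝ) (f : ℝ → ℝ) : Prop :=
  ∀ t ∈ S, t < t₁ → ∀ s ∈ Icc t (nextTime S t), f s = f t + (s - t) * rate S f t

section NextPrev

variable {S : Finset ℝ} {s t : ℝ}

theorem nextTime_spec (h : ∃ s ∈ S, t < s) : nextTime S t ∈ S ∧ t < nextTime S t := by
  have hfin : {s : ℝ | s ∈ S ∧ t < s}.Finite := S.finite_toSet.subset fun _ hx => hx.1
  obtain ⟨s, hs⟩ := h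
  exact Set.Nonempty.csInf_mem ⟨s, hs⟩ hfin

theorem nextTime_le (hs : s ∈ S) (h : t < s) : nextTime S t ≤ s :=
  csInf_le (S.finite_toSet.subset fun _ hx => hx.1 : {s : ℝ | s ∈ S ∧ t < s}.Finite).bddBelow
    ⟨hs, h⟩

theorem prevTime_spec (h : ∃ s ∈ S, s < t) : prevTime S t ∈ S ∧ prevTime S t < t := by
  have hfin : {s : ℝ | s ∈ S ∧ s < t}.Finite := S.finite_toSet.subset fun _ hx => hx.1
  obtain ⟨s, hs⟩ := h
  exact Set.Nonempty.csSup_mem ⟨s, hs⟩ hfin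

theorem le_prevTime (hs : s ∈ S) (h : s < t) : s ≤ prevTime S t :=
  le_csSup (S.finite_toSet.subset fun _ hx => hx.1 : {s : ℝ | s ∈ S ∧ s < t}.Finite).bddAbove
    ⟨hs, h⟩

theorem lastTime_spec (h : ∃ s ∈ S, s ≤ t) : lastTime S t ∈ S ∧ lastTime S t ≤ t := by
  have hfin : {s : ℝ | s ∈ S ∧ s ≤ t}.Finite := S.finite_toSet.subset fun _ hx => hx.1
  obtain ⟨s, hs⟩ := h
  exact Set.Nonempty.csSup_mem ⟨s, hs⟩ hfin

theorem le_lastTime (hs : s ∈ S) (h : s ≤ t) : s ≤ lastTime S t :=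
  le_csSup (S.finite_toSet.subset fun _ hx => hx.1 : {s : ℝ | s ∈ S ∧ s ≤ t}.Finite).bddAbove
    ⟨hs, h⟩

theorem lastTime_of_mem (ht : t ∈ S) : lastTime S t = t :=
  le_antisymm (lastTime_spec ⟨t, ht, le_rfl⟩).2 (le_lastTime ht le_rfl)

theorem lastTime_eq_of (hs : s ∈ S) (hst : s ≤ t) (h : ∀ r ∈ S, r ≤ t → r ≤ s) :
    lastTime S t = s := by
  have := lastTime_spec ⟨s, hs, hst⟩
  exact le_antisymm (h _ this.1 this.2) (le_lastTime hs hst)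

theorem nextTime_prevTime (ht : t ∈ S) (h : ∃ s ∈ S, s < t) : nextTime S (prevTime S t) = t := by
  have hp := prevTime_spec h
  have hn := nextTime_spec (S := S) (t := prevTime S t) ⟨t, ht, hp.2⟩
  refine le_antisymm (nextTime_le ht hp.2) (not_lt.1 fun hlt => ?_)
  exact absurd (le_prevTime hn.1 hlt) (not_le.2 hn.2)

theorem prevTime_nextTime (ht : t ∈ S) (h : ∃ s ∈ S, t < s) : prevTime S (nextTime S t) = t := by
  have hn := nextTime_spec h
  have hp := prevTime_spec (S := S) (t := nextTime S t) ⟨t, ht, hn.2⟩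
  refine le_antisymm (not_lt.1 fun hlt => ?_) (le_prevTime ht hn.2)
  exact absurd (nextTime_le hp.1 hlt) (not_le.2 hp.2)

theorem lastTime_of_mem_Ico (ht : t ∈ S) (hs : s ∈ Ico t (nextTime S t)) : lastTime S s = t :=
  lastTime_eq_of ht hs.1 fun _ hr hrs => not_lt.1 fun hlt =>
    absurd (nextTime_le hr hlt) (not_le.2 (hrs.trans_lt hs.2))

end NextPrev

/-- A finite subset of `[t₀, t₁]` that contains the end-points. -/
structure IsGrid (S : Finset ℝ) (t₀ t₁ : ℝ) : Prop where
  lt : t₀ < t₁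
  start_mem : t₀ ∈ S
  end_mem : t₁ ∈ S
  subset_Icc : ∀ t ∈ S, t ∈ Icc t₀ t₁

namespace IsGrid

variable {S : Finset ℝ} {t₀ t₁ s s' t : ℝ} (hS : IsGrid S t₀ t₁)

include hS

theorem next_mem (ht : t < t₁) : nextTime S t ∈ S := (nextTime_spec ⟨t₁, hS.end_mem, ht⟩).1

theorem lt_next (ht : t < t₁) : t < nextTime S t := (nextTime_spec ⟨t₁, hS.end_mem, ht⟩).2

theorem next_le (ht : t < t₁) : nextTime S t ≤ t₁ := nextTime_le hS.end_mem ht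

theorem prev_mem (ht : t₀ < t) : prevTime S t ∈ S := (prevTime_spec ⟨t₀, hS.start_mem, ht⟩).1

theorem prev_lt (ht : t₀ < t) : prevTime S t < t := (prevTime_spec ⟨t₀, hS.start_mem, ht⟩).2

theorem le_prev (ht : t₀ < t) : t₀ ≤ prevTime S t := le_prevTime hS.start_mem ht

theorem next_prev (hS' : t ∈ S) (ht : t₀ < t) : nextTime S (prevTime S t) = t :=
  nextTime_prevTime hS' ⟨t₀, hS.start_mem, ht⟩

theorem prev_next (hS' : t ∈ S) (ht : t < t₁) : prevTime S (nextTime S t) = t :=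
  prevTime_nextTime hS' ⟨t₁, hS.end_mem, ht⟩

theorem last_mem (ht : t₀ ≤ t) : lastTime S t ∈ S := (lastTime_spec ⟨t₀, hS.start_mem, ht⟩).1

theorem last_le (ht : t₀ ≤ t) : lastTime S t ≤ t := (lastTime_spec ⟨t₀, hS.start_mem, ht⟩).2

theorem last_lt_end (ht : t₀ ≤ t) (ht' : t < t₁) : lastTime S t < t₁ :=
  (hS.last_le ht).trans_lt ht'

theorem lt_next_last (ht : t₀ ≤ t) (ht' : t < t₁) : t < nextTime S (lastTime S t) := by
  refine not_le.1 fun h => ?_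
  have := le_lastTime (hS.next_mem (hS.last_lt_end ht ht')) h
  exact absurd this (not_le.2 (hS.lt_next (hS.last_lt_end ht ht')))

theorem mem_cell (ht : t₀ ≤ t) (ht' : t < t₁) :
    t ∈ Ico (lastTime S t) (nextTime S (lastTime S t)) :=
  ⟨hS.last_le ht, hS.lt_next_last ht ht'⟩

/-- Telescoping over the instants in (s, s'], where s and s' need not be instants. The induction on
the number of these instants removes the last one. -/
theorem sum_sub_prev (F : ℝ → ℝ) (hs : t₀ ≤ s) (hss : s ≤ s') :
    ∑ t ∈ S with s < t ∧ t ≤ s', (F t - F (prevTime S t)) =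
      F (lastTime S s') - F (lastTime S s) := by
  have hs' : t₀ ≤ s' := hs.trans hss
  induction hn : (S.filter fun t => s < t ∧ t ≤ s').card using Nat.strong_induction_on
    generalizing s' with
  | _ n ih =>
    subst hn
    set m := lastTime S s' with hm
    have hmS := hS.last_mem hs'
    have hms := hS.last_le hs'
    rcases le_or_gt m s with hms' | hsm
    · have : lastTime S s = m :=
        lastTime_eq_of hmS hms' fun _ hr hrs => le_lastTime hr (hrs.trans hss)
      rw [this, sub_self]
      refine Finset.sum_eq_zero fun t ht => ?_
      rw [Finset.mem_filter] at ht
      exact absurd (le_lastTime ht.1 ht.2.2) (not_le.2 (hms'.trans_lt ht.2.1))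
    · have h0m : t₀ < m := hs.trans_lt hsm
      -- Lowering s' to p removes exactly the instant m. The maximum keeps s ≤ p when the instant
      -- before m lies before s.
      set p := max s (prevTime S m) with hp
      have hpm : p < m := max_lt hsm (hS.prev_lt h0m)
      have hsp : s ≤ p := le_max_left _ _
      have hset : (S.filter fun t => s < t ∧ t ≤ s') =
          insert m (S.filter fun t => s < t ∧ t ≤ p) := by
        ext t
        simp only [Finset.mem_filter, Finset.mem_insert]
        constructor
        · rintro ⟨htS, hst, hts⟩
          rcases (le_lastTime htS hts).lt_or_eq with h | h
          · exact Or.inr ⟨htS, hst, (le_prevTime htS h).trans (le_max_right _ _)⟩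
          · exact Or.inl h
        · rintro (rfl | ⟨htS, hst, htp⟩)
          · exact ⟨hmS, hsm, hms⟩
          · exact ⟨htS, hst, (htp.trans hpm.le).trans hms⟩
      have hnot : m ∉ S.filter fun t => s < t ∧ t ≤ p := by
        simp only [Finset.mem_filter, not_and, not_le]
        exact fun _ _ => hpm
      have hlast : lastTime S p = prevTime S m := by
        have hpS := hS.prev_mem h0m
        refine lastTime_eq_of hpS (le_max_right _ _) fun r hr hrp => ?_
        exact le_prevTime hr (hrp.trans_lt hpm)
      rw [hset, Finset.sum_insert hnot, ih _ _ hsp (hs.trans hsp) rfl, hlast]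
      · ring
      · rw [hset, Finset.card_insert_of_notMem hnot]; omega

theorem sum_next_sub (G : ℝ → ℝ) (hs : t₀ ≤ s) (hss : s ≤ s') :
    ∑ t ∈ S with s < t ∧ t ≤ s', (G (nextTime S t) - G t) =
      G (nextTime S (lastTime S s')) - G (nextTime S (lastTime S s)) := by
  rw [← hS.sum_sub_prev (fun t => G (nextTime S t)) hs hss]
  refine Finset.sum_congr rfl fun t ht => ?_
  rw [Finset.mem_filter] at ht
  simp only [hS.next_prev ht.1 (hs.trans_lt ht.2.1)]

/-- The steps that start in (s, s'] tile an interval that begins after s and ends at most T after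
s'. -/
theorem sum_steps_le {T : ℝ} (hT : ∀ t ∈ S, t < t₁ → nextTime S t - t ≤ T)
    (hs : t₀ ≤ s) (hss : s ≤ s') (hs' : s' < t₁) :
    ∑ t ∈ S with s < t ∧ t ≤ s', (nextTime S t - t) ≤ s' - s + T := by
  have h0 := hS.sum_next_sub id hs hss
  simp only [id] at h0
  rw [h0]
  have h1 := hT _ (hS.last_mem (hs.trans hss)) (hS.last_lt_end (hs.trans hss) hs')
  have h2 := hS.last_le (hs.trans hss)
  have h3 := hS.lt_next_last hs (hss.trans_lt hs')
  linarith

/-- Summation by parts along a grid. -/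
theorem sum_mul_next_sub (r φ : ℝ → ℝ) (h0 : φ t₀ = 0) (h1 : φ t₁ = 0) :
    ∑ t ∈ S with t < t₁, r t * (φ (nextTime S t) - φ t) =
      ∑ t ∈ S with t₀ < t ∧ t < t₁, (r (prevTime S t) - r t) * φ t := by
  -- The successor map is a bijection from the instants before t₁ onto those after t₀, with the
  -- predecessor map as inverse.
  have e1 : ∑ t ∈ S with t < t₁, r t * φ (nextTime S t) =
      ∑ t ∈ S with t₀ < t, r (prevTime S t) * φ t := by
    refine Finset.sum_bij' (fun t _ => nextTime S t) (fun t _ => prevTime S t) ?_ ?_ ?_ ?_ ?_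
    · intro t ht
      rw [Finset.mem_filter] at ht ⊢
      exact ⟨hS.next_mem ht.2, (hS.subset_Icc t ht.1).1.trans_lt (hS.lt_next ht.2)⟩
    · intro t ht
      rw [Finset.mem_filter] at ht ⊢
      exact ⟨hS.prev_mem ht.2, (hS.prev_lt ht.2).trans_le (hS.subset_Icc t ht.1).2⟩
    · intro t ht
      rw [Finset.mem_filter] at ht
      exact hS.prev_next ht.1 ht.2
    · intro t ht
      rw [Finset.mem_filter] at ht
      exact hS.next_prev ht.1 ht.2
    · intro t ht
      rw [Finset.mem_filter] at ht
      rw [hS.prev_next ht.1 ht.2]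
  have e2 : ∑ t ∈ S with t₀ < t, r (prevTime S t) * φ t =
      ∑ t ∈ S with t₀ < t ∧ t < t₁, r (prevTime S t) * φ t := by
    symm
    refine Finset.sum_subset (fun t ht => ?_) fun t ht ht' => ?_
    · rw [Finset.mem_filter] at ht ⊢
      exact ⟨ht.1, ht.2.1⟩
    · rw [Finset.mem_filter] at ht ht'
      have : t = t₁ := le_antisymm (hS.subset_Icc t ht.1).2
        (not_lt.1 fun h => ht' ⟨ht.1, ht.2, h⟩)
      rw [this, h1, mul_zero]
  have e3 : ∑ t ∈ S with t < t₁, r t * φ t =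
      ∑ t ∈ S with t₀ < t ∧ t < t₁, r t * φ t := by
    symm
    refine Finset.sum_subset (fun t ht => ?_) fun t ht ht' => ?_
    · rw [Finset.mem_filter] at ht ⊢
      exact ⟨ht.1, ht.2.2⟩
    · rw [Finset.mem_filter] at ht ht'
      have : t = t₀ := le_antisymm (not_lt.1 fun h => ht' ⟨ht.1, h, ht.2⟩)
        (hS.subset_Icc t ht.1).1
      rw [this, h0, mul_zero]
  simp only [mul_sub, sub_mul, Finset.sum_sub_distrib]
  rw [e1, e2, e3]

/-- A sum over the instants of a finer grid, split according to the cells of a coarser one. -/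
theorem sum_cells {S' : Finset ℝ} (hS' : IsGrid S' t₀ t₁) (F : ℝ → ℝ) :
    ∑ s ∈ S with s < t₁, ∑ t ∈ S' with s ≤ t ∧ t < nextTime S s, F t =
      ∑ t ∈ S' with t < t₁, F t := by
  have hmaps : ∀ t ∈ S'.filter (· < t₁), lastTime S t ∈ S.filter (· < t₁) := by
    intro t ht
    rw [Finset.mem_filter] at ht ⊢
    have h0 := (hS'.subset_Icc t ht.1).1
    exact ⟨hS.last_mem h0, hS.last_lt_end h0 ht.2⟩
  rw [← Finset.sum_fiberwise_of_maps_to hmaps]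
  refine Finset.sum_congr rfl fun s hs => Finset.sum_congr ?_ fun _ _ => rfl
  rw [Finset.mem_filter] at hs
  ext t
  simp only [Finset.mem_filter]
  constructor
  · rintro ⟨htS, hst⟩
    exact ⟨⟨htS, hst.2.trans_le (hS.next_le hs.2)⟩, lastTime_of_mem_Ico hs.1 hst⟩
  · rintro ⟨⟨htS, ht1⟩, rfl⟩
    exact ⟨htS, hS.mem_cell (hS'.subset_Icc t htS).1 ht1⟩

end IsGrid

/-! ### Piecewise affine functions along a grid -/

theorem rate_mul_step {S : Finset ℝ} {f : ℝ → ℝ} {t : ℝ} (h : t < nextTime S t) :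
    (nextTime S t - t) * rate S f t = f (nextTime S t) - f t := by
  have : nextTime S t - t ≠ 0 := by linarith
  simp only [rate, smul_eq_mul]
  field_simp

namespace AffineAlong

variable {S : Finset ℝ} {t₀ t₁ s s' t : ℝ} {f : ℝ → ℝ}

theorem eq_last (hf : AffineAlong S t₁ f) (hS : IsGrid S t₀ t₁) (ht : t₀ ≤ t) (ht' : t < t₁) :
    f t = f (lastTime S t) + (t - lastTime S t) * stepRate S f t :=
  hf _ (hS.last_mem ht) (hS.last_lt_end ht ht') t (Ico_subset_Icc_self (hS.mem_cell ht ht'))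

theorem next_last (hf : AffineAlong S t₁ f) (hS : IsGrid S t₀ t₁) (ht : t₀ ≤ t) (ht' : t < t₁) :
    f (nextTime S (lastTime S t)) =
      f t + (nextTime S (lastTime S t) - t) * stepRate S f t := by
  have h1 := hf.eq_last hS ht ht'
  have h2 := rate_mul_step (f := f) (hS.lt_next (hS.last_lt_end ht ht'))
  rw [stepRate] at *
  linear_combination (-1 : ℝ) * h2 - h1

theorem continuousOn (hf : AffineAlong S t₁ f) (hS : IsGrid S t₀ t₁) :
    ContinuousOn f (Icc t₀ t₁) := by
  have hcov : Icc t₀ t₁ ⊆ ⋃ t : {t // t ∈ S.filter (· < t₁)}, Icc t.1 (nextTime S t.1) := by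
    intro s hs
    rw [mem_iUnion]
    rcases hs.2.lt_or_eq with h | h
    · exact ⟨⟨lastTime S s, Finset.mem_filter.2 ⟨hS.last_mem hs.1, hS.last_lt_end hs.1 h⟩⟩,
        Ico_subset_Icc_self (hS.mem_cell hs.1 h)⟩
    · refine ⟨⟨prevTime S t₁, Finset.mem_filter.2 ⟨hS.prev_mem hS.lt, hS.prev_lt hS.lt⟩⟩, ?_⟩
      simp only [hS.next_prev hS.end_mem hS.lt, h]
      exact ⟨(hS.prev_lt hS.lt).le, le_rfl⟩
  refine ContinuousOn.mono ?_ hcov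
  refine LocallyFinite.continuousOn_iUnion (locallyFinite_of_finite _) (fun _ => isClosed_Icc) ?_
  rintro ⟨t, ht⟩
  rw [Finset.mem_filter] at ht
  refine ContinuousOn.congr (f := fun s => f t + (s - t) * rate S f t) (by fun_prop) ?_
  exact fun s hs => hf t ht.1 ht.2 s hs

/-- The step function of the slopes is right-continuous, so it is the right derivative at every
time, the instants of the grid included. Mean value inequalities thus apply without exceptional
points. -/
theorem hasDerivWithinAt (hf : AffineAlong S t₁ f) (hS : IsGrid S t₀ t₁) (ht : t₀ ≤ t)
    (ht' : t < t₁) : HasDerivWithinAt f (stepRate S f t) (Ici t) t := by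
  have hc := hS.mem_cell ht ht'
  have h1 : HasDerivWithinAt (fun s => f (lastTime S t) + (s - lastTime S t) * stepRate S f t)
      (stepRate S f t) (Ici t) t := by
    simpa using (((hasDerivAt_id t).sub_const (lastTime S t)).mul_const
      (stepRate S f t)).const_add (f (lastTime S t)) |>.hasDerivWithinAt
  refine h1.congr_of_eventuallyEq ?_ (hf.eq_last hS ht ht')
  have : Ico t (nextTime S (lastTime S t)) ∈ 𝓝[≥] t := Ico_mem_nhdsGE hc.2
  filter_upwards [this] with s hs
  exact hf _ (hS.last_mem ht) (hS.last_lt_end ht ht') s ⟨hc.1.trans hs.1, hs.2.le⟩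

theorem hasDerivAt (hf : AffineAlong S t₁ f) (hS : IsGrid S t₀ t₁) (ht : t ∈ Ioo t₀ t₁)
    (htS : t ∉ S) : HasDerivAt f (stepRate S f t) t := by
  have hc := hS.mem_cell ht.1.le ht.2
  have hlt : lastTime S t < t := lt_of_le_of_ne hc.1 fun h => htS (h ▸ hS.last_mem ht.1.le)
  have h1 : HasDerivAt (fun s => f (lastTime S t) + (s - lastTime S t) * stepRate S f t)
      (stepRate S f t) t := by
    simpa using (((hasDerivAt_id t).sub_const (lastTime S t)).mul_const
      (stepRate S f t)).const_add (f (lastTime S t))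
  refine h1.congr_of_eventuallyEq ?_
  filter_upwards [Ioo_mem_nhds hlt hc.2] with s hs
  exact hf _ (hS.last_mem ht.1.le) (hS.last_lt_end ht.1.le ht.2) s ⟨hs.1.le, hs.2.le⟩

/-- The mean value inequality for right derivatives, applied to f r - c r. The choice c = 0 gives
Lipschitz bounds; taking for c the velocity at s gives the second-order estimate that identifies the
derivative of the limit. -/
theorem abs_sub_sub_le (hf : AffineAlong S t₁ f) (hS : IsGrid S t₀ t₁) {c B : ℝ}
    (hs : t₀ ≤ s) (hss : s ≤ s') (hs' : s' ≤ t₁)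
    (hB : ∀ r ∈ Ico s s', |stepRate S f r - c| ≤ B) :
    |f s' - f s - c * (s' - s)| ≤ B * (s' - s) := by
  have hcont : ContinuousOn (fun r => f r - c * r) (Icc s s') :=
    ((hf.continuousOn hS).mono (Icc_subset_Icc hs hs')).sub (by fun_prop)
  have hder : ∀ r ∈ Ico s s',
      HasDerivWithinAt (fun r => f r - c * r) (stepRate S f r - c) (Ici r) r := by
    intro r hr
    have := (hf.hasDerivWithinAt hS (hs.trans hr.1) (hr.2.trans_le hs')).fun_sub
      (((hasDerivAt_id r).const_mul c).hasDerivWithinAt (s := Ici r))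
    simpa using this
  have := norm_image_sub_le_of_norm_deriv_right_le_segment hcont hder
    (C := B) (by simpa only [Real.norm_eq_abs] using hB) s' ⟨hss, le_rfl⟩
  rw [Real.norm_eq_abs] at this
  convert this using 2
  ring

theorem eqOn_of_eq (hf : AffineAlong S t₁ f) {g : ℝ → ℝ} (hg : AffineAlong S t₁ g)
    (hS : IsGrid S t₀ t₁) (h : ∀ t ∈ S, f t = g t) : EqOn f g (Icc t₀ t₁) := by
  intro t ht
  rcases ht.2.lt_or_eq with h' | h'
  · rw [hf.eq_last hS ht.1 h', hg.eq_last hS ht.1 h', h _ (hS.last_mem ht.1)]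
    simp only [stepRate, rate, h _ (hS.last_mem ht.1),
      h _ (hS.next_mem (hS.last_lt_end ht.1 h'))]
  · rw [h', h _ hS.end_mem]

end AffineAlong

/-- The piecewise affine interpolation along `S` of the values of `v` at the instants of `S`. -/
def interpAlong (S : Finset ℝ) (v : ℝ → ℝ) (t : ℝ) : ℝ :=
  v (lastTime S t) + (t - lastTime S t) * rate S v (lastTime S t)

theorem interpAlong_of_mem {S : Finset ℝ} {t : ℝ} (v : ℝ → ℝ) (ht : t ∈ S) :
    interpAlong S v t = v t := by
  simp [interpAlong, lastTime_of_mem ht]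

theorem rate_interpAlong {S : Finset ℝ} {t₀ t₁ t : ℝ} (hS : IsGrid S t₀ t₁) (v : ℝ → ℝ)
    (ht : t ∈ S) (ht' : t < t₁) : rate S (interpAlong S v) t = rate S v t := by
  simp only [rate, interpAlong_of_mem v ht, interpAlong_of_mem v (hS.next_mem ht')]

theorem affineAlong_interpAlong {S : Finset ℝ} {t₀ t₁ : ℝ} (hS : IsGrid S t₀ t₁) (v : ℝ → ℝ) :
    AffineAlong S t₁ (interpAlong S v) := by
  intro t ht ht' s hs
  rw [rate_interpAlong hS v ht ht', interpAlong_of_mem v ht]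
  rcases hs.2.lt_or_eq with h | h
  · simp only [interpAlong, lastTime_of_mem_Ico ht ⟨hs.1, h⟩]
  · rw [h, interpAlong_of_mem v (hS.next_mem ht'), rate_mul_step (hS.lt_next ht')]
    ring

theorem interpAlong_eq_zero {S : Finset ℝ} {t₀ t₁ t : ℝ} (hS : IsGrid S t₀ t₁) {v : ℝ → ℝ}
    (hv : ∀ t ∈ S, v t = 0) (ht : t ∈ Icc t₀ t₁) : interpAlong S v t = 0 := by
  have h0 : AffineAlong S t₁ (fun _ => 0) := by
    intro t _ _ s _; simp [rate]
  exact (affineAlong_interpAlong hS v).eqOn_of_eq h0 hS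
    (fun t ht => by rw [interpAlong_of_mem v ht, hv t ht]) ht

/-! ### Asynchronous schemes for systems with finitely many scalar degrees of freedom -/

/-- A system with degrees of freedom `ι` and elements `κ`: inertia and damping coefficients, the
degrees of freedom that are kept at zero, and the forces `force K i x` that the element `K` exerts
on the degree of freedom `i` in the configuration `x`. -/
structure ForceSystem (ι κ : Type*) [Fintype ι] where
  elems : ι → Finset κ
  elems_nonempty : ∀ i, (elems i).Nonempty
  mass : ι → ℝ
  damp : ι → ℝ
  fixed : ι → Prop
  force : κ → ι → (ι → ℝ) → ℝ
  mass_pos : ∀ i, 0 < mass i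
  damp_nonneg : ∀ i, 0 ≤ damp i
  force_continuous : ∀ K i, Continuous (force K i)
  force_growth : ∃ C, ∀ K i x, |force K i x| ≤ C * (1 + ‖x‖)
  force_local : ∀ K i x y, (∀ j, K ∈ elems j → x j = y j) → force K i x = force K i y

namespace ForceSystem

variable {ι κ : Type*} [Fintype ι] (P : ForceSystem ι κ)

/-- Time grids for the elements, and the induced grids for the degrees of freedom. -/
structure Grids (t₀ t₁ : ℝ) where
  elemTimes : κ → Finset ℝ
  dofTimes : ι → Finset ℝ
  elem_grid : ∀ K, IsGrid (elemTimes K) t₀ t₁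
  mem_dofTimes : ∀ i t, t ∈ dofTimes i ↔ ∃ K ∈ P.elems i, t ∈ elemTimes K

namespace Grids

variable {P} {t₀ t₁ : ℝ} (Θ : P.Grids t₀ t₁)

theorem dof_grid (i : ι) : IsGrid (Θ.dofTimes i) t₀ t₁ where
  lt := (Θ.elem_grid (P.elems_nonempty i).choose).lt
  start_mem := (Θ.mem_dofTimes i t₀).2
    ⟨_, (P.elems_nonempty i).choose_spec, (Θ.elem_grid _).start_mem⟩
  end_mem := (Θ.mem_dofTimes i t₁).2
    ⟨_, (P.elems_nonempty i).choose_spec, (Θ.elem_grid _).end_mem⟩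
  subset_Icc t ht := by
    obtain ⟨K, -, hK⟩ := (Θ.mem_dofTimes i t).1 ht
    exact (Θ.elem_grid K).subset_Icc t hK

open Classical in
/-- The impulse that the elements exert at the instant `t` on the degree of freedom `i`. -/
def impulse (i : ι) (t : ℝ) (x : ι → ℝ) : ℝ :=
  ∑ K ∈ P.elems i with t ∈ Θ.elemTimes K, (nextTime (Θ.elemTimes K) t - t) * P.force K i x

/-- The balance of momentum of the degree of freedom `i` at the instant `t`. -/
def Balance (x : ℝ → ι → ℝ) (i : ι) (t : ℝ) : Prop :=
  P.mass i * (rate (Θ.dofTimes i) (fun r => x r i) t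
      - rate (Θ.dofTimes i) (fun r => x r i) (prevTime (Θ.dofTimes i) t)) =
    P.damp i * (x (nextTime (Θ.dofTimes i) t) i - x t i) - Θ.impulse i t (x t)

/-- `x` is a trajectory of the asynchronous scheme. -/
structure IsTrajectory (x : ℝ → ι → ℝ) : Prop where
  affine : ∀ i, AffineAlong (Θ.dofTimes i) t₁ fun t => x t i
  fixed : ∀ i, P.fixed i → ∀ t ∈ Icc t₀ t₁, x t i = 0
  balance : ∀ i, ¬ P.fixed i → ∀ t ∈ Θ.dofTimes i, t₀ < t → t < t₁ → Θ.Balance x i t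

/-- The scheme can be solved for the next value of every free degree of freedom. -/
def Solvable : Prop :=
  ∀ i, ¬ P.fixed i → ∀ t ∈ Θ.dofTimes i, t₀ < t → t < t₁ →
    P.damp i * (nextTime (Θ.dofTimes i) t - t) ≠ P.mass i

/-- By locality of the forces, the elements acting at t see only degrees of freedom that have t in
their grids. The balance therefore involves values at grid instants only, and is unaffected by
interpolation or by changes at later times. -/
theorem balance_congr {i : ι} {t : ℝ} {x y : ℝ → ι → ℝ} (hit : t ∈ Θ.dofTimes i) (h0 : t₀ < t)
    (hnext : x (nextTime (Θ.dofTimes i) t) i = y (nextTime (Θ.dofTimes i) t) i)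
    (hprev : x (prevTime (Θ.dofTimes i) t) i = y (prevTime (Θ.dofTimes i) t) i)
    (ht : ∀ j, t ∈ Θ.dofTimes j → x t j = y t j) :
    Θ.Balance x i t ↔ Θ.Balance y i t := by
  have himp : Θ.impulse i t (x t) = Θ.impulse i t (y t) := by
    refine Finset.sum_congr rfl fun K hK => ?_
    rw [Finset.mem_filter] at hK
    rw [P.force_local K i (x t) (y t) fun j hj => ht j ((Θ.mem_dofTimes j t).2 ⟨K, hj, hK.2⟩)]
  have hn := (Θ.dof_grid i).next_prev hit h0
  simp only [Balance, rate, himp, hnext, ht i hit, hn, hprev]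

/-- Explicit time marching, as an induction that adds an instant later than all those treated
before. Each new instant fixes one later value for every degree of freedom that has it in its grid,
and this value occurs in none of the earlier balances. -/
theorem exists_values (hsolv : Θ.Solvable) (x₀ v₀ : ι → ℝ)
    (hfix : ∀ i, P.fixed i → x₀ i = 0 ∧ v₀ i = 0) (A : Finset ℝ)
    (hA : ∀ t ∈ A, t₀ < t ∧ t < t₁) :
    ∃ x : ℝ → ι → ℝ, x t₀ = x₀ ∧ (∀ i, rate (Θ.dofTimes i) (fun r => x r i) t₀ = v₀ i) ∧
      (∀ i, P.fixed i → ∀ t, x t i = 0) ∧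
      ∀ i, ¬ P.fixed i → ∀ t ∈ A, t ∈ Θ.dofTimes i → Θ.Balance x i t := by
  classical
  induction A using Finset.induction_on_max with
  | empty =>
    -- Uniform motion has the prescribed initial rate wherever the first step of the grid ends.
    refine ⟨fun t i => x₀ i + (t - t₀) * v₀ i, by simp, fun i => ?_, fun i hi t => ?_, by simp⟩
    · have := (Θ.dof_grid i).lt_next (Θ.dof_grid i).lt
      have : nextTime (Θ.dofTimes i) t₀ - t₀ ≠ 0 := by linarith
      simp only [rate, smul_eq_mul]
      field_simp
      ring
    · change x₀ i + (t - t₀) * v₀ i = 0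
      rw [(hfix i hi).1, (hfix i hi).2]; simp
  | insert s A hs ih =>
    obtain ⟨x, hx0, hxv, hxf, hxb⟩ := ih fun t ht => hA t (Finset.mem_insert_of_mem ht)
    obtain ⟨hs0, hs1⟩ := hA s (Finset.mem_insert_self _ _)
    set Δ : ι → ℝ := fun i => nextTime (Θ.dofTimes i) s - s with hΔ
    -- The balance solved for the next value. The damping term is implicit and equals damping times
    -- `Δ i` times the unknown rate, hence the denominator.
    set new : ι → ℝ := fun i => if P.fixed i then 0 else x s i + Δ i *
      ((P.mass i * rate (Θ.dofTimes i) (fun r => x r i) (prevTime (Θ.dofTimes i) s)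
        - Θ.impulse i s (x s)) / (P.mass i - P.damp i * Δ i)) with hnew
    set y : ℝ → ι → ℝ := fun t i =>
      if s ∈ Θ.dofTimes i ∧ t = nextTime (Θ.dofTimes i) s then new i else x t i with hy
    have hyx : ∀ t ≤ s, ∀ i, y t i = x t i := by
      intro t hts i
      simp only [hy]
      rw [if_neg]
      rintro ⟨-, h2⟩
      have := (Θ.dof_grid i).lt_next hs1
      linarith
    -- If s is in the grid of i and t < s, the successor of t is at most s, while the modified value
    -- sits strictly after s.
    have hynext : ∀ t < s, ∀ i, y (nextTime (Θ.dofTimes i) t) i =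
        x (nextTime (Θ.dofTimes i) t) i := by
      intro t hts i
      simp only [hy]
      rw [if_neg]
      rintro ⟨h1, h2⟩
      have h3 := (Θ.dof_grid i).lt_next hs1
      have h4 := nextTime_le h1 hts
      linarith
    refine ⟨y, ?_, fun i => ?_, fun i hi t => ?_, fun i hi t ht hit => ?_⟩
    · rw [← hx0]; exact funext fun i => hyx t₀ hs0.le i
    · rw [← hxv i]; simp only [rate, hynext t₀ hs0, hyx t₀ hs0.le]
    · simp only [hy, hnew, if_pos hi, hxf i hi t, ite_self]
    · obtain ⟨ht0, ht1⟩ := hA t ht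
      have hpt := (Θ.dof_grid i).prev_lt ht0
      rcases Finset.mem_insert.1 ht with rfl | htA
      · have hne : P.mass i - P.damp i * Δ i ≠ 0 :=
          sub_ne_zero.2 (hsolv i hi t hit ht0 ht1).symm
        have hΔ0 : nextTime (Θ.dofTimes i) t - t ≠ 0 := by
          have := (Θ.dof_grid i).lt_next ht1
          linarith
        have himp : Θ.impulse i t (y t) = Θ.impulse i t (x t) := by
          rw [show y t = x t from funext fun j => hyx t le_rfl j]
        have hprev : rate (Θ.dofTimes i) (fun r => y r i) (prevTime (Θ.dofTimes i) t) =
            rate (Θ.dofTimes i) (fun r => x r i) (prevTime (Θ.dofTimes i) t) := by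
          simp only [rate, (Θ.dof_grid i).next_prev hit ht0, hyx t le_rfl, hyx _ hpt.le]
        have hyn : y (nextTime (Θ.dofTimes i) t) i = new i := if_pos ⟨hit, rfl⟩
        rw [Balance, himp, hprev]
        set R := rate (Θ.dofTimes i) (fun r => x r i) (prevTime (Θ.dofTimes i) t)
        set J := Θ.impulse i t (x t)
        have hni : new i = x t i + Δ i * ((P.mass i * R - J) / (P.mass i - P.damp i * Δ i)) :=
          if_neg hi
        have hr : rate (Θ.dofTimes i) (fun r => y r i) t =
            (P.mass i * R - J) / (P.mass i - P.damp i * Δ i) := by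
          change (nextTime (Θ.dofTimes i) t - t)⁻¹ * (y (nextTime (Θ.dofTimes i) t) i - y t i) = _
          rw [hyn, hyx t le_rfl, hni, add_sub_cancel_left]
          exact inv_mul_cancel_left₀ hΔ0 _
        rw [hr, hyn, hyx t le_rfl, hni]
        field_simp
        ring
      · have hts := hs t htA
        exact (Θ.balance_congr hit ht0 (hynext t hts i) (hyx _ (hpt.le.trans hts.le) i)
          fun j _ => hyx t hts.le j).2 (hxb i hi t htA hit)

variable [Fintype κ]

open Classical in
theorem exists_isTrajectory (hsolv : Θ.Solvable) (x₀ v₀ : ι → ℝ)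
    (hfix : ∀ i, P.fixed i → x₀ i = 0 ∧ v₀ i = 0) :
    ∃ x : ℝ → ι → ℝ, Θ.IsTrajectory x ∧ x t₀ = x₀ ∧
      ∀ i, rate (Θ.dofTimes i) (fun r => x r i) t₀ = v₀ i := by
  obtain ⟨x, hx0, hxv, hxf, hxb⟩ := Θ.exists_values hsolv x₀ v₀ hfix
    ((Finset.univ.biUnion Θ.elemTimes).filter fun t => t₀ < t ∧ t < t₁)
    fun t ht => (Finset.mem_filter.1 ht).2
  set y : ℝ → ι → ℝ := fun t i => interpAlong (Θ.dofTimes i) (fun r => x r i) t with hy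
  have hyx : ∀ i, ∀ t ∈ Θ.dofTimes i, y t i = x t i := fun i t ht => interpAlong_of_mem _ ht
  refine ⟨y, ⟨fun i => affineAlong_interpAlong (Θ.dof_grid i) _, fun i hi t ht => ?_,
    fun i hi t ht h0 h1 => ?_⟩, ?_, fun i => ?_⟩
  · exact interpAlong_eq_zero (Θ.dof_grid i) (fun s _ => hxf i hi s) ht
  · have hg := Θ.dof_grid i
    refine (Θ.balance_congr ht h0 (hyx i _ (hg.next_mem h1)) (hyx i _ (hg.prev_mem h0))
      (fun j hj => hyx j t hj)).2 (hxb i hi t ?_ ht)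
    obtain ⟨K, -, hK⟩ := (Θ.mem_dofTimes i t).1 ht
    exact Finset.mem_filter.2 ⟨Finset.mem_biUnion.2 ⟨K, Finset.mem_univ _, hK⟩, h0, h1⟩
  · rw [← hx0]; exact funext fun i => hyx i t₀ (Θ.dof_grid i).start_mem
  · rw [← hxv i]
    exact rate_interpAlong (Θ.dof_grid i) _ (Θ.dof_grid i).start_mem (Θ.dof_grid i).lt

open Classical in
-- At the earliest instant t at which two trajectories differ, say in the degree of freedom i, let s
-- be the preceding instant of i. All data of the balance at s agree, and solvability makes the rate
-- on [s, t], hence the value at t, unique.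
theorem IsTrajectory.eqOn {Θ : P.Grids t₀ t₁} (hsolv : Θ.Solvable) {x y : ℝ → ι → ℝ}
    (hx : Θ.IsTrajectory x) (hy : Θ.IsTrajectory y) (h0 : x t₀ = y t₀)
    (hv : ∀ i, rate (Θ.dofTimes i) (fun r => x r i) t₀ =
      rate (Θ.dofTimes i) (fun r => y r i) t₀) : EqOn x y (Icc t₀ t₁) := by
  suffices h : ∀ i, ∀ t ∈ Θ.dofTimes i, x t i = y t i from fun t ht => funext fun i =>
    (hx.affine i).eqOn_of_eq (hy.affine i) (Θ.dof_grid i) (h i) ht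
  by_contra! hne
  obtain ⟨i₀, s₀, hs₀, hne₀⟩ := hne
  set A := (Finset.univ.biUnion Θ.elemTimes).filter
    fun t => ∃ i, t ∈ Θ.dofTimes i ∧ x t i ≠ y t i with hA
  have hmem : ∀ i, ∀ t ∈ Θ.dofTimes i, x t i ≠ y t i → t ∈ A := by
    intro i t ht hne
    obtain ⟨K, -, hK⟩ := (Θ.mem_dofTimes i t).1 ht
    exact Finset.mem_filter.2 ⟨Finset.mem_biUnion.2 ⟨K, Finset.mem_univ _, hK⟩, i, ht, hne⟩
  have hAne : A.Nonempty := ⟨s₀, hmem i₀ s₀ hs₀ hne₀⟩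
  obtain ⟨i, hit, hxy⟩ := (Finset.mem_filter.1 (A.min'_mem hAne)).2
  set t := A.min' hAne with ht
  have hlt : ∀ j, ∀ s ∈ Θ.dofTimes j, s < t → x s j = y s j := fun j s hs hst =>
    not_ne_iff.1 fun hne => absurd (A.min'_le s (hmem j s hs hne)) (not_le.2 hst)
  have hg := Θ.dof_grid i
  have htI := hg.subset_Icc t hit
  have ht0 : t₀ < t := lt_of_le_of_ne htI.1 fun h => hxy (by rw [← h, h0])
  have hfree : ¬ P.fixed i := fun hf => hxy (by rw [hx.fixed i hf t htI, hy.fixed i hf t htI])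
  set s := prevTime (Θ.dofTimes i) t with hs
  have hsS : s ∈ Θ.dofTimes i := hg.prev_mem ht0
  have hst : s < t := hg.prev_lt ht0
  have hnext : nextTime (Θ.dofTimes i) s = t := hg.next_prev hit ht0
  have hs1 : s < t₁ := hst.trans_le htI.2
  have hval : ∀ z : ℝ → ι → ℝ, z t i =
      z s i + (t - s) * rate (Θ.dofTimes i) (fun r => z r i) s := by
    intro z
    have := rate_mul_step (f := fun r => z r i) (hg.lt_next hs1)
    rw [hnext] at this
    linarith
  suffices hrate : rate (Θ.dofTimes i) (fun r => x r i) s =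
      rate (Θ.dofTimes i) (fun r => y r i) s by
    exact hxy (by rw [hval x, hval y, hrate, hlt i s hsS hst])
  -- On the first step no balance is available; there the rate is the prescribed initial velocity.
  rcases (hg.le_prev ht0).eq_or_lt with h | hs0
  · rw [hs, ← h]; exact hv i
  · have bx := hx.balance i hfree s hsS hs0 hs1
    have by' := hy.balance i hfree s hsS hs0 hs1
    have hp : prevTime (Θ.dofTimes i) s < s := hg.prev_lt hs0
    have hpS : prevTime (Θ.dofTimes i) s ∈ Θ.dofTimes i := hg.prev_mem hs0
    have himp : Θ.impulse i s (x s) = Θ.impulse i s (y s) := by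
      refine Finset.sum_congr rfl fun K hK => ?_
      rw [Finset.mem_filter] at hK
      rw [P.force_local K i (x s) (y s) fun j hj =>
        hlt j s ((Θ.mem_dofTimes j s).2 ⟨K, hj, hK.2⟩) hst]
    have hpr : rate (Θ.dofTimes i) (fun r => x r i) (prevTime (Θ.dofTimes i) s) =
        rate (Θ.dofTimes i) (fun r => y r i) (prevTime (Θ.dofTimes i) s) := by
      simp only [rate, hg.next_prev hsS hs0, hlt i s hsS hst,
        hlt i _ hpS (hp.trans hst)]
    have hne := sub_ne_zero.2 (hsolv i hfree s hsS hs0 hs1)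
    rw [hnext] at hne
    rw [Balance, hpr, himp, hnext, hval x] at bx
    rw [Balance, hnext, hval y] at by'
    refine mul_left_cancel₀ hne ?_
    linear_combination by' - bx

end Grids

end ForceSystem

/-- Compactness of bounded, asymptotically equi-Lipschitz sequences. -/
theorem exists_subseq_tendstoUniformlyOn {E : Type*} [NormedAddCommGroup E] [ProperSpace E]
    {A : Set ℝ} (hA : Bornology.IsBounded A) {f : ℕ → ℝ → E} {L M : ℝ} {ε : ℕ → ℝ}
    (hL : 0 ≤ L) (hε : Tendsto ε atTop (𝓝 0)) (hM : ∀ n, ∀ t ∈ A, ‖f n t‖ ≤ M)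
    (hf : ∀ n, ∀ t ∈ A, ∀ s ∈ A, ‖f n t - f n s‖ ≤ L * |t - s| + ε n) :
    ∃ (g : ℝ → E) (σ : ℕ → ℕ), StrictMono σ ∧ LipschitzOnWith L.toNNReal g A ∧
      TendstoUniformlyOn (fun n => f (σ n)) g atTop A := by
  obtain ⟨D, hDA, hDc, hAD⟩ : ∃ D ⊆ A, D.Countable ∧ A ⊆ closure D := by
    obtain ⟨D, hDc, hDd⟩ := TopologicalSpace.exists_countable_dense A
    refine ⟨(↑) '' D, by simp, hDc.image _, fun a ha => ?_⟩
    have := image_closure_subset_closure_image continuous_subtype_val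
      (mem_image_of_mem ((↑) : A → ℝ) (hDd ⟨a, ha⟩))
    exact this
  have := hDc.to_subtype
  -- The diagonal argument: a countable product of compact balls is sequentially compact, so one
  -- subsequence converges at all points of D.
  obtain ⟨g₀, -, σ, hσ, hg₀⟩ := (isCompact_univ_pi
    fun _ : D => isCompact_closedBall (0 : E) M).tendsto_subseq
    (x := fun n (t : D) => f n t) fun n t _ => by
      simpa using hM n t (hDA t.2)
  have hpt : ∀ t ∈ D, CauchySeq fun n => f (σ n) t := fun t ht =>
    ((tendsto_pi_nhds.1 hg₀) ⟨t, ht⟩).cauchySeq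
  have hεσ : Tendsto (fun n => ε (σ n)) atTop (𝓝 0) := hε.comp hσ.tendsto_atTop
  have hunif : UniformCauchySeqOn (fun n => f (σ n)) atTop A := by
    rw [Metric.uniformCauchySeqOn_iff]
    intro η hη
    -- The two increments contribute at most η/4 + η/8 each and the values at the net point η/8,
    -- which adds up to less than η.
    set δ := η / (8 * (L + 1)) with hδ
    have hδ0 : 0 < δ := by positivity
    have hLδ : L * (2 * δ) ≤ η / 4 := by
      rw [hδ, show L * (2 * (η / (8 * (L + 1)))) = (η / 4) * (L / (L + 1)) by field_simp; ring]
      have : L / (L + 1) ≤ 1 := (div_le_one (by linarith)).2 (by linarith)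
      nlinarith
    -- The finite net is taken inside D, where convergence is known. A point of A is within δ of D,
    -- hence within 2δ of the net.
    obtain ⟨F, hFD, hFfin, hF⟩ := Metric.finite_approx_of_totallyBounded
      (hA.isCompact_closure.totallyBounded.subset (hDA.trans subset_closure)) δ hδ0
    have hev : ∀ᶠ N in atTop, ∀ t ∈ F, ∀ m ≥ N, ∀ n ≥ N, dist (f (σ m) t) (f (σ n) t) < η / 8 := by
      rw [hFfin.eventually_all]
      intro t ht
      obtain ⟨N, hN⟩ := Metric.cauchySeq_iff.1 (hpt t (hFD ht)) (η / 8) (by linarith)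
      filter_upwards [eventually_ge_atTop N] with N' hN' m hm n hn
      exact hN m (hN'.trans hm) n (hN'.trans hn)
    have hev2 : ∀ᶠ N in atTop, ∀ m ≥ N, ε (σ m) < η / 8 := by
      obtain ⟨N, hN⟩ := eventually_atTop.1 (hεσ.eventually_lt_const (by linarith : (0:ℝ) < η / 8))
      filter_upwards [eventually_ge_atTop N] with N' hN' m hm using hN m (hN'.trans hm)
    obtain ⟨N, hN1, hN2⟩ := (hev.and hev2).exists
    refine ⟨N, fun m hm n hn t ht => ?_⟩
    obtain ⟨d, hdD, hdt⟩ := Metric.mem_closure_iff.1 (hAD ht) δ hδ0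
    obtain ⟨y, hyF, hdy⟩ := mem_iUnion₂.1 (hF hdD)
    have hty : |t - y| ≤ 2 * δ := by
      have h1 := abs_lt.1 (Real.dist_eq t d ▸ hdt)
      have h2 := abs_lt.1 (Real.dist_eq d y ▸ (Metric.mem_ball.1 hdy))
      rw [abs_le]; constructor <;> linarith
    have hyA := hDA (hFD hyF)
    have e1 := hf (σ m) t ht y hyA
    have e2 := hf (σ n) t ht y hyA
    have e3 := hN1 y hyF m hm n hn
    have e4 := hN2 m hm
    have e5 := hN2 n hn
    have e6 : L * |t - y| ≤ η / 4 := (mul_le_mul_of_nonneg_left hty hL).trans hLδ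
    rw [← dist_eq_norm] at e1 e2
    have e7 := dist_triangle4 (f (σ m) t) (f (σ m) y) (f (σ n) y) (f (σ n) t)
    rw [dist_comm (f (σ n) y)] at e7
    linarith
  choose! g hg using fun t (ht : t ∈ A) =>
    cauchySeq_tendsto_of_complete (hunif.cauchySeq ht)
  refine ⟨g, σ, hσ, ?_, hunif.tendstoUniformlyOn_of_tendsto fun t ht => hg t ht⟩
  refine LipschitzOnWith.of_dist_le_mul fun t ht s hs => ?_
  rw [Real.coe_toNNReal L hL, Real.dist_eq, dist_eq_norm]
  have h1 : Tendsto (fun n => ‖f (σ n) t - f (σ n) s‖) atTop (𝓝 ‖g t - g s‖) :=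
    ((hg t ht).sub (hg s hs)).norm
  have h2 : Tendsto (fun n => L * |t - s| + ε (σ n)) atTop (𝓝 (L * |t - s| + 0)) :=
    tendsto_const_nhds.add hεσ
  rw [add_zero] at h2
  exact le_of_tendsto_of_tendsto' h1 h2 fun n => hf (σ n) t ht s hs

namespace IsGrid

/-- Comparison of a Riemann sum over a grid with an integral. -/
theorem abs_sum_sub_integral_le {S : Finset ℝ} {t₀ t₁ s T M ε : ℝ} (hS : IsGrid S t₀ t₁)
    (hT : ∀ t ∈ S, t < t₁ → nextTime S t - t ≤ T) (hs : t₀ ≤ s) (hs' : s < t₁)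
    {f g : ℝ → ℝ} (hf : Continuous f) (hM : ∀ t ∈ Icc t₀ t₁, |f t| ≤ M)
    (hfg : ∀ t ∈ Icc t₀ t₁, ∀ r ∈ Icc t₀ t₁, |t - r| ≤ T → |g t - f r| ≤ ε) :
    |(∑ t ∈ S with t₀ < t ∧ t ≤ s, (nextTime S t - t) * g t) - ∫ t in t₀..s, f t| ≤
      ε * (s - t₀ + T) + 2 * M * T := by
  have hint : ∀ a b : ℝ, IntervalIntegrable f volume a b := fun a b => hf.intervalIntegrable a b
  -- Each term is compared with the increment of the primitive G over its step. These increments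
  -- telescope; the missing first step and the overshoot of the last one cost at most M T each.
  set G : ℝ → ℝ := fun t => ∫ r in t₀..t, f r with hG
  have hGsub : ∀ a b, G b - G a = ∫ r in a..b, f r := fun a b =>
    intervalIntegral.integral_interval_sub_left (hint _ _) (hint _ _)
  have hsum := hS.sum_next_sub G le_rfl hs
  have hM0 : 0 ≤ M := (abs_nonneg _).trans (hM t₀ ⟨le_rfl, hS.lt.le⟩)
  have hGle : ∀ a b, t₀ ≤ a → a ≤ b → b ≤ t₁ → b - a ≤ T → |G b - G a| ≤ M * T := by
    intro a b ha hab hb hT'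
    rw [hGsub, ← Real.norm_eq_abs]
    refine (intervalIntegral.norm_integral_le_of_norm_le_const (C := M) fun r hr => ?_).trans ?_
    · rw [uIoc_of_le hab] at hr
      exact hM r ⟨ha.trans hr.1.le, hr.2.trans hb⟩
    · rw [abs_of_nonneg (by linarith)]; gcongr
  have h1 := hS.last_mem hs
  have h2 := hS.last_lt_end hs hs'
  have h3 := hT _ h1 h2
  have h4 := hS.last_le hs
  have h5 := hS.lt_next_last hs hs'
  have h6 := hS.next_le h2
  have e1 := hGle s (nextTime S (lastTime S s)) hs h5.le h6 (by linarith)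
  have hl0 : lastTime S t₀ = t₀ := lastTime_of_mem hS.start_mem
  have h7 := hS.lt_next hS.lt
  have e2 := hGle t₀ (nextTime S t₀) le_rfl h7.le (hS.next_le hS.lt) (hT _ hS.start_mem hS.lt)
  have hG0 : G t₀ = 0 := intervalIntegral.integral_same
  have hterm : ∀ t ∈ S.filter (fun t => t₀ < t ∧ t ≤ s),
      |(nextTime S t - t) * g t - (G (nextTime S t) - G t)| ≤ ε * (nextTime S t - t) := by
    intro t ht
    rw [Finset.mem_filter] at ht
    have ht1 : t < t₁ := ht.2.2.trans_lt hs'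
    have hlt := hS.lt_next ht1
    have hle := hS.next_le ht1
    have hst := hT t ht.1 ht1
    have hcI : (nextTime S t - t) * g t = ∫ _ in t..nextTime S t, g t := by
      rw [intervalIntegral.integral_const, smul_eq_mul]
    rw [hGsub, hcI, ← intervalIntegral.integral_sub intervalIntegrable_const (hint _ _),
      ← Real.norm_eq_abs]
    refine (intervalIntegral.norm_integral_le_of_norm_le_const (C := ε) fun r hr => ?_).trans ?_
    · rw [uIoc_of_le hlt.le] at hr
      refine hfg t (hS.subset_Icc t ht.1) r ⟨ht.2.1.le.trans hr.1.le, hr.2.trans hle⟩ ?_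
      rw [abs_le]; constructor <;> linarith [hr.1, hr.2]
    · rw [abs_of_pos (by linarith)]
  have hε : 0 ≤ ε := (abs_nonneg _).trans (hfg t₀ ⟨le_rfl, hS.lt.le⟩ t₀ ⟨le_rfl, hS.lt.le⟩ (by
    have := hT _ hS.start_mem hS.lt
    simp only [sub_self, abs_zero]; linarith))
  have e3 : |(∑ t ∈ S with t₀ < t ∧ t ≤ s, (nextTime S t - t) * g t) -
      ∑ t ∈ S with t₀ < t ∧ t ≤ s, (G (nextTime S t) - G t)| ≤ ε * (s - t₀ + T) := by
    rw [← Finset.sum_sub_distrib]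
    refine (Finset.abs_sum_le_sum_abs _ _).trans ((Finset.sum_le_sum hterm).trans ?_)
    rw [← Finset.mul_sum]
    gcongr
    exact hS.sum_steps_le hT le_rfl hs hs'
  rw [hsum, hl0] at e3
  rw [hG0, sub_zero] at e2
  change |_ - G s| ≤ _
  rw [abs_le] at *
  constructor <;> linarith [e1.1, e1.2, e2.1, e2.2, e3.1, e3.2]

end IsGrid

/-! ### A priori estimates uniform in the time grids -/

namespace ForceSystem.Grids

variable {ι κ : Type*} [Fintype ι] {P : ForceSystem ι κ} {t₀ t₁ : ℝ} (Θ : P.Grids t₀ t₁)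

/-- The step function of the velocities. -/
def velocity (x : ℝ → ι → ℝ) (t : ℝ) : ι → ℝ :=
  fun i => stepRate (Θ.dofTimes i) (fun r => x r i) t

/-- All steps of the elements are at most `T`. -/
def StepLe (T : ℝ) : Prop :=
  ∀ K, ∀ t ∈ Θ.elemTimes K, t < t₁ → nextTime (Θ.elemTimes K) t - t ≤ T

variable {Θ}

/-- The grid of a degree of freedom refines those of its elements, so the next instant comes no
later than the next one of an element that has t as an instant. -/
theorem StepLe.dof {T : ℝ} (hT : Θ.StepLe T) (i : ι) :
    ∀ t ∈ Θ.dofTimes i, t < t₁ → nextTime (Θ.dofTimes i) t - t ≤ T := by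
  intro t ht ht1
  obtain ⟨K, hKi, hK⟩ := (Θ.mem_dofTimes i t).1 ht
  have hg := Θ.elem_grid K
  have := nextTime_le ((Θ.mem_dofTimes i _).2 ⟨K, hKi, hg.next_mem ht1⟩) (hg.lt_next ht1)
  linarith [hT K t hK ht1]

namespace IsTrajectory

variable {x : ℝ → ι → ℝ} (hx : Θ.IsTrajectory x)

include hx

theorem velocity_fixed {i : ι} (hi : P.fixed i) {t : ℝ} (ht : t₀ ≤ t) (ht' : t < t₁) :
    Θ.velocity x t i = 0 := by
  have hg := Θ.dof_grid i
  have h1 := hg.last_mem ht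
  have h2 := hg.next_mem (hg.last_lt_end ht ht')
  simp only [velocity, stepRate, rate, hx.fixed i hi _ (hg.subset_Icc _ h1),
    hx.fixed i hi _ (hg.subset_Icc _ h2), sub_zero, smul_zero]

/-- The sum of the balances over the instants of i in (s, s']. Rates and positions telescope, and
the impulses are regrouped element by element, which prepares both the estimates and the passage to
the limit. -/
theorem momentum {i : ι} (hi : ¬ P.fixed i) {s s' : ℝ} (hs : t₀ ≤ s) (hss : s ≤ s')
    (hs' : s' < t₁) :
    P.mass i * (Θ.velocity x s' i - Θ.velocity x s i) =
      P.damp i * (x (nextTime (Θ.dofTimes i) (lastTime (Θ.dofTimes i) s')) i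
        - x (nextTime (Θ.dofTimes i) (lastTime (Θ.dofTimes i) s)) i)
      - ∑ K ∈ P.elems i, ∑ t ∈ Θ.elemTimes K with s < t ∧ t ≤ s',
          (nextTime (Θ.elemTimes K) t - t) * P.force K i (x t) := by
  classical
  have hg := Θ.dof_grid i
  have h1 := hg.sum_sub_prev (fun t => rate (Θ.dofTimes i) (fun r => x r i) t) hs hss
  have h2 := hg.sum_next_sub (fun t => x t i) hs hss
  have h3 : ∑ t ∈ Θ.dofTimes i with s < t ∧ t ≤ s', Θ.impulse i t (x t) =
      ∑ K ∈ P.elems i, ∑ t ∈ Θ.elemTimes K with s < t ∧ t ≤ s',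
        (nextTime (Θ.elemTimes K) t - t) * P.force K i (x t) := by
    refine Finset.sum_comm' fun t K => ?_
    simp only [Finset.mem_filter, Θ.mem_dofTimes]
    constructor
    · rintro ⟨⟨-, h⟩, hK, ht⟩
      exact ⟨⟨ht, h⟩, hK⟩
    · rintro ⟨⟨ht, h⟩, hK⟩
      exact ⟨⟨⟨K, hK, ht⟩, h⟩, hK, ht⟩
  have h4 : Θ.velocity x s' i - Θ.velocity x s i = ∑ t ∈ Θ.dofTimes i with s < t ∧ t ≤ s',
      (rate (Θ.dofTimes i) (fun r => x r i) t -
        rate (Θ.dofTimes i) (fun r => x r i) (prevTime (Θ.dofTimes i) t)) := h1.symm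
  rw [h4, ← h3, ← h2, Finset.mul_sum, Finset.mul_sum, ← Finset.sum_sub_distrib]
  refine Finset.sum_congr rfl fun t ht => ?_
  rw [Finset.mem_filter] at ht
  exact hx.balance i hi t ht.1 (hs.trans_lt ht.2.1) (ht.2.2.trans_lt hs')

theorem continuousOn : ContinuousOn x (Icc t₀ t₁) :=
  continuousOn_pi.2 fun i => (hx.affine i).continuousOn (Θ.dof_grid i)

theorem norm_sub_sub_le {s s' B : ℝ} {c : ι → ℝ} (hs : t₀ ≤ s) (hss : s ≤ s') (hs' : s' ≤ t₁)
    (hB0 : 0 ≤ B) (hB : ∀ r ∈ Ico s s', ‖Θ.velocity x r - c‖ ≤ B) :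
    ‖x s' - x s - (s' - s) • c‖ ≤ B * (s' - s) := by
  refine (pi_norm_le_iff_of_nonneg (mul_nonneg hB0 (sub_nonneg.2 hss))).2 fun i => ?_
  have := (hx.affine i).abs_sub_sub_le (Θ.dof_grid i) (c := c i) hs hss hs'
    fun r hr => (norm_le_pi_norm (Θ.velocity x r - c) i).trans (hB r hr)
  rw [mul_comm] at this
  rw [Real.norm_eq_abs]
  convert this using 2
  simp only [Pi.sub_apply, Pi.smul_apply, smul_eq_mul]

theorem norm_sub_le {s s' B : ℝ} (hs : t₀ ≤ s) (hss : s ≤ s') (hs' : s' ≤ t₁)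
    (hB0 : 0 ≤ B) (hB : ∀ r ∈ Ico s s', ‖Θ.velocity x r‖ ≤ B) :
    ‖x s' - x s‖ ≤ B * (s' - s) := by
  simpa using hx.norm_sub_sub_le (c := 0) hs hss hs' hB0 (by simpa using hB)

/-- Telescoping leaves positions at the next instant after s. The motion is affine up to there, so
replacing them by positions at s costs one step at the current velocity. -/
theorem abs_next_sub_le {i : ι} {T s B : ℝ} (hT : Θ.StepLe T) (hs : t₀ ≤ s) (hs' : s < t₁)
    (hB : ‖Θ.velocity x s‖ ≤ B) :
    |x (nextTime (Θ.dofTimes i) (lastTime (Θ.dofTimes i) s)) i - x s i| ≤ T * B := by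
  have hg := Θ.dof_grid i
  have h1 := (hx.affine i).next_last hg hs hs'
  have h2 := hT.dof i _ (hg.last_mem hs) (hg.last_lt_end hs hs')
  have h3 := hg.lt_next_last hs hs'
  have h4 := hg.last_le hs
  rw [h1, add_sub_cancel_left, abs_mul, abs_of_pos (by linarith)]
  have h5 : |stepRate (Θ.dofTimes i) (fun r => x r i) s| ≤ B :=
    (norm_le_pi_norm (Θ.velocity x s) i).trans hB
  have : 0 ≤ B := (abs_nonneg _).trans h5
  exact mul_le_mul (by linarith) h5 (abs_nonneg _) (by linarith)

/-- A merely qualitative bound depending on the trajectory; it makes the supremum in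
`exists_uniform_bound` finite, so that it can be absorbed. -/
theorem bddAbove_norm : ∃ M, ∀ t ∈ Ico t₀ t₁, 1 + ‖x t‖ + ‖Θ.velocity x t‖ ≤ M := by
  obtain ⟨M₁, hM₁⟩ := isCompact_Icc.exists_bound_of_continuousOn hx.continuousOn
  set R : ι → ℝ := fun i => ∑ t ∈ Θ.dofTimes i, |rate (Θ.dofTimes i) (fun r => x r i) t| with hR
  refine ⟨1 + M₁ + ∑ i, R i, fun t ht => ?_⟩
  have h1 := hM₁ t (Ico_subset_Icc_self ht)
  have hR0 : ∀ i, 0 ≤ R i := fun i => Finset.sum_nonneg fun _ _ => abs_nonneg _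
  have h2 : ‖Θ.velocity x t‖ ≤ ∑ i, R i := by
    refine (pi_norm_le_iff_of_nonneg (Finset.sum_nonneg fun i _ => hR0 i)).2 fun i => ?_
    refine le_trans ?_ (Finset.single_le_sum (fun i _ => hR0 i) (Finset.mem_univ i))
    exact Finset.single_le_sum (f := fun t => |rate (Θ.dofTimes i) (fun r => x r i) t|)
      (fun _ _ => abs_nonneg _) ((Θ.dof_grid i).last_mem ht.1)
  linarith

end IsTrajectory

variable (P) in
/-- The velocities vary by at most a constant times the elapsed time, up to the size of the
steps. -/
theorem exists_velocity_estimate : ∃ D, 0 ≤ D ∧ ∀ {t₀ t₁ : ℝ} (Θ : P.Grids t₀ t₁)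
    (x : ℝ → ι → ℝ), Θ.IsTrajectory x → ∀ T, Θ.StepLe T → ∀ s s' B, t₀ ≤ s → s ≤ s' → s' < t₁ →
    (∀ r ∈ Icc s s', 1 + ‖x r‖ + ‖Θ.velocity x r‖ ≤ B) →
    ‖Θ.velocity x s' - Θ.velocity x s‖ ≤ D * B * (s' - s + 2 * T) := by
  obtain ⟨C₀, hC₀⟩ := P.force_growth
  set C := max C₀ 0 with hC
  have hC0 : 0 ≤ C := le_max_right _ _
  have hCf : ∀ K i x, |P.force K i x| ≤ C * (1 + ‖x‖) := fun K i x =>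
    (hC₀ K i x).trans (by gcongr; exact le_max_left _ _)
  -- Momentum changes through the damping term and through one sum of impulses for each element at
  -- i. Both are estimated by multiples of B (s' - s + 2T), and division by the mass gives this
  -- constant.
  set d : ι → ℝ := fun i => (P.damp i + (P.elems i).card * C) / P.mass i with hd
  have hd0 : ∀ i, 0 ≤ d i := fun i => div_nonneg
    (add_nonneg (P.damp_nonneg i) (by positivity)) (P.mass_pos i).le
  refine ⟨∑ i, d i, Finset.sum_nonneg fun i _ => hd0 i, ?_⟩
  intro t₀ t₁ Θ x hx T hT s s' B hs hss hs' hB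
  have hB1 : 1 ≤ B := le_trans (by
    have := norm_nonneg (x s); have := norm_nonneg (Θ.velocity x s); linarith)
    (hB s ⟨le_rfl, hss⟩)
  have hBv : ∀ r ∈ Icc s s', ‖Θ.velocity x r‖ ≤ B := fun r hr => by
    have := norm_nonneg (x r); linarith [hB r hr]
  have hBx : ∀ r ∈ Icc s s', 1 + ‖x r‖ ≤ B := fun r hr => by
    have := norm_nonneg (Θ.velocity x r); linarith [hB r hr]
  rcases isEmpty_or_nonempty ι with hι | ⟨⟨i₀⟩⟩
  · rw [Subsingleton.elim (Θ.velocity x s') (Θ.velocity x s)]; simp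
  have hT0 : 0 ≤ T := by
    have hg := Θ.dof_grid i₀
    linarith [hT.dof i₀ _ hg.start_mem hg.lt, hg.lt_next hg.lt]
  have hτ : 0 ≤ s' - s + 2 * T := by linarith
  have hD0 : 0 ≤ ∑ i, d i := Finset.sum_nonneg fun i _ => hd0 i
  refine (pi_norm_le_iff_of_nonneg (by positivity)).2 fun i => ?_
  have hdle : d i ≤ ∑ i, d i := Finset.single_le_sum (fun i _ => hd0 i) (Finset.mem_univ i)
  suffices h : |Θ.velocity x s' i - Θ.velocity x s i| ≤ d i * B * (s' - s + 2 * T) from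
    h.trans (by gcongr)
  by_cases hi : P.fixed i
  · rw [hx.velocity_fixed hi hs (hss.trans_lt hs'), hx.velocity_fixed hi (hs.trans hss) hs',
      sub_self, abs_zero]
    have := hd0 i
    positivity
  have hm := P.mass_pos i
  have hmom := hx.momentum hi hs hss hs'
  have e1 := hx.abs_next_sub_le (i := i) hT hs (hss.trans_lt hs') (hBv s ⟨le_rfl, hss⟩)
  have e2 := hx.abs_next_sub_le (i := i) hT (hs.trans hss) hs' (hBv s' ⟨hss, le_rfl⟩)
  have e3 : |x s' i - x s i| ≤ B * (s' - s) := (norm_le_pi_norm (x s' - x s) i).trans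
    (hx.norm_sub_le hs hss hs'.le (by linarith) fun r hr => hBv r (Ico_subset_Icc_self hr))
  set a := x (nextTime (Θ.dofTimes i) (lastTime (Θ.dofTimes i) s')) i
  set b := x (nextTime (Θ.dofTimes i) (lastTime (Θ.dofTimes i) s)) i
  -- The positions move by B (s' - s) between s and s', plus at most T B at each end to reach the
  -- next instants; this is the origin of 2T.
  have e4 : |a - b| ≤ B * (s' - s + 2 * T) := by
    rw [abs_le] at *
    constructor <;> linarith [e1.1, e1.2, e2.1, e2.2, e3.1, e3.2]
  have e5 : |∑ K ∈ P.elems i, ∑ t ∈ Θ.elemTimes K with s < t ∧ t ≤ s',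
      (nextTime (Θ.elemTimes K) t - t) * P.force K i (x t)| ≤
      (P.elems i).card * C * (B * (s' - s + 2 * T)) := by
    refine (Finset.abs_sum_le_sum_abs _ _).trans ?_
    rw [mul_assoc, ← nsmul_eq_mul]
    refine Finset.sum_le_card_nsmul _ _ _ fun K _ => ?_
    refine (Finset.abs_sum_le_sum_abs _ _).trans ?_
    have hterm : ∀ t ∈ (Θ.elemTimes K).filter (fun t => s < t ∧ t ≤ s'),
        |(nextTime (Θ.elemTimes K) t - t) * P.force K i (x t)| ≤
          C * B * (nextTime (Θ.elemTimes K) t - t) := by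
      intro t ht
      rw [Finset.mem_filter] at ht
      have := (Θ.elem_grid K).lt_next (ht.2.2.trans_lt hs')
      rw [abs_mul, abs_of_pos (by linarith), mul_comm]
      refine mul_le_mul_of_nonneg_right ((hCf K i (x t)).trans ?_) (by linarith)
      exact mul_le_mul_of_nonneg_left (hBx t ⟨ht.2.1.le, ht.2.2⟩) hC0
    refine (Finset.sum_le_sum hterm).trans ?_
    rw [← Finset.mul_sum, ← mul_assoc]
    refine mul_le_mul_of_nonneg_left ?_ (by positivity)
    linarith [(Θ.elem_grid K).sum_steps_le (hT K) hs hss hs']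
  have e6 : P.mass i * |Θ.velocity x s' i - Θ.velocity x s i| ≤
      (P.damp i + (P.elems i).card * C) * (B * (s' - s + 2 * T)) := by
    rw [← abs_of_pos hm, ← abs_mul, hmom]
    refine (abs_sub _ _).trans ?_
    rw [abs_mul, abs_of_nonneg (P.damp_nonneg i), add_mul]
    exact add_le_add (mul_le_mul_of_nonneg_left e4 (P.damp_nonneg i)) e5
  rw [hd]
  simp only
  rw [mul_assoc, div_mul_eq_mul_div, le_div_iff₀ hm, mul_comm]
  exact e6

variable (P) in
/-- Bounds for the trajectories that are uniform in the grids, as long as these are fine. -/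
theorem exists_uniform_bound (t₀ t₁ N₀ : ℝ) : ∃ B T₀ : ℝ, 0 < T₀ ∧ ∀ (Θ : P.Grids t₀ t₁)
    (x : ℝ → ι → ℝ), Θ.IsTrajectory x → Θ.StepLe T₀ → 1 + ‖x t₀‖ + ‖Θ.velocity x t₀‖ ≤ N₀ →
    ∀ t ∈ Ico t₀ t₁, 1 + ‖x t‖ + ‖Θ.velocity x t‖ ≤ B := by
  obtain ⟨D, hD, hest⟩ := exists_velocity_estimate P
  -- On a window of length δ, with steps at most δ/2, velocity and position together grow by at most
  -- (D + 1) · 2δ = 1/2 times the supremum.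
  set δ : ℝ := 1 / (4 * (D + 1)) with hδ
  have hδ0 : 0 < δ := by positivity
  have hDδ : (D + 1) * (δ + 2 * (δ / 2)) = 1 / 2 := by
    rw [hδ]; field_simp; ring
  obtain ⟨n, hn⟩ := exists_nat_ge ((t₁ - t₀) / δ)
  refine ⟨2 ^ n * N₀, δ / 2, by positivity, fun Θ x hx hT hN₀ => ?_⟩
  have hN : 0 ≤ N₀ := le_trans (by positivity) hN₀
  -- The size at most doubles on each of the n windows of length δ that cover the time interval.
  suffices h : ∀ m : ℕ, ∀ t ∈ Ico t₀ t₁, t - t₀ ≤ m * δ →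
      1 + ‖x t‖ + ‖Θ.velocity x t‖ ≤ 2 ^ m * N₀ by
    intro t ht
    refine h n t ht ?_
    rw [div_le_iff₀ hδ0] at hn
    linarith [ht.2]
  intro m
  induction m with
  | zero =>
    intro t ht ht'
    have : t = t₀ := le_antisymm (by simpa using ht') ht.1
    simpa [this] using hN₀
  | succ m ih =>
    intro t ht htm
    obtain ⟨M, hM⟩ := hx.bddAbove_norm
    set A := sSup ((fun r => 1 + ‖x r‖ + ‖Θ.velocity x r‖) '' Icc t₀ t) with hA
    have hbdd : BddAbove ((fun r => 1 + ‖x r‖ + ‖Θ.velocity x r‖) '' Icc t₀ t) := by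
      refine ⟨M, ?_⟩
      rintro _ ⟨r, hr, rfl⟩
      exact hM r ⟨hr.1, hr.2.trans_lt ht.2⟩
    have hle : ∀ r ∈ Icc t₀ t, 1 + ‖x r‖ + ‖Θ.velocity x r‖ ≤ A := fun r hr =>
      le_csSup hbdd (mem_image_of_mem _ hr)
    have hA0 : 0 ≤ A := le_trans (by positivity) (hle t ⟨ht.1, le_rfl⟩)
    -- The growth over the last window is at most half the supremum A itself, so it is absorbed on
    -- the left.
    have hkey : A ≤ 2 ^ m * N₀ + A / 2 := by
      refine csSup_le ⟨_, mem_image_of_mem _ ⟨le_rfl, ht.1⟩⟩ ?_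
      rintro _ ⟨r, hr, rfl⟩
      simp only
      rcases le_or_gt (r - t₀) (m * δ) with hrm | hrm
      · have := ih r ⟨hr.1, hr.2.trans_lt ht.2⟩ hrm
        linarith
      · set b := t₀ + m * δ with hb
        have hb0 : t₀ ≤ b := by rw [hb]; have : 0 ≤ m * δ := by positivity
                                linarith
        have hbr : b ≤ r := by linarith
        have hrb : r - b ≤ δ := by
          push_cast at htm
          linarith [hr.2]
        have hr1 := hr.2.trans_lt ht.2
        have hA' : ∀ q ∈ Icc b r, 1 + ‖x q‖ + ‖Θ.velocity x q‖ ≤ A := fun q hq =>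
          hle q ⟨hb0.trans hq.1, hq.2.trans hr.2⟩
        have e1 := hest Θ x hx _ hT b r A hb0 hbr hr1 hA'
        have e2 := hx.norm_sub_le hb0 hbr hr1.le hA0 fun q hq => by
          have := hA' q (Ico_subset_Icc_self hq)
          have := norm_nonneg (x q)
          linarith
        have e3 := ih b ⟨hb0, hbr.trans_lt hr1⟩ (by rw [hb]; linarith)
        have e4 := norm_le_norm_add_norm_sub' (x r) (x b)
        have e5 := norm_le_norm_add_norm_sub' (Θ.velocity x r) (Θ.velocity x b)
        have e6 : D * A * (r - b + 2 * (δ / 2)) + A * (r - b) ≤ A / 2 := by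
          calc D * A * (r - b + 2 * (δ / 2)) + A * (r - b)
              ≤ D * A * (δ + 2 * (δ / 2)) + A * (δ + 2 * (δ / 2)) := by
                gcongr
                linarith
            _ = A * ((D + 1) * (δ + 2 * (δ / 2))) := by ring
            _ = A / 2 := by rw [hDδ]; ring
        linarith
    have := hle t ⟨ht.1, le_rfl⟩
    rw [pow_succ]
    linarith

end ForceSystem.Grids

/-! ### Passage to the limit of vanishing time steps -/

namespace ForceSystem

variable {ι κ : Type*} [Fintype ι] (P : ForceSystem ι κ)

/-- `X` is a `C¹` curve with Lipschitz velocity `V` that satisfies the balance of momentum of the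
system, integrated in time, on `[t₀, t₁)`. -/
structure IsContinuousTrajectory (t₀ t₁ : ℝ) (X V : ℝ → ι → ℝ) : Prop where
  lipschitz : ∃ L, LipschitzWith L V
  hasDerivAt : ∀ t, HasDerivAt X (V t) t
  fixed : ∀ i, P.fixed i → ∀ t ∈ Icc t₀ t₁, X t i = 0
  balance : ∀ i, ¬ P.fixed i → ∀ t ∈ Ico t₀ t₁, P.mass i * (V t i - V t₀ i) =
    P.damp i * (X t i - X t₀ i) - ∑ K ∈ P.elems i, ∫ s in t₀..t, P.force K i (X s)

variable {P}

theorem Grids.StepLe.mono {t₀ t₁ S T : ℝ} {Θ : P.Grids t₀ t₁} (h : Θ.StepLe S) (hST : S ≤ T) :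
    Θ.StepLe T := fun K t ht ht1 => (h K t ht ht1).trans hST

theorem tendsto_riemannSum {t₀ t₁ t M : ℝ} {Θ : ℕ → P.Grids t₀ t₁} {T : ℕ → ℝ}
    (hT : ∀ n, (Θ n).StepLe (T n)) (hT0 : Tendsto T atTop (𝓝 0)) {x : ℕ → ℝ → ι → ℝ}
    {X : ℝ → ι → ℝ} (hX : Continuous X) (hM : ∀ n, ∀ t ∈ Icc t₀ t₁, ‖x n t‖ ≤ M)
    (hx : TendstoUniformlyOn x X atTop (Icc t₀ t₁)) (ht : t ∈ Ico t₀ t₁) (K : κ) (i : ι) :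
    Tendsto (fun n => ∑ s ∈ (Θ n).elemTimes K with t₀ < s ∧ s ≤ t,
      (nextTime ((Θ n).elemTimes K) s - s) * P.force K i (x n s)) atTop
      (𝓝 (∫ s in t₀..t, P.force K i (X s))) := by
  have hcont : Continuous fun s => P.force K i (X s) := (P.force_continuous K i).comp hX
  obtain ⟨M₁, hM₁⟩ := isCompact_Icc.exists_bound_of_continuousOn
    (hcont.continuousOn (s := Icc t₀ t₁))
  obtain ⟨M₂, hM₂⟩ := isCompact_Icc.exists_bound_of_continuousOn (hX.continuousOn (s := Icc t₀ t₁))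
  have huf : UniformContinuousOn (P.force K i) (Metric.closedBall 0 (max M M₂)) :=
    (isCompact_closedBall _ _).uniformContinuousOn_of_continuous
      (P.force_continuous K i).continuousOn
  have huX : UniformContinuousOn X (Icc t₀ t₁) :=
    isCompact_Icc.uniformContinuousOn_of_continuous hX.continuousOn
  -- All configurations lie in one ball, on which the force is uniformly continuous. Uniform
  -- convergence compares x n with X at time s, and uniform continuity of X moves from s to r.
  have hclose : ∀ ε > 0, ∀ᶠ n in atTop, ∀ s ∈ Icc t₀ t₁, ∀ r ∈ Icc t₀ t₁, |s - r| ≤ T n →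
      |P.force K i (x n s) - P.force K i (X r)| ≤ ε := by
    intro ε hε
    obtain ⟨δ, hδ, hδf⟩ := Metric.uniformContinuousOn_iff.1 huf ε hε
    obtain ⟨η, hη, hηX⟩ := Metric.uniformContinuousOn_iff.1 huX (δ / 2) (by linarith)
    filter_upwards [Metric.tendstoUniformlyOn_iff.1 hx (δ / 2) (by linarith),
      hT0.eventually_lt_const hη] with n hn hTn s hs r hr hsr
    refine (hδf _ ?_ _ ?_ ?_).le
    · simpa using Or.inl (hM n s hs)
    · simpa using Or.inr (hM₂ r hr)
    · have h1 := hn s hs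
      have h2 := hηX s hs r hr (by rw [Real.dist_eq]; linarith)
      rw [dist_comm] at h1
      have := dist_triangle (x n s) (X s) (X r)
      linarith
  rw [Metric.tendsto_atTop']
  intro ε hε
  have ht01 : 0 < t₁ - t₀ := by linarith [ht.1, ht.2]
  -- Once the steps are below 1, this makes the error inside the cells at most ε/2; the other half
  -- is for the two boundary terms.
  set ε' := ε / (2 * (t₁ - t₀ + 1)) with hε'
  have hε'0 : 0 < ε' := by positivity
  have hlim : Tendsto (fun n => 2 * M₁ * T n) atTop (𝓝 0) := by
    simpa using hT0.const_mul (2 * M₁)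
  obtain ⟨N, hN⟩ := eventually_atTop.1 ((hclose ε' hε'0).and
    ((hlim.eventually_lt_const (by linarith : (0 : ℝ) < ε / 2)).and
      (hT0.eventually_lt_const one_pos)))
  refine ⟨N, fun n hn => ?_⟩
  obtain ⟨h1, h2, h3⟩ := hN n hn.le
  have := ((Θ n).elem_grid K).abs_sum_sub_integral_le (hT n K) ht.1 ht.2 hcont
    (fun r hr => hM₁ r hr) (g := fun s => P.force K i (x n s)) h1
  rw [Real.dist_eq]
  refine this.trans_lt ?_
  have h4 : ε' * (t - t₀ + T n) ≤ ε' * (t₁ - t₀ + 1) := by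
    have := ht.2
    gcongr
  have h5 : ε' * (t₁ - t₀ + 1) = ε / 2 := by rw [hε']; field_simp
  linarith

/-- The quadratic error makes V s the right derivative of x at s. Then x - X has zero right
derivative and vanishes at t₀. Only pointwise limits of the discrete second-order estimate are
needed to verify the hypothesis. -/
theorem eqOn_integral_of_norm_sub_sub_le {t₀ t₁ L : ℝ} {x X V : ℝ → ι → ℝ}
    (hV : Continuous V) (hX0 : X = fun t => x t₀ + ∫ s in t₀..t, V s)
    (hx : ∀ s s', t₀ ≤ s → s ≤ s' → s' < t₁ → ‖x s' - x s - (s' - s) • V s‖ ≤ L * (s' - s) ^ 2)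
    (hxc : ContinuousOn x (Icc t₀ t₁)) : EqOn x X (Icc t₀ t₁) := by
  have hder : ∀ s ∈ Ico t₀ t₁, HasDerivWithinAt x (V s) (Ici s) s := by
    intro s hs
    rw [hasDerivWithinAt_iff_isLittleO]
    have h1 : (fun s' => x s' - x s - (s' - s) • V s) =O[𝓝[≥] s] fun s' => (s' - s) ^ 2 := by
      refine Asymptotics.IsBigO.of_bound L ?_
      filter_upwards [Ico_mem_nhdsGE hs.2] with s' hs'
      rw [Real.norm_of_nonneg (sq_nonneg _)]
      exact hx s s' hs.1 hs'.1 hs'.2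
    refine h1.trans_isLittleO ?_
    have h2 : (fun s' : ℝ => s' - s) =o[𝓝[≥] s] fun _ => (1 : ℝ) := by
      rw [Asymptotics.isLittleO_one_iff]
      have : Tendsto (fun s' : ℝ => s' - s) (𝓝 s) (𝓝 (s - s)) := tendsto_id.sub_const s
      rw [sub_self] at this
      exact this.mono_left nhdsWithin_le_nhds
    simpa [pow_two] using h2.mul_isBigO (Asymptotics.isBigO_refl (fun s' : ℝ => s' - s) (𝓝[≥] s))
  intro t htI
  have hXder : ∀ s, HasDerivAt X (V s) s := by
    intro s
    rw [hX0]
    exact (intervalIntegral.integral_hasDerivAt_right (hV.intervalIntegrable _ _)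
      hV.stronglyMeasurable.stronglyMeasurableAtFilter hV.continuousAt).const_add _
  have h := constant_of_has_deriv_right_zero (f := fun t => x t - X t) (a := t₀) (b := t₁)
    (hxc.sub (continuous_iff_continuousAt.2 fun s => (hXder s).continuousAt).continuousOn)
    (fun s hs => by simpa using (hder s hs).fun_sub (hXder s).hasDerivWithinAt) t htI
  have h0 : X t₀ = x t₀ := by simp [hX0]
  simp only [h0, sub_self] at h
  exact sub_eq_zero.1 h

/-- Trajectories of asynchronous schemes with steps tending to zero converge, up to a subsequence,
to a trajectory of the system. -/
theorem exists_limit {t₀ t₁ N₀ : ℝ} (ht : t₀ < t₁) {Θ : ℕ → P.Grids t₀ t₁} {T : ℕ → ℝ}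
    (hT : ∀ n, (Θ n).StepLe (T n)) (hT0 : Tendsto T atTop (𝓝 0)) {x : ℕ → ℝ → ι → ℝ}
    (hx : ∀ᶠ n in atTop, (Θ n).IsTrajectory (x n) ∧
      1 + ‖x n t₀‖ + ‖(Θ n).velocity (x n) t₀‖ ≤ N₀) :
    ∃ (X V : ℝ → ι → ℝ) (σ : ℕ → ℕ), P.IsContinuousTrajectory t₀ t₁ X V ∧ StrictMono σ ∧
      TendstoUniformlyOn (fun n => x (σ n)) X atTop (Icc t₀ t₁) ∧
      TendstoUniformlyOn (fun n => (Θ (σ n)).velocity (x (σ n))) V atTop (Ico t₀ t₁) := by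
  obtain ⟨B, T₀, hT₀, hB⟩ := Grids.exists_uniform_bound P t₀ t₁ N₀
  obtain ⟨D, hD, hest⟩ := Grids.exists_velocity_estimate P
  -- From the index N on, the x n are trajectories and the steps are small enough for the uniform
  -- bound; the sequence is shifted by N.
  obtain ⟨N, hN⟩ := eventually_atTop.1 (hx.and (hT0.eventually_le_const hT₀))
  have hx' : ∀ n, (Θ (n + N)).IsTrajectory (x (n + N)) := fun n => (hN (n + N) (by omega)).1.1
  have hb : ∀ n, ∀ t ∈ Ico t₀ t₁,
      1 + ‖x (n + N) t‖ + ‖(Θ (n + N)).velocity (x (n + N)) t‖ ≤ B := fun n =>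
    hB _ _ (hx' n) ((hT _).mono (hN (n + N) (by omega)).2) (hN (n + N) (by omega)).1.2
  have hB0 : 0 ≤ B := le_trans (by positivity) (hb 0 t₀ ⟨le_rfl, ht⟩)
  have hbv : ∀ n, ∀ t ∈ Ico t₀ t₁, ‖(Θ (n + N)).velocity (x (n + N)) t‖ ≤ B := fun n t h => by
    have := norm_nonneg (x (n + N) t); linarith [hb n t h]
  have hbx : ∀ n, ∀ t ∈ Ico t₀ t₁, ‖x (n + N) t‖ ≤ B := fun n t h => by
    have := norm_nonneg ((Θ (n + N)).velocity (x (n + N)) t); linarith [hb n t h]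
  have hTN : Tendsto (fun n => T (n + N)) atTop (𝓝 0) :=
    hT0.comp (tendsto_add_atTop_nat N)
  have hvlip : ∀ n, ∀ s s', t₀ ≤ s → s ≤ s' → s' < t₁ →
      ‖(Θ (n + N)).velocity (x (n + N)) s' - (Θ (n + N)).velocity (x (n + N)) s‖ ≤
        D * B * (s' - s) + 2 * D * B * T (n + N) := fun n s s' h1 h2 h3 => by
    have := hest _ _ (hx' n) _ (hT (n + N)) s s' B h1 h2 h3
      fun r hr => hb n r ⟨h1.trans hr.1, hr.2.trans_lt h3⟩
    linarith
  have hxlip : ∀ n, ∀ s s', t₀ ≤ s → s ≤ s' → s' ≤ t₁ →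
      ‖x (n + N) s' - x (n + N) s‖ ≤ B * (s' - s) := fun n s s' h1 h2 h3 =>
    (hx' n).norm_sub_le h1 h2 h3 hB0 fun r hr => hbv n r ⟨h1.trans hr.1, hr.2.trans_le h3⟩
  -- The velocities jump at grid instants, by amounts of the order of the step, which the error term
  -- allows. The end-point t₁ is left out because no instant follows it.
  obtain ⟨V₀, σ₁, hσ₁, hV₀, hvel⟩ := exists_subseq_tendstoUniformlyOn
    (A := Ico t₀ t₁) (f := fun n => (Θ (n + N)).velocity (x (n + N)))
    (L := D * B) (M := B) (ε := fun n => 2 * D * B * T (n + N)) (Metric.isBounded_Ico _ _)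
    (by positivity) (by simpa using hTN.const_mul (2 * D * B)) hbv (by
      intro n t htA s hsA
      rcases le_total s t with h | h
      · rw [abs_of_nonneg (by linarith)]
        exact hvlip n s t hsA.1 h htA.2
      · rw [abs_of_nonpos (by linarith), norm_sub_rev, neg_sub]
        exact hvlip n t s htA.1 h hsA.2)
  have hbx' : ∀ n, ∀ t ∈ Icc t₀ t₁, ‖x (n + N) t‖ ≤ B + B * (t₁ - t₀) := by
    intro n t htA
    have h1 := hxlip n t₀ t le_rfl htA.1 htA.2
    have h2 := hbx n t₀ ⟨le_rfl, ht⟩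
    have h3 := norm_le_norm_add_norm_sub' (x (n + N) t) (x (n + N) t₀)
    have h4 : B * (t - t₀) ≤ B * (t₁ - t₀) := by have := htA.2; gcongr
    linarith
  obtain ⟨X₀, σ₂, hσ₂, hX₀, hpos⟩ := exists_subseq_tendstoUniformlyOn
    (A := Icc t₀ t₁) (f := fun n => x (σ₁ n + N))
    (L := B) (M := B + B * (t₁ - t₀)) (ε := fun _ => 0) (Metric.isBounded_Icc _ _)
    hB0 tendsto_const_nhds (fun n => hbx' (σ₁ n)) (by
      intro n t htA s hsA
      rw [add_zero]
      rcases le_total s t with h | h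
      · rw [abs_of_nonneg (by linarith)]
        exact hxlip (σ₁ n) s t hsA.1 h htA.2
      · rw [abs_of_nonpos (by linarith), norm_sub_rev, neg_sub]
        exact hxlip (σ₁ n) t s htA.1 h hsA.2)
  set σ : ℕ → ℕ := fun n => σ₁ (σ₂ n) + N with hσ
  have hσm : StrictMono σ := fun a b hab => by
    have := hσ₁ (hσ₂ hab); simp only [hσ]; omega
  -- A Lipschitz extension to the whole line, coordinate by coordinate, so that the primitive X
  -- below is differentiable everywhere.
  obtain ⟨V, hVlip, hVeq⟩ := hV₀.extend_pi
  have hvel' : TendstoUniformlyOn (fun n => (Θ (σ n)).velocity (x (σ n))) V atTop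
      (Ico t₀ t₁) := by
    refine TendstoUniformlyOn.congr_right ?_ hVeq
    exact fun u hu => hσ₂.tendsto_atTop.eventually (hvel u hu)
  have hV := hVlip.continuous
  have hTσ : Tendsto (fun n => T (σ n)) atTop (𝓝 0) := hT0.comp hσm.tendsto_atTop
  set X : ℝ → ι → ℝ := fun t => X₀ t₀ + ∫ s in t₀..t, V s with hX
  have hXder : ∀ s, HasDerivAt X (V s) s := fun s =>
    (intervalIntegral.integral_hasDerivAt_right (hV.intervalIntegrable _ _)
      hV.stronglyMeasurable.stronglyMeasurableAtFilter hV.continuousAt).const_add _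
  have hXc : Continuous X := continuous_iff_continuousAt.2 fun s => (hXder s).continuousAt
  have hptv : ∀ t ∈ Ico t₀ t₁, Tendsto (fun n => (Θ (σ n)).velocity (x (σ n)) t) atTop
      (𝓝 (V t)) := fun t htA => hvel'.tendsto_at htA
  -- The limit of the estimate with c the velocity at s: the term in the step size disappears and a
  -- pure square of s' - s remains.
  have hX₀X : EqOn X₀ X (Icc t₀ t₁) := by
    refine eqOn_integral_of_norm_sub_sub_le (L := D * B) hV hX ?_ hX₀.continuousOn
    intro s s' h1 h2 h3
    have hsI : s ∈ Icc t₀ t₁ := ⟨h1, h2.trans h3.le⟩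
    have hl1 : Tendsto (fun n => ‖x (σ n) s' - x (σ n) s -
        (s' - s) • (Θ (σ n)).velocity (x (σ n)) s‖) atTop
        (𝓝 ‖X₀ s' - X₀ s - (s' - s) • V s‖) :=
      (((hpos.tendsto_at ⟨h1.trans h2, h3.le⟩).sub (hpos.tendsto_at hsI)).sub
        ((hptv s ⟨h1, h2.trans_lt h3⟩).const_smul (s' - s))).norm
    have hl2 : Tendsto (fun n => (D * B * (s' - s) + 2 * D * B * T (σ n)) * (s' - s)) atTop
        (𝓝 ((D * B * (s' - s) + 2 * D * B * 0) * (s' - s))) :=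
      ((hTσ.const_mul _).const_add _).mul_const _
    have := le_of_tendsto_of_tendsto' hl1 hl2 fun n => by
      have hTn : 0 ≤ D * B * (s' - s) + 2 * D * B * T (σ n) := (norm_nonneg _).trans
        (hvlip _ s s' h1 h2 h3)
      refine (hx' (σ₁ (σ₂ n))).norm_sub_sub_le h1 h2 h3.le hTn fun r hr => ?_
      refine (hvlip _ s r h1 hr.1 (hr.2.trans h3)).trans ?_
      have := hr.2.le
      simp only [hσ]
      gcongr
    refine this.trans (le_of_eq ?_)
    ring
  have hpos' : TendstoUniformlyOn (fun n => x (σ n)) X atTop (Icc t₀ t₁) :=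
    TendstoUniformlyOn.congr_right hpos hX₀X
  refine ⟨X, V, σ, ⟨⟨_, hVlip⟩, hXder, ?_, ?_⟩, hσm, hpos', hvel'⟩
  · intro i hi t htA
    have h1 : Tendsto (fun n => x (σ n) t i) atTop (𝓝 (X t i)) :=
      (tendsto_pi_nhds.1 (hpos'.tendsto_at htA)) i
    refine tendsto_nhds_unique h1 ?_
    exact tendsto_const_nhds.congr fun n => ((hx' _).fixed i hi t htA).symm
  · intro i hi t htA
    have hsum : Tendsto (fun n => ∑ K ∈ P.elems i, ∑ s ∈ (Θ (σ n)).elemTimes K with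
        t₀ < s ∧ s ≤ t, (nextTime ((Θ (σ n)).elemTimes K) s - s) * P.force K i (x (σ n) s)) atTop
        (𝓝 (∑ K ∈ P.elems i, ∫ s in t₀..t, P.force K i (X s))) :=
      tendsto_finsetSum _ fun K _ => tendsto_riemannSum (fun n => hT (σ n)) hTσ hXc
        (fun n => hbx' (σ₁ (σ₂ n))) hpos' htA K i
    -- The position at the next instant differs from that at s by at most one step times B, so both
    -- have the same limit.
    have hnext : ∀ s ∈ Ico t₀ t₁, Tendsto (fun n => x (σ n) (nextTime ((Θ (σ n)).dofTimes i)
        (lastTime ((Θ (σ n)).dofTimes i) s)) i) atTop (𝓝 (X s i)) := by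
      intro s hs
      have h1 : Tendsto (fun n => x (σ n) s i) atTop (𝓝 (X s i)) :=
        (tendsto_pi_nhds.1 (hpos'.tendsto_at (Ico_subset_Icc_self hs))) i
      have h2 : Tendsto (fun n => x (σ n) (nextTime ((Θ (σ n)).dofTimes i)
        (lastTime ((Θ (σ n)).dofTimes i) s)) i - x (σ n) s i) atTop (𝓝 0) := by
        refine squeeze_zero_norm (fun n => ?_) (by simpa using hTσ.mul_const B)
        exact (hx' _).abs_next_sub_le (hT _) hs.1 hs.2 (hbv _ s hs)
      simpa using h2.add h1
    have ht₀ : t₀ ∈ Ico t₀ t₁ := ⟨le_rfl, ht⟩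
    have hl : Tendsto (fun n => P.mass i * ((Θ (σ n)).velocity (x (σ n)) t i
        - (Θ (σ n)).velocity (x (σ n)) t₀ i)) atTop (𝓝 (P.mass i * (V t i - V t₀ i))) :=
      (((tendsto_pi_nhds.1 (hptv t htA)) i).sub ((tendsto_pi_nhds.1 (hptv t₀ ht₀)) i)).const_mul _
    have hr := (((hnext t htA).sub (hnext t₀ ht₀)).const_mul (P.damp i)).sub hsum
    exact tendsto_nhds_unique hl (hr.congr fun n => ((hx' _).momentum hi le_rfl htA.1 htA.2).symm)

end ForceSystem

/-! ### Regularity of the elemental potentials -/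

theorem _root_.Continuous.prod_clm {X E F G : Type*} [TopologicalSpace X]
    [NormedAddCommGroup E] [NormedSpace ℝ E] [NormedAddCommGroup F] [NormedSpace ℝ F]
    [NormedAddCommGroup G] [NormedSpace ℝ G] {f : X → E →L[ℝ] F} {g : X → E →L[ℝ] G}
    (hf : Continuous f) (hg : Continuous g) : Continuous fun x => (f x).prod (g x) :=
  (ContinuousLinearMap.prodₗᵢ ℝ).continuous.comp (hf.prodMk hg)

/-- A `C¹` function on a finite-dimensional space whose gradient grows at most linearly. -/
structure LinearGradientGrowth {E : Type*} [NormedAddCommGroup E] [NormedSpace ℝ E]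
    (G : E → ℝ) : Prop where
  contDiff : ContDiff ℝ 1 G
  growth : ∃ C, 0 ≤ C ∧ ∀ x, ‖fderiv ℝ G x‖ ≤ C * (1 + ‖x‖)

namespace LinearGradientGrowth

variable {E F X : Type*} [NormedAddCommGroup E] [NormedSpace ℝ E]
  [NormedAddCommGroup F] [NormedSpace ℝ F]

theorem differentiable {G : E → ℝ} (hG : LinearGradientGrowth G) : Differentiable ℝ G :=
  hG.contDiff.differentiable one_ne_zero

theorem add {G H : E → ℝ} (hG : LinearGradientGrowth G) (hH : LinearGradientGrowth H) :
    LinearGradientGrowth (fun x => G x + H x) where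
  contDiff := hG.contDiff.add hH.contDiff
  growth := by
    obtain ⟨C, hC0, hC⟩ := hG.growth
    obtain ⟨C', hC0', hC'⟩ := hH.growth
    refine ⟨C + C', by positivity, fun x => ?_⟩
    rw [fderiv_fun_add (hG.differentiable x) (hH.differentiable x), add_mul]
    exact (norm_add_le _ _).trans (add_le_add (hC x) (hC' x))

theorem of_clm (L : E →L[ℝ] ℝ) : LinearGradientGrowth L where
  contDiff := L.contDiff
  growth := ⟨‖L‖, norm_nonneg _, fun x => by
    rw [L.fderiv]; nlinarith [norm_nonneg L, norm_nonneg x]⟩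

theorem of_linearMap [FiniteDimensional ℝ E] (L : E →ₗ[ℝ] ℝ) : LinearGradientGrowth L :=
  of_clm L.toContinuousLinearMap

theorem of_quadraticForm [FiniteDimensional ℝ E] (Q : QuadraticForm ℝ E) :
    LinearGradientGrowth (fun x => Q x) := by
  -- The polar form, normalized so that B x x = Q x; it is continuous because the space is
  -- finite-dimensional.
  set B : E →L[ℝ] E →L[ℝ] ℝ := LinearMap.toContinuousLinearMap
    ((LinearMap.toContinuousLinearMap : (E →ₗ[ℝ] ℝ) ≃ₗ[ℝ] E →L[ℝ] ℝ).toLinearMap ∘ₗ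
      QuadraticMap.associated Q) with hB
  have hQ : ∀ x, Q x = B x x := fun x => (QuadraticMap.associated_eq_self_apply ℝ Q x).symm
  have hder : ∀ x, HasFDerivAt (fun x => B x x) (B.flip x + B x) x := by
    intro x
    convert! B.hasFDerivAt_of_bilinear (hasFDerivAt_id x) (hasFDerivAt_id x) using 1
    ext y
    simp [add_comm]
  simp only [hQ]
  refine ⟨by fun_prop, ⟨2 * ‖B‖, by positivity, fun x => ?_⟩⟩
  rw [(hder x).fderiv]
  have h1 := B.le_opNorm x
  have h2 := B.flip.le_opNorm x
  rw [ContinuousLinearMap.opNorm_flip] at h2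
  have h3 := norm_add_le (B.flip x) (B x)
  nlinarith [norm_nonneg B, norm_nonneg x]

/-- Integrals of functions with linear gradient growth along linear maps that depend continuously
on a parameter. -/
theorem integral [FiniteDimensional ℝ E]
    [TopologicalSpace X] [SecondCountableTopology X] [T2Space X]
    [MeasurableSpace X] [BorelSpace X] {μ : Measure X} [IsLocallyFiniteMeasure μ]
    {s : Set X} (hs : IsCompact s) {A : X → E →L[ℝ] F} (hA : Continuous A) {G : F → ℝ}
    (hG : LinearGradientGrowth G) :
    LinearGradientGrowth (fun q => ∫ x in s, G (A x q) ∂μ) := by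
  obtain ⟨C, hC0, hC⟩ := hG.growth
  obtain ⟨M₀, hM₀⟩ := hs.exists_bound_of_continuousOn hA.continuousOn
  set M := max M₀ 0 with hMdef
  have hM0 : 0 ≤ M := le_max_right _ _
  have hM : ∀ x ∈ s, ‖A x‖ ≤ M := fun x hx => (hM₀ x hx).trans (le_max_left _ _)
  set D : E → X → E →L[ℝ] ℝ := fun q x => (fderiv ℝ G (A x q)).comp (A x) with hD
  have hApp : Continuous fun p : E × X => A p.2 p.1 := (hA.comp continuous_snd).clm_apply
    continuous_fst
  have hDc : Continuous D.uncurry :=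
    ((hG.contDiff.continuous_fderiv one_ne_zero).comp hApp).clm_comp (hA.comp continuous_snd)
  have hbound : ∀ x ∈ s, ∀ q, ‖D q x‖ ≤ C * (1 + M * ‖q‖) * M := by
    intro x hx q
    refine (ContinuousLinearMap.opNorm_comp_le _ _).trans ?_
    have h1 := (A x).le_opNorm q
    refine mul_le_mul ((hC _).trans ?_) (hM x hx) (norm_nonneg _) (by positivity)
    have := hM x hx
    gcongr
    exact h1.trans (by gcongr)
  have hFc : ∀ q, Continuous fun x => G (A x q) := fun q =>
    hG.contDiff.continuous.comp (hA.clm_apply continuous_const)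
  have hfin : μ s < ∞ := hs.measure_lt_top
  have hder : ∀ q, HasFDerivAt (fun q => ∫ x in s, G (A x q) ∂μ) (∫ x in s, D q x ∂μ) q := by
    intro q
    refine hasFDerivAt_integral_of_dominated_of_fderiv_le (F := fun q x => G (A x q)) (F' := D)
      (s := Metric.ball q 1) (bound := fun _ => C * (1 + M * (‖q‖ + 1)) * M)
      (Metric.ball_mem_nhds q one_pos) ?_ ?_ ?_ ?_ ?_ ?_
    · exact Eventually.of_forall fun q => (hFc q).aestronglyMeasurable
    · exact (hFc q).continuousOn.integrableOn_compact hs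
    · exact (hDc.comp (Continuous.prodMk_right q)).aestronglyMeasurable
    · refine (ae_restrict_iff' hs.measurableSet).2 (Eventually.of_forall fun x hx r hr => ?_)
      refine (hbound x hx r).trans ?_
      have : ‖r‖ ≤ ‖q‖ + 1 := by
        have h1 := norm_le_norm_add_norm_sub' r q
        have h2 := (mem_ball_iff_norm.1 hr).le
        linarith
      gcongr
    · exact integrableOn_const hfin.ne
    · exact Eventually.of_forall fun x r _ =>
        (hG.differentiable (A x r)).hasFDerivAt.comp r (A x).hasFDerivAt
  have hfd : fderiv ℝ (fun q => ∫ x in s, G (A x q) ∂μ) = fun q => ∫ x in s, D q x ∂μ :=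
    funext fun q => (hder q).fderiv
  -- The growth constant comes from C (1 + M ‖q‖) M and 1 + M ‖q‖ ≤ (M + 1) (1 + ‖q‖), integrated
  -- over s.
  refine ⟨contDiff_one_iff_fderiv.2 ⟨fun q => (hder q).differentiableAt, ?_⟩,
    ⟨C * M * (M + 1) * μ.real s, by positivity, fun q => ?_⟩⟩
  · rw [hfd]
    have := FiniteDimensional.proper_real E
    exact continuous_parametric_integral_of_continuous hDc hs
  · rw [hfd]
    refine (norm_setIntegral_le_of_norm_le_const hfin fun x hx => hbound x hx q).trans ?_
    have : C * (1 + M * ‖q‖) * M ≤ C * M * (M + 1) * (1 + ‖q‖) := by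
      have h1 : 1 + M * ‖q‖ ≤ (M + 1) * (1 + ‖q‖) := by nlinarith [norm_nonneg q]
      calc C * (1 + M * ‖q‖) * M = C * M * (1 + M * ‖q‖) := by ring
        _ ≤ C * M * ((M + 1) * (1 + ‖q‖)) := by gcongr
        _ = _ := by ring
    calc _ ≤ C * M * (M + 1) * (1 + ‖q‖) * μ.real s := by gcongr
      _ = _ := by ring

end LinearGradientGrowth

/-! ### Nodal values as degrees of freedom, and finite element fields as linear functions of them -/

namespace Tessellation

variable {d : ℕ} {B : Set (Vec d)} (T : Tessellation B)

/-- The scalar degrees of freedom: the components of the nodal values of `u` and of `ν`. -/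
abbrev Dof (k : ℕ) := (T.Node × Fin d) ⊕ (T.Node × Fin k)

/-- The node of a degree of freedom. -/
def Dof.node {T : Tessellation B} {k : ℕ} : T.Dof k → T.Node := Sum.elim Prod.fst Prod.fst

/-- The nodal values of `u`. -/
def dispOf (k : ℕ) : (T.Dof k → ℝ) →L[ℝ] T.NodalVec d :=
  (PiLp.continuousLinearEquiv 2 ℝ (fun _ : T.Node => Vec d)).symm.toContinuousLinearMap ∘L
    ContinuousLinearMap.pi fun a => (EuclideanSpace.equiv (Fin d) ℝ).symm.toContinuousLinearMap ∘L
      ContinuousLinearMap.pi fun j => ContinuousLinearMap.proj (Sum.inl (a, j))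

/-- The nodal values of `ν`. -/
def microOf (k : ℕ) : (T.Dof k → ℝ) →L[ℝ] T.NodalVec k :=
  (PiLp.continuousLinearEquiv 2 ℝ (fun _ : T.Node => Vec k)).symm.toContinuousLinearMap ∘L
    ContinuousLinearMap.pi fun a => (EuclideanSpace.equiv (Fin k) ℝ).symm.toContinuousLinearMap ∘L
      ContinuousLinearMap.pi fun j => ContinuousLinearMap.proj (Sum.inr (a, j))

/-- The values of all degrees of freedom. -/
def pack {k : ℕ} (u : T.NodalVec d) (ν : T.NodalVec k) : T.Dof k → ℝ :=
  Sum.elim (fun p => u p.1 p.2) (fun p => ν p.1 p.2)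

@[simp] theorem dispOf_pack {k : ℕ} (u : T.NodalVec d) (ν : T.NodalVec k) :
    T.dispOf k (T.pack u ν) = u := rfl

@[simp] theorem microOf_pack {k : ℕ} (u : T.NodalVec d) (ν : T.NodalVec k) :
    T.microOf k (T.pack u ν) = ν := rfl

@[simp] theorem pack_inl {k : ℕ} (u : T.NodalVec d) (ν : T.NodalVec k) (p : T.Node × Fin d) :
    T.pack u ν (Sum.inl p) = u p.1 p.2 := rfl

@[simp] theorem pack_inr {k : ℕ} (u : T.NodalVec d) (ν : T.NodalVec k) (p : T.Node × Fin k) :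
    T.pack u ν (Sum.inr p) = ν p.1 p.2 := rfl

theorem pack_dispOf_microOf {k : ℕ} (x : T.Dof k → ℝ) :
    T.pack (T.dispOf k x) (T.microOf k x) = x := by
  ext (p | p) <;> rfl

theorem exists_shape_eq (K : T.Elem) (a : T.Node) :
    ∃ (L : Vec d →L[ℝ] ℝ) (c : ℝ), ∀ x, T.shape K a x = L x + c := by
  by_cases h : a.1 ∈ K.1
  · refine ⟨LinearMap.toContinuousLinearMap ((T.affineBasis K).coord ⟨a.1, h⟩).linear,
      (T.affineBasis K).coord ⟨a.1, h⟩ 0, fun x => ?_⟩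
    have := ((T.affineBasis K).coord ⟨a.1, h⟩).decomp
    rw [shape, dif_pos h]
    conv_lhs => rw [this]
    rfl
  · exact ⟨0, 0, fun x => by rw [shape, dif_neg h]; simp⟩

theorem shape_of_notMem {K : T.Elem} {a : T.Node} (h : a.1 ∉ K.1) (x : Vec d) :
    T.shape K a x = 0 := by rw [shape, dif_neg h]

theorem continuous_shape (K : T.Elem) (a : T.Node) : Continuous (T.shape K a) := by
  obtain ⟨L, c, h⟩ := T.exists_shape_eq K a
  rw [funext h]
  fun_prop

theorem differentiable_shape (K : T.Elem) (a : T.Node) : Differentiable ℝ (T.shape K a) := by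
  obtain ⟨L, c, h⟩ := T.exists_shape_eq K a
  rw [funext h]
  fun_prop

theorem fderiv_shape_eq (K : T.Elem) (a : T.Node) (x : Vec d) :
    fderiv ℝ (T.shape K a) x = fderiv ℝ (T.shape K a) 0 := by
  obtain ⟨L, c, h⟩ := T.exists_shape_eq K a
  rw [funext h]
  simp

theorem isCompact_simplex (K : T.Elem) : IsCompact (T.simplex K) :=
  K.1.finite_toSet.isCompact_convexHull ℝ

/-- The finite element field at a point, as a linear function of the nodal values. -/
def fieldL (n : ℕ) (K : T.Elem) (x : Vec d) : T.NodalVec n →L[ℝ] Vec n :=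
  ∑ a : T.Node, T.shape K a x • PiLp.proj 2 (fun _ : T.Node => Vec n) a

theorem fieldL_apply {n : ℕ} (K : T.Elem) (x : Vec d) (q : T.NodalVec n) :
    T.fieldL n K x q = T.field K q x := by
  simp [fieldL, field]

theorem continuous_fieldL (n : ℕ) (K : T.Elem) : Continuous (T.fieldL n K) :=
  continuous_finsetSum _ fun a _ => (T.continuous_shape K a).smul continuous_const

/-- Shape functions are affine on an element, so the gradient does not depend on x and is linear in
the nodal values. -/
theorem gradField_eq {n : ℕ} (K : T.Elem) (q : T.NodalVec n) (x : Vec d) (i : Fin n)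
    (j : Fin d) : T.gradField K q x i j =
      ∑ a : T.Node, fderiv ℝ (T.shape K a) 0 (EuclideanSpace.single j 1) * q a i := by
  have h : HasFDerivAt (T.field K q)
      (∑ a : T.Node, (fderiv ℝ (T.shape K a) x).smulRight (q a)) x := by
    have := HasFDerivAt.fun_sum (u := Finset.univ) fun (a : T.Node) _ =>
      ((T.differentiable_shape K a x).hasFDerivAt.smul_const (q a))
    exact this
  simp only [gradField, Matrix.of_apply, h.fderiv, _root_.sum_apply]
  simp [T.fderiv_shape_eq K _ x]

/-- The gradient of the finite element field, as a linear function of the nodal values. -/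
def gradL (n : ℕ) (K : T.Elem) : T.NodalVec n →L[ℝ] (Fin n → Fin d → ℝ) :=
  ContinuousLinearMap.pi fun i => ContinuousLinearMap.pi fun j =>
    ∑ a : T.Node, fderiv ℝ (T.shape K a) 0 (EuclideanSpace.single j 1) •
      (EuclideanSpace.proj i ∘L PiLp.proj 2 (fun _ : T.Node => Vec n) a)

theorem of_gradL_apply {n : ℕ} (K : T.Elem) (q : T.NodalVec n) (x : Vec d) :
    Matrix.of (T.gradL n K q) = T.gradField K q x := by
  ext i j
  rw [gradField_eq]
  simp [gradL]

end Tessellation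

section Potential

variable {d k : ℕ} (𝓑 : ComplexBody d k) (T : Tessellation 𝓑.domain)

/-- The potential energy of an element as a function of the degrees of freedom. -/
def dofPotential (K : T.Elem) (x : T.Dof k → ℝ) : ℝ :=
  elemPotential 𝓑 T K (T.dispOf k x) (T.microOf k x)

variable {𝓑}

/-- A square integrable traction is integrable because the boundary has finite measure, and the
finite element field is bounded on the compact simplex. -/
theorem integrableOn_traction_inner (hB : 𝓑.IsBoundedDomain) (hA3 : 𝓑.A3) (K : T.Elem)
    (u : T.NodalVec d) : Integrable (fun x => inner ℝ (𝓑.traction x) (T.field K u x))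
      (μHE[d - 1].restrict (frontier (T.simplex K) ∩ 𝓑.tractionBdry)) := by
  have hfin : IsFiniteMeasure ((μHE[d - 1]).restrict (frontier 𝓑.domain)) :=
    ⟨by rw [Measure.restrict_apply_univ]; exact hB.boundary_finite⟩
  have ht : IntegrableOn 𝓑.traction (frontier 𝓑.domain) μHE[d - 1] :=
    hA3.traction_memLp.integrable one_le_two
  have ht' : IntegrableOn 𝓑.traction (frontier (T.simplex K) ∩ 𝓑.tractionBdry) μHE[d - 1] :=
    ht.mono_set (inter_subset_right.trans hA3.tractionBdry_subset)
  have hc : Continuous (T.field K u) := by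
    have : T.field K u = fun x => T.fieldL d K x u := funext fun x => (T.fieldL_apply K x u).symm
    rw [this]
    exact (T.continuous_fieldL d K).clm_apply continuous_const
  obtain ⟨M, hM⟩ := (T.isCompact_simplex K).exists_bound_of_continuousOn hc.continuousOn
  refine Integrable.mono' (ht'.norm.mul_const M)
    (ht'.aestronglyMeasurable.inner hc.aestronglyMeasurable) ?_
  have hmeas : MeasurableSet (frontier (T.simplex K) ∩ 𝓑.tractionBdry) :=
    (isClosed_frontier.inter hA3.tractionBdry_closed).measurableSet
  refine (ae_restrict_iff' hmeas).2 (Eventually.of_forall fun x hx => ?_)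
  refine (norm_inner_le_norm _ _).trans ?_
  refine mul_le_mul_of_nonneg_left (hM x ?_) (norm_nonneg _)
  exact (T.isCompact_simplex K).isClosed.frontier_subset hx.1

/-- Elastic and external energies are integrals, along linear maps depending continuously on x, of a
quadratic form and of w, both with gradients of linear growth. The traction term is a linear
functional in finite dimension. -/
theorem linearGradientGrowth_dofPotential (hB : 𝓑.IsBoundedDomain) (hA2 : 𝓑.A2) (hA3 : 𝓑.A3)
    (K : T.Elem) : LinearGradientGrowth (dofPotential 𝓑 T K) := by
  have hpot : LinearGradientGrowth 𝓑.potential := by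
    obtain ⟨h1, -, Xi, hXi, h2⟩ := hA2
    refine ⟨h1, 2 * Xi, by positivity, fun p => (h2 p.1 p.2).trans ?_⟩
    have := norm_fst_le p
    have := norm_snd_le p
    nlinarith [norm_nonneg p]
  -- Matrices are read as functions of two indices, which form a normed space.
  set ofL : ((Fin d → Fin d → ℝ) × Vec k × (Fin k → Fin d → ℝ)) →ₗ[ℝ]
      (Matrix (Fin d) (Fin d) ℝ × Vec k × Matrix (Fin k) (Fin d) ℝ) :=
    LinearMap.prodMap (Matrix.ofLinearEquiv ℝ).toLinearMap
      (LinearMap.prodMap LinearMap.id (Matrix.ofLinearEquiv ℝ).toLinearMap) with hofL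
  have hen := LinearGradientGrowth.of_quadraticForm (𝓑.energy.comp ofL)
  have h1 := LinearGradientGrowth.integral (μ := volume) (T.isCompact_simplex K)
    (A := fun x => ((T.gradL d K).comp (T.dispOf k)).prod
      (((T.fieldL k K x).comp (T.microOf k)).prod ((T.gradL k K).comp (T.microOf k))))
    (continuous_const.prod_clm (((T.continuous_fieldL k K).clm_comp continuous_const).prod_clm
      continuous_const)) hen
  have h2 := LinearGradientGrowth.integral (μ := volume) (T.isCompact_simplex K)
    (A := fun x => ((T.fieldL d K x).comp (T.dispOf k)).prod
      ((T.fieldL k K x).comp (T.microOf k)))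
    (((T.continuous_fieldL d K).clm_comp continuous_const).prod_clm
      ((T.continuous_fieldL k K).clm_comp continuous_const)) hpot
  set L : (T.Dof k → ℝ) →ₗ[ℝ] ℝ :=
    { toFun := fun x₀ => -∫ x in frontier (T.simplex K) ∩ 𝓑.tractionBdry,
        inner ℝ (𝓑.traction x) (T.field K (T.dispOf k x₀) x) ∂(μHE[d - 1])
      map_add' := fun u v => by
        simp only [← T.fieldL_apply, map_add, inner_add_right]
        rw [integral_add, neg_add]
        · simpa only [T.fieldL_apply] using integrableOn_traction_inner T hB hA3 K (T.dispOf k u)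
        · simpa only [T.fieldL_apply] using integrableOn_traction_inner T hB hA3 K (T.dispOf k v)
      map_smul' := fun c u => by
        simp only [← T.fieldL_apply, map_smul, inner_smul_right]
        rw [integral_const_mul]
        simp } with hL
  have h3 := LinearGradientGrowth.of_linearMap L
  have h := (h1.add h2).add h3
  convert! h using 2 with x
  have hLx : L x = -∫ y in frontier (T.simplex K) ∩ 𝓑.tractionBdry,
    inner ℝ (𝓑.traction y) (T.field K (T.dispOf k x) y) ∂(μHE[d - 1]) := rfl
  rw [dofPotential, elemPotential, sub_eq_add_neg, hLx]
  simp only [← T.fieldL_apply, ← T.of_gradL_apply]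
  rfl

/-- On K only the shape functions of its own vertices are nonzero, and all three integrals depend on
the nodal values only through the fields on K. -/
theorem dofPotential_congr {K : T.Elem} {x y : T.Dof k → ℝ}
    (h : ∀ i : T.Dof k, K ∈ T.elemsAt (Tessellation.Dof.node i) → x i = y i) :
    dofPotential 𝓑 T K x = dofPotential 𝓑 T K y := by
  have hmem : ∀ a : T.Node, a.1 ∈ K.1 → K ∈ T.elemsAt a := fun a ha => by
    simp [Tessellation.elemsAt, ha]
  have hu : T.field K (T.dispOf k x) = T.field K (T.dispOf k y) := by
    funext z
    refine Finset.sum_congr rfl fun a _ => ?_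
    by_cases ha : a.1 ∈ K.1
    · congr 1
      ext j
      exact h (Sum.inl (a, j)) (hmem a ha)
    · simp [T.shape_of_notMem ha]
  have hν : T.field K (T.microOf k x) = T.field K (T.microOf k y) := by
    funext z
    refine Finset.sum_congr rfl fun a _ => ?_
    by_cases ha : a.1 ∈ K.1
    · congr 1
      ext j
      exact h (Sum.inr (a, j)) (hmem a ha)
    · simp [T.shape_of_notMem ha]
  simp only [dofPotential, elemPotential, Tessellation.gradField, hu, hν]

open Classical in
/-- The coordinates of the degrees of freedom of an element; the others are put to zero. -/
def restrictDof (K : T.Elem) : (T.Dof k → ℝ) →L[ℝ] (T.Dof k → ℝ) :=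
  ContinuousLinearMap.pi fun i =>
    if K ∈ T.elemsAt (Tessellation.Dof.node i) then ContinuousLinearMap.proj i else 0

theorem restrictDof_apply_of_mem {K : T.Elem} {i : T.Dof k}
    (hi : K ∈ T.elemsAt (Tessellation.Dof.node i)) (x : T.Dof k → ℝ) :
    restrictDof T K x i = x i := by simp [restrictDof, hi]

theorem restrictDof_apply_of_notMem {K : T.Elem} {i : T.Dof k}
    (hi : K ∉ T.elemsAt (Tessellation.Dof.node i)) (x : T.Dof k → ℝ) :
    restrictDof T K x i = 0 := by simp [restrictDof, hi]

/-- The potential factors through `restrictDof`. The chain rule gives both forms of locality: forces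
depend only on the degrees of freedom of the element, and act only on them. -/
theorem fderiv_dofPotential_eq {K : T.Elem} (hd : Differentiable ℝ (dofPotential 𝓑 T K))
    (x : T.Dof k → ℝ) : fderiv ℝ (dofPotential 𝓑 T K) x =
      (fderiv ℝ (dofPotential 𝓑 T K) (restrictDof T K x)).comp (restrictDof T K) := by
  have hcomp : dofPotential 𝓑 T K = dofPotential 𝓑 T K ∘ restrictDof T K :=
    funext fun z => dofPotential_congr T fun i hi => (restrictDof_apply_of_mem T hi z).symm
  conv_lhs => rw [hcomp]
  exact ((hd _).hasFDerivAt.comp x (restrictDof T K).hasFDerivAt).fderiv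

theorem fderiv_dofPotential_congr {K : T.Elem} {x y : T.Dof k → ℝ}
    (hd : Differentiable ℝ (dofPotential 𝓑 T K))
    (h : ∀ i : T.Dof k, K ∈ T.elemsAt (Tessellation.Dof.node i) → x i = y i) :
    fderiv ℝ (dofPotential 𝓑 T K) x = fderiv ℝ (dofPotential 𝓑 T K) y := by
  have hxy : restrictDof T K x = restrictDof T K y := by
    ext i
    by_cases hi : K ∈ T.elemsAt (Tessellation.Dof.node i)
    · rw [restrictDof_apply_of_mem T hi, restrictDof_apply_of_mem T hi, h i hi]
    · rw [restrictDof_apply_of_notMem T hi, restrictDof_apply_of_notMem T hi]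
  rw [fderiv_dofPotential_eq T hd x, fderiv_dofPotential_eq T hd y, hxy]

open Classical in
theorem fderiv_dofPotential_single {K : T.Elem} {i : T.Dof k}
    (hd : Differentiable ℝ (dofPotential 𝓑 T K))
    (hi : K ∉ T.elemsAt (Tessellation.Dof.node i)) (x : T.Dof k → ℝ) :
    fderiv ℝ (dofPotential 𝓑 T K) x (Pi.single i 1) = 0 := by
  have h0 : restrictDof T K (Pi.single i 1) = 0 := by
    ext j
    by_cases hj : K ∈ T.elemsAt (Tessellation.Dof.node j)
    · rw [restrictDof_apply_of_mem T hj, Pi.single_eq_of_ne, Pi.zero_apply]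
      rintro rfl
      exact hi hj
    · rw [restrictDof_apply_of_notMem T hj, Pi.zero_apply]
  rw [fderiv_dofPotential_eq T hd, ContinuousLinearMap.comp_apply, h0, map_zero]

end Potential

/-! ### The discrete principle in terms of the degrees of freedom -/

theorem sum_apply_single {ι : Type*} [Fintype ι] [DecidableEq ι] (L : (ι → ℝ) →L[ℝ] ℝ)
    (v : ι → ℝ) : L v = ∑ i, L (Pi.single i 1) * v i := by
  conv_lhs => rw [← Finset.univ_sum_single v, map_sum]
  refine Finset.sum_congr rfl fun i _ => ?_
  rw [mul_comm, ← smul_eq_mul, ← map_smul, ← Pi.single_smul, smul_eq_mul, mul_one]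

namespace ForceSystem.Grids

variable {ι κ : Type*} [Fintype ι] [Fintype κ] {P : ForceSystem ι κ} {t₀ t₁ : ℝ}
  (Θ : P.Grids t₀ t₁)

/-- The residual of the balance of momentum. -/
def residual (x : ℝ → ι → ℝ) (i : ι) (t : ℝ) : ℝ :=
  P.mass i * (rate (Θ.dofTimes i) (fun r => x r i) (prevTime (Θ.dofTimes i) t)
      - rate (Θ.dofTimes i) (fun r => x r i) t)
    - Θ.impulse i t (x t) + P.damp i * (x (nextTime (Θ.dofTimes i) t) i - x t i)

omit [Fintype κ] in
theorem balance_iff_residual {x : ℝ → ι → ℝ} {i : ι} {t : ℝ} :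
    Θ.Balance x i t ↔ Θ.residual x i t = 0 := by
  unfold Balance residual
  constructor <;> intro h <;> linarith

/-- Exchange of summations: a pair of an element at i and one of its instants is the same as an
instant of i with an element acting there. The terms at t₀ vanish with the test function. -/
theorem sum_force_eq_sum_impulse (hzero : ∀ K i x, K ∉ P.elems i → P.force K i x = 0)
    {x φ : ℝ → ι → ℝ} (h0 : φ t₀ = 0) :
    ∑ K, ∑ s ∈ Θ.elemTimes K with s < t₁, (nextTime (Θ.elemTimes K) s - s) *
        ∑ i, P.force K i (x s) * φ s i =
      ∑ i, ∑ t ∈ Θ.dofTimes i with t₀ < t ∧ t < t₁, Θ.impulse i t (x t) * φ t i := by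
  classical
  have e1 : ∀ K, ∑ s ∈ Θ.elemTimes K with s < t₁, (nextTime (Θ.elemTimes K) s - s) *
        ∑ i, P.force K i (x s) * φ s i =
      ∑ i, ∑ s ∈ Θ.elemTimes K with t₀ < s ∧ s < t₁,
        (nextTime (Θ.elemTimes K) s - s) * P.force K i (x s) * φ s i := by
    intro K
    rw [Finset.sum_comm]
    symm
    simp only [Finset.mul_sum, ← mul_assoc]
    refine Finset.sum_subset (fun s hs => ?_) fun s hs hs' => ?_
    · rw [Finset.mem_filter] at hs ⊢
      exact ⟨hs.1, hs.2.2⟩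
    · rw [Finset.mem_filter] at hs hs'
      have : s = t₀ := le_antisymm (not_lt.1 fun h => hs' ⟨hs.1, h, hs.2⟩)
        ((Θ.elem_grid K).subset_Icc s hs.1).1
      simp [this, h0]
  simp only [e1]
  rw [Finset.sum_comm]
  refine Finset.sum_congr rfl fun i _ => ?_
  have e2 : ∑ K, ∑ s ∈ Θ.elemTimes K with t₀ < s ∧ s < t₁,
        (nextTime (Θ.elemTimes K) s - s) * P.force K i (x s) * φ s i =
      ∑ K ∈ P.elems i, ∑ s ∈ Θ.elemTimes K with t₀ < s ∧ s < t₁,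
        (nextTime (Θ.elemTimes K) s - s) * P.force K i (x s) * φ s i := by
    symm
    refine Finset.sum_subset (Finset.subset_univ _) fun K _ hK => ?_
    refine Finset.sum_eq_zero fun s _ => ?_
    rw [hzero K i _ hK]; ring
  rw [e2]
  simp only [impulse, Finset.sum_mul]
  symm
  refine Finset.sum_comm' fun t K => ?_
  simp only [Finset.mem_filter, Θ.mem_dofTimes]
  constructor
  · rintro ⟨⟨-, h⟩, hK, ht⟩
    exact ⟨⟨ht, h⟩, hK⟩
  · rintro ⟨⟨ht, h⟩, hK⟩
    exact ⟨⟨⟨K, hK, ht⟩, h⟩, hK, ht⟩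

/-- Discrete integration by parts in the first variation. -/
theorem variation_eq_sum_residual (hzero : ∀ K i x, K ∉ P.elems i → P.force K i x = 0)
    {x φ : ℝ → ι → ℝ} (h0 : φ t₀ = 0) (h1 : φ t₁ = 0) :
    (∑ i, ∑ t ∈ Θ.dofTimes i with t < t₁, P.mass i * (nextTime (Θ.dofTimes i) t - t) *
        (rate (Θ.dofTimes i) (fun r => x r i) t * rate (Θ.dofTimes i) (fun r => φ r i) t))
      - (∑ K, ∑ s ∈ Θ.elemTimes K with s < t₁, (nextTime (Θ.elemTimes K) s - s) *
        ∑ i, P.force K i (x s) * φ s i)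
      + (∑ i, ∑ t ∈ Θ.dofTimes i with t < t₁,
        P.damp i * (x (nextTime (Θ.dofTimes i) t) i - x t i) * φ t i) =
    ∑ i, ∑ t ∈ Θ.dofTimes i with t₀ < t ∧ t < t₁, Θ.residual x i t * φ t i := by
  rw [Θ.sum_force_eq_sum_impulse hzero h0, ← Finset.sum_sub_distrib, ← Finset.sum_add_distrib]
  refine Finset.sum_congr rfl fun i _ => ?_
  have hg := Θ.dof_grid i
  have e1 : ∑ t ∈ Θ.dofTimes i with t < t₁, P.mass i * (nextTime (Θ.dofTimes i) t - t) *
        (rate (Θ.dofTimes i) (fun r => x r i) t * rate (Θ.dofTimes i) (fun r => φ r i) t) =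
      ∑ t ∈ Θ.dofTimes i with t₀ < t ∧ t < t₁, P.mass i *
        (rate (Θ.dofTimes i) (fun r => x r i) (prevTime (Θ.dofTimes i) t)
          - rate (Θ.dofTimes i) (fun r => x r i) t) * φ t i := by
    have := hg.sum_mul_next_sub (fun t => P.mass i * rate (Θ.dofTimes i) (fun r => x r i) t)
      (fun t => φ t i) (congrFun h0 i) (congrFun h1 i)
    simp only [← mul_sub] at this
    rw [← this]
    refine Finset.sum_congr rfl fun t ht => ?_
    rw [Finset.mem_filter] at ht
    have h2 := rate_mul_step (f := fun r => φ r i) (hg.lt_next ht.2)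
    rw [mul_sub, ← mul_sub, ← h2]
    ring
  have e2 : ∑ t ∈ Θ.dofTimes i with t < t₁,
        P.damp i * (x (nextTime (Θ.dofTimes i) t) i - x t i) * φ t i =
      ∑ t ∈ Θ.dofTimes i with t₀ < t ∧ t < t₁,
        P.damp i * (x (nextTime (Θ.dofTimes i) t) i - x t i) * φ t i := by
    symm
    refine Finset.sum_subset (fun s hs => ?_) fun s hs hs' => ?_
    · rw [Finset.mem_filter] at hs ⊢
      exact ⟨hs.1, hs.2.2⟩
    · rw [Finset.mem_filter] at hs hs'
      have : s = t₀ := le_antisymm (not_lt.1 fun h => hs' ⟨hs.1, h, hs.2⟩)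
        (hg.subset_Icc s hs.1).1
      simp [this, h0]
  rw [e1, e2, ← Finset.sum_sub_distrib, ← Finset.sum_add_distrib]
  refine Finset.sum_congr rfl fun t _ => ?_
  rw [residual]
  ring

end ForceSystem.Grids

/-! ### Finite element action and dissipation in terms of the force system -/

section Translation

variable {d k : ℕ} {𝓑 : ComplexBody d k} {T : Tessellation 𝓑.domain}

theorem Tessellation.elemsAt_nonempty {B : Set (Vec d)} {T : Tessellation B} (a : T.Node) :
    (T.elemsAt a).Nonempty := by
  obtain ⟨K, hK, ha⟩ := Finset.mem_biUnion.1 a.2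
  exact ⟨⟨K, hK⟩, by simpa [Tessellation.elemsAt] using ha⟩

theorem Tessellation.Coefficients.nodalInertia_pos {B : Set (Vec d)} {T : Tessellation B}
    (c : T.Coefficients) (a : T.Node) : 0 < c.nodalInertia a :=
  Finset.sum_pos (fun K hK => c.inertia_pos K a (Finset.mem_filter.1 hK).2)
    (Tessellation.elemsAt_nonempty a)

theorem Tessellation.Coefficients.nodalDiss_nonneg {B : Set (Vec d)} {T : Tessellation B}
    (c : T.Coefficients) (a : T.Node) : 0 ≤ c.nodalDiss a :=
  Finset.sum_nonneg fun K hK => (c.diss_pos K a (Finset.mem_filter.1 hK).2).le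

open Classical in
/-- The system of the nodal degrees of freedom. -/
def nodalSystem (hV : ∀ K, LinearGradientGrowth (dofPotential 𝓑 T K)) (c : T.Coefficients) :
    ForceSystem (T.Dof k) T.Elem where
  elems i := T.elemsAt (Tessellation.Dof.node i)
  elems_nonempty i := Tessellation.elemsAt_nonempty _
  mass := Sum.elim (fun p => ∑ K ∈ T.elemsAt p.1, c.mass K p.1) fun p => c.nodalInertia p.1
  damp := Sum.elim (fun _ => 0) fun p => c.nodalDiss p.1
  fixed := Sum.elim (fun p => p.1.1 ∈ 𝓑.dispBdry) fun p => p.1.1 ∈ 𝓑.microBdry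
  force K i x := fderiv ℝ (dofPotential 𝓑 T K) x (Pi.single i 1)
  mass_pos := by
    rintro (⟨a, j⟩ | ⟨a, j⟩)
    · exact Finset.sum_pos (fun K hK => c.mass_pos K a (Finset.mem_filter.1 hK).2)
        (Tessellation.elemsAt_nonempty a)
    · exact c.nodalInertia_pos a
  damp_nonneg := by
    rintro (⟨a, j⟩ | ⟨a, j⟩)
    · exact le_rfl
    · exact c.nodalDiss_nonneg a
  force_continuous K i :=
    ((hV K).contDiff.continuous_fderiv one_ne_zero).clm_apply continuous_const
  force_growth := by
    choose C hC0 hC using fun K => (hV K).growth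
    refine ⟨∑ K, C K, fun K i x => ?_⟩
    have h1 := (fderiv ℝ (dofPotential 𝓑 T K) x).le_opNorm (Pi.single i 1)
    have h2 : ‖(Pi.single i 1 : T.Dof k → ℝ)‖ = 1 := by rw [Pi.norm_single, norm_one]
    rw [h2, mul_one] at h1
    refine h1.trans ((hC K x).trans ?_)
    gcongr
    exact Finset.single_le_sum (fun K _ => hC0 K) (Finset.mem_univ K)
  force_local K i x y h := by
    rw [fderiv_dofPotential_congr T (hV K).differentiable h]

variable {t₀ t₁ : ℝ} (hV : ∀ K, LinearGradientGrowth (dofPotential 𝓑 T K)) (c : T.Coefficients)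

theorem nodalSystem_force_eq_zero (K : T.Elem) (i : T.Dof k) (x : T.Dof k → ℝ)
    (h : K ∉ (nodalSystem hV c).elems i) : (nodalSystem hV c).force K i x = 0 :=
  fderiv_dofPotential_single T (hV K).differentiable h x

theorem fderiv_dofPotential_apply (K : T.Elem) (x v : T.Dof k → ℝ) :
    fderiv ℝ (dofPotential 𝓑 T K) x v = ∑ i, (nodalSystem hV c).force K i x * v i := by
  classical
  exact sum_apply_single _ v

/-- The grids of the degrees of freedom for an asynchronous time set. -/
def TimeSet.grids (Θ : TimeSet T t₀ t₁) (ht : t₀ < t₁) : (nodalSystem hV c).Grids t₀ t₁ where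
  elemTimes := Θ.times
  dofTimes i := Θ.nodalTimes (Tessellation.Dof.node i)
  elem_grid K := ⟨ht, Θ.start_mem K, Θ.end_mem K, Θ.subset_Icc K⟩
  mem_dofTimes i t := by simp [TimeSet.nodalTimes, nodalSystem]

variable (T) in
/-- The motion of all degrees of freedom. -/
def packed (u : ℝ → T.NodalVec d) (ν : ℝ → T.NodalVec k) (t : ℝ) : T.Dof k → ℝ :=
  T.pack (u t) (ν t)

theorem rate_apply {n : ℕ} (S : Finset ℝ) (f : ℝ → Vec n) (t : ℝ) (j : Fin n) :
    rate S f t j = rate S (fun r => f r j) t := by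
  simp [rate]

theorem norm_sq_rate {n : ℕ} (S : Finset ℝ) (f : ℝ → Vec n) (t : ℝ) :
    ‖rate S f t‖ ^ 2 = ∑ j, rate S (fun r => f r j) t ^ 2 := by
  simp only [EuclideanSpace.real_norm_sq_eq, rate_apply]

namespace TimeSet

variable (Θ : TimeSet T t₀ t₁) (ht : t₀ < t₁) {u φ : ℝ → T.NodalVec d} {ν ψ : ℝ → T.NodalVec k}

theorem piecewiseAffine_iff {n : ℕ} {q : ℝ → T.NodalVec n} :
    Θ.PiecewiseAffine q ↔
      ∀ (a : T.Node) (j : Fin n), AffineAlong (Θ.nodalTimes a) t₁ fun t => q t a j := by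
  constructor
  · intro h a j t ht ht1 s hs
    have := congrArg (fun v : Vec n => v j) (h a t ht ht1 s hs)
    simpa [rate_apply] using this
  · intro h a t ht ht1 s hs
    ext j
    simpa [rate_apply] using h a j t ht ht1 s hs

theorem memY_iff : Θ.MemY u ν ↔
    (∀ i, AffineAlong ((Θ.grids hV c ht).dofTimes i) t₁ fun t => packed T u ν t i) ∧
      ∀ i, (nodalSystem hV c).fixed i → ∀ t ∈ Icc t₀ t₁, packed T u ν t i = 0 := by
  unfold MemY
  rw [Θ.piecewiseAffine_iff, Θ.piecewiseAffine_iff]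
  constructor
  · rintro ⟨h1, h2, h3⟩
    refine ⟨?_, ?_⟩
    · rintro (⟨a, j⟩ | ⟨a, j⟩)
      · exact h1 a j
      · exact h2 a j
    · rintro (⟨a, j⟩ | ⟨a, j⟩) hi t ht
      · have := (h3 t ht a).1 hi
        simp [packed, this]
      · have := (h3 t ht a).2 hi
        simp [packed, this]
  · rintro ⟨h1, h2⟩
    refine ⟨fun a j => h1 (Sum.inl (a, j)), fun a j => h1 (Sum.inr (a, j)), fun t ht a => ?_⟩
    refine ⟨fun h => ?_, fun h => ?_⟩
    · ext j
      exact h2 (Sum.inl (a, j)) h t ht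
    · ext j
      exact h2 (Sum.inr (a, j)) h t ht

/-- For each element the half-open cells of its grid partition the nodal instants before t₁, so the
nested kinetic sum is a single sum over nodal instants. Summing over the elements at a node then
assembles the nodal masses. -/
theorem discreteAction_eq : Θ.discreteAction c u ν =
    (∑ i, ∑ t ∈ (Θ.grids hV c ht).dofTimes i with t < t₁, (nodalSystem hV c).mass i / 2 *
        (nextTime ((Θ.grids hV c ht).dofTimes i) t - t) *
        rate ((Θ.grids hV c ht).dofTimes i) (fun r => packed T u ν r i) t ^ 2)
      - ∑ K, ∑ s ∈ Θ.times K with s < t₁, (nextTime (Θ.times K) s - s) *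
        dofPotential 𝓑 T K (packed T u ν s) := by
  have hgrid : ∀ a : T.Node, IsGrid (Θ.nodalTimes a) t₀ t₁ := fun a => by
    obtain ⟨K, hK⟩ := Tessellation.elemsAt_nonempty a
    refine ⟨ht, ?_, ?_, fun t ht => ?_⟩
    · exact Finset.mem_biUnion.2 ⟨K, hK, Θ.start_mem K⟩
    · exact Finset.mem_biUnion.2 ⟨K, hK, Θ.end_mem K⟩
    · obtain ⟨K, -, hK⟩ := Finset.mem_biUnion.1 ht
      exact Θ.subset_Icc K t hK
  unfold discreteAction elemAction
  simp only [Finset.sum_sub_distrib]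
  refine congrArg₂ _ ?_ rfl
  have e1 : ∀ K : T.Elem, ∑ s ∈ Θ.times K with s < t₁, ∑ a ∈ T.nodesOf K,
      ∑ t ∈ Θ.nodalTimes a with s ≤ t ∧ t < nextTime (Θ.times K) s,
        (c.mass K a / 2 * (nextTime (Θ.nodalTimes a) t - t)
            * ‖rate (Θ.nodalTimes a) (fun r => u r a) t‖ ^ 2
          + c.inertia K a / 2 * (nextTime (Θ.nodalTimes a) t - t)
            * ‖rate (Θ.nodalTimes a) (fun r => ν r a) t‖ ^ 2) =
      ∑ a ∈ T.nodesOf K, ∑ t ∈ Θ.nodalTimes a with t < t₁,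
        (c.mass K a / 2 * (nextTime (Θ.nodalTimes a) t - t)
            * ‖rate (Θ.nodalTimes a) (fun r => u r a) t‖ ^ 2
          + c.inertia K a / 2 * (nextTime (Θ.nodalTimes a) t - t)
            * ‖rate (Θ.nodalTimes a) (fun r => ν r a) t‖ ^ 2) := by
    intro K
    rw [Finset.sum_comm]
    refine Finset.sum_congr rfl fun a _ => ?_
    exact ((Θ.grids hV c ht).elem_grid K).sum_cells (hgrid a) _
  rw [Finset.sum_congr rfl fun K _ => e1 K]
  rw [Finset.sum_comm' (t' := Finset.univ) (s' := fun a => T.elemsAt a) (fun K a => by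
    simp [Tessellation.nodesOf, Tessellation.elemsAt])]
  rw [Fintype.sum_sum_type, Fintype.sum_prod_type, Fintype.sum_prod_type,
    ← Finset.sum_add_distrib]
  refine Finset.sum_congr rfl fun a _ => ?_
  rw [Finset.sum_comm]
  change _ = (∑ j, ∑ t ∈ Θ.nodalTimes a with t < t₁, (∑ K ∈ T.elemsAt a, c.mass K a) / 2 *
      (nextTime (Θ.nodalTimes a) t - t) * rate (Θ.nodalTimes a) (fun r => u r a j) t ^ 2) +
    ∑ j, ∑ t ∈ Θ.nodalTimes a with t < t₁, (∑ K ∈ T.elemsAt a, c.inertia K a) / 2 *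
      (nextTime (Θ.nodalTimes a) t - t) * rate (Θ.nodalTimes a) (fun r => ν r a j) t ^ 2
  rw [Finset.sum_comm (s := (Finset.univ : Finset (Fin d))),
    Finset.sum_comm (s := (Finset.univ : Finset (Fin k))), ← Finset.sum_add_distrib]
  refine Finset.sum_congr rfl fun t _ => ?_
  rw [norm_sq_rate, norm_sq_rate, ← Finset.mul_sum, ← Finset.mul_sum, Finset.sum_add_distrib,
    Finset.sum_div, Finset.sum_div, Finset.sum_mul, Finset.sum_mul, Finset.sum_mul,
    Finset.sum_mul]

/-- The motions u and φ on the right are arbitrary, because displacement components carry zero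
damping. -/
theorem discreteDissipation_eq : Θ.discreteDissipation c ν ψ =
    ∑ i, ∑ t ∈ (Θ.grids hV c ht).dofTimes i with t < t₁, (nodalSystem hV c).damp i *
      (packed T u ν (nextTime ((Θ.grids hV c ht).dofTimes i) t) i - packed T u ν t i) *
        packed T φ ψ t i := by
  rw [Fintype.sum_sum_type, Fintype.sum_prod_type, Fintype.sum_prod_type]
  have h0 : ∀ p : T.Node × Fin d, (nodalSystem hV c).damp (Sum.inl p) = 0 := fun _ => rfl
  simp only [h0, zero_mul, Finset.sum_const_zero, zero_add]
  unfold discreteDissipation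
  refine Finset.sum_congr rfl fun a _ => ?_
  change _ = ∑ j, ∑ t ∈ Θ.nodalTimes a with t < t₁, c.nodalDiss a *
    (ν (nextTime (Θ.nodalTimes a) t) a j - ν t a j) * ψ t a j
  rw [Finset.sum_comm]
  refine Finset.sum_congr rfl fun t _ => ?_
  rw [PiLp.inner_apply, Finset.mul_sum]
  refine Finset.sum_congr rfl fun j _ => ?_
  simp
  ring

end TimeSet

end Translation

section Translation

variable {d k : ℕ} {𝓑 : ComplexBody d k} {T : Tessellation 𝓑.domain} {t₀ t₁ : ℝ}
  (hV : ∀ K, LinearGradientGrowth (dofPotential 𝓑 T K)) (c : T.Coefficients)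

theorem packed_add_smul (u φ : ℝ → T.NodalVec d) (ν ψ : ℝ → T.NodalVec k) (ε t : ℝ) :
    packed T (u + ε • φ) (ν + ε • ψ) t = packed T u ν t + ε • packed T φ ψ t := by
  ext (p | p) <;> simp [packed]

include hV in
theorem hasDerivAt_dofPotential (K : T.Elem) (x v : T.Dof k → ℝ) (ε : ℝ) :
    HasDerivAt (fun ε : ℝ => dofPotential 𝓑 T K (x + ε • v))
      (fderiv ℝ (dofPotential 𝓑 T K) (x + ε • v) v) ε := by
  have h1 : HasDerivAt (fun ε : ℝ => x + ε • v) v ε := by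
    simpa using ((hasDerivAt_id ε).smul_const v).const_add x
  exact ((hV K).differentiable (x + ε • v)).hasFDerivAt.comp_hasDerivAt ε h1

namespace TimeSet

variable (Θ : TimeSet T t₀ t₁) (ht : t₀ < t₁) {u φ : ℝ → T.NodalVec d} {ν ψ : ℝ → T.NodalVec k}

theorem hasDerivAt_discreteAction :
    HasDerivAt (fun ε : ℝ => Θ.discreteAction c (u + ε • φ) (ν + ε • ψ))
      ((∑ i, ∑ t ∈ (Θ.grids hV c ht).dofTimes i with t < t₁, (nodalSystem hV c).mass i *
        (nextTime ((Θ.grids hV c ht).dofTimes i) t - t) *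
        (rate ((Θ.grids hV c ht).dofTimes i) (fun r => packed T u ν r i) t *
          rate ((Θ.grids hV c ht).dofTimes i) (fun r => packed T φ ψ r i) t))
      - ∑ K, ∑ s ∈ (Θ.grids hV c ht).elemTimes K with s < t₁,
        (nextTime ((Θ.grids hV c ht).elemTimes K) s - s) *
        ∑ i, (nodalSystem hV c).force K i (packed T u ν s) * packed T φ ψ s i) 0 := by
  simp only [Θ.discreteAction_eq hV c ht, packed_add_smul]
  refine HasDerivAt.fun_sub (HasDerivAt.fun_sum fun i _ => HasDerivAt.fun_sum fun t _ => ?_)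
    (HasDerivAt.fun_sum fun K _ => HasDerivAt.fun_sum fun s _ => ?_)
  · have h1 : ∀ ε : ℝ, rate ((Θ.grids hV c ht).dofTimes i)
        (fun r => (packed T u ν r + ε • packed T φ ψ r) i) t =
        rate ((Θ.grids hV c ht).dofTimes i) (fun r => packed T u ν r i) t +
          ε * rate ((Θ.grids hV c ht).dofTimes i) (fun r => packed T φ ψ r i) t := by
      intro ε
      simp only [rate, Pi.add_apply, Pi.smul_apply, smul_eq_mul]
      ring
    simp only [h1]
    have h2 := ((((hasDerivAt_id (0 : ℝ)).mul_const
      (rate ((Θ.grids hV c ht).dofTimes i) (fun r => packed T φ ψ r i) t)).const_add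
      (rate ((Θ.grids hV c ht).dofTimes i) (fun r => packed T u ν r i) t)).pow 2).const_mul
      ((nodalSystem hV c).mass i / 2 * (nextTime ((Θ.grids hV c ht).dofTimes i) t - t))
    refine HasDerivAt.congr_deriv h2 ?_
    simp
    ring
  · have h1 := hasDerivAt_dofPotential hV K (packed T u ν s) (packed T φ ψ s) 0
    simp only [zero_smul, add_zero] at h1
    rw [← fderiv_dofPotential_apply]
    exact h1.const_mul _

/-- After summation by parts the principle says that the residuals of the balance, weighted with the
test motion, sum to zero. A hat function at one interior instant of one free degree of freedom
isolates one residual; conversely, test motions vanish at the fixed degrees of freedom. -/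
theorem isDiscreteSolution_iff :
    Θ.IsDiscreteSolution c u ν ↔ (Θ.grids hV c ht).IsTrajectory (packed T u ν) := by
  classical
  have hres : ∀ φ ψ, φ t₀ = 0 → φ t₁ = 0 → ψ t₀ = 0 → ψ t₁ = 0 →
      (HasDerivAt (fun ε : ℝ => Θ.discreteAction c (u + ε • φ) (ν + ε • ψ))
        (-Θ.discreteDissipation c ν ψ) 0 ↔
      ∑ i, ∑ t ∈ (Θ.grids hV c ht).dofTimes i with t₀ < t ∧ t < t₁,
        (Θ.grids hV c ht).residual (packed T u ν) i t * packed T φ ψ t i = 0) := by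
    intro φ ψ h1 h2 h3 h4
    have hp0 : packed T φ ψ t₀ = 0 := by ext (p | p) <;> simp [packed, h1, h3]
    have hp1 : packed T φ ψ t₁ = 0 := by ext (p | p) <;> simp [packed, h2, h4]
    have hd := Θ.hasDerivAt_discreteAction hV c ht (u := u) (ν := ν) (φ := φ) (ψ := ψ)
    rw [← (Θ.grids hV c ht).variation_eq_sum_residual (nodalSystem_force_eq_zero hV c) hp0 hp1,
      ← Θ.discreteDissipation_eq hV c ht]
    constructor
    · intro h
      rw [hd.unique h]
      ring
    · intro h
      rwa [eq_neg_of_add_eq_zero_left h] at hd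
  constructor
  · intro h
    obtain ⟨haff, hfix⟩ := (Θ.memY_iff hV c ht).1 h.memY
    refine ⟨haff, hfix, fun i hi t hit h0 h1 => ?_⟩
    rw [ForceSystem.Grids.balance_iff_residual]
    have hg := (Θ.grids hV c ht).dof_grid i
    -- The hat function of the instant t in the component i. It is admissible because i is free, and
    -- it vanishes at both ends because t is interior.
    set η : ℝ → T.Dof k → ℝ := fun s j =>
      if j = i then interpAlong ((Θ.grids hV c ht).dofTimes i) (Pi.single t 1) s else 0 with hη
    have hpack : packed T (fun s => T.dispOf k (η s)) (fun s => T.microOf k (η s)) = η :=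
      funext fun s => T.pack_dispOf_microOf (η s)
    have hη0 : η t₀ = 0 := by
      ext j
      simp only [hη]
      split_ifs with hj
      · rw [interpAlong_of_mem _ hg.start_mem, Pi.single_eq_of_ne h0.ne, Pi.zero_apply]
      · rfl
    have hη1 : η t₁ = 0 := by
      ext j
      simp only [hη]
      split_ifs with hj
      · rw [interpAlong_of_mem _ hg.end_mem, Pi.single_eq_of_ne h1.ne', Pi.zero_apply]
      · rfl
    have hmem : Θ.MemY (fun s => T.dispOf k (η s)) (fun s => T.microOf k (η s)) := by
      rw [Θ.memY_iff hV c ht, hpack]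
      refine ⟨fun j => ?_, fun j hj s hs => ?_⟩
      · by_cases hji : j = i
        · subst hji
          simp only [hη, if_true]
          exact affineAlong_interpAlong hg _
        · simp only [hη, if_neg hji]
          intro s _ _ r _
          simp [rate]
      · have : j ≠ i := fun hji => hi (hji ▸ hj)
        simp only [hη, if_neg this]
    have hz : ∀ s, η s = 0 → T.dispOf k (η s) = 0 ∧ T.microOf k (η s) = 0 := fun s hs => by
      rw [hs, map_zero, map_zero]; exact ⟨rfl, rfl⟩
    have := (hres _ _ (hz _ hη0).1 (hz _ hη1).1 (hz _ hη0).2 (hz _ hη1).2).1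
      (h.stationary _ _ hmem (hz _ hη0).1 (hz _ hη1).1 (hz _ hη0).2 (hz _ hη1).2)
    rw [hpack, Finset.sum_eq_single i (fun j _ hj => ?_) (by simp),
      Finset.sum_eq_single t (fun s hs hst => ?_) (fun h => ?_)] at this
    · have hηt : η t i = 1 := by
        simp only [hη, if_true, interpAlong_of_mem _ hit, Pi.single_eq_same]
      rwa [hηt, mul_one] at this
    · have hηs : η s i = 0 := by
        simp only [hη, if_true, interpAlong_of_mem _ (Finset.mem_filter.1 hs).1,
          Pi.single_eq_of_ne hst]
      rw [hηs, mul_zero]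
    · exact absurd (Finset.mem_filter.2 ⟨hit, h0, h1⟩) h
    · refine Finset.sum_eq_zero fun s _ => ?_
      simp only [hη, if_neg hj, mul_zero]
  · intro h
    refine ⟨(Θ.memY_iff hV c ht).2 ⟨h.affine, h.fixed⟩, fun φ ψ hY h1 h2 h3 h4 => ?_⟩
    refine (hres φ ψ h1 h2 h3 h4).2 (Finset.sum_eq_zero fun i _ => Finset.sum_eq_zero
      fun t hti => ?_)
    rw [Finset.mem_filter] at hti
    by_cases hi : (nodalSystem hV c).fixed i
    · rw [((Θ.memY_iff hV c ht).1 hY).2 i hi t ⟨hti.2.1.le, hti.2.2.le⟩, mul_zero]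
    · rw [(ForceSystem.Grids.balance_iff_residual _).1 (h.balance i hi t hti.1 hti.2.1 hti.2.2),
        zero_mul]

theorem hasInitialData_iff {u₀ v₀ : T.NodalVec d} {ν₀ ξ₀ : T.NodalVec k} :
    Θ.HasInitialData u₀ v₀ ν₀ ξ₀ u ν ↔ packed T u ν t₀ = T.pack u₀ ν₀ ∧
      ∀ i, rate ((Θ.grids hV c ht).dofTimes i) (fun r => packed T u ν r i) t₀ =
        T.pack v₀ ξ₀ i := by
  constructor
  · rintro ⟨h1, h2, h3⟩
    refine ⟨by rw [packed, h1, h2], ?_⟩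
    rintro (⟨a, j⟩ | ⟨a, j⟩)
    · rw [T.pack_inl, ← (h3 a).1, rate_apply]; rfl
    · rw [T.pack_inr, ← (h3 a).2, rate_apply]; rfl
  · rintro ⟨h1, h2⟩
    refine ⟨?_, ?_, fun a => ⟨?_, ?_⟩⟩
    · rw [← T.dispOf_pack (u t₀) (ν t₀), ← T.dispOf_pack u₀ ν₀, ← h1]; rfl
    · rw [← T.microOf_pack (u t₀) (ν t₀), ← T.microOf_pack u₀ ν₀, ← h1]; rfl
    · ext j
      rw [rate_apply]
      exact h2 (Sum.inl (a, j))
    · ext j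
      rw [rate_apply]
      exact h2 (Sum.inr (a, j))

/-- Displacement components have zero damping and positive mass, so only the components of ν impose
a condition. -/
theorem solvable_grids (h : Θ.Nondegenerate c 𝓑.microBdry) : (Θ.grids hV c ht).Solvable := by
  rintro (⟨a, j⟩ | ⟨a, j⟩) hi t hti h0 h1
  · change (0 : ℝ) * _ ≠ _
    rw [zero_mul]
    exact ((nodalSystem hV c).mass_pos (Sum.inl (a, j))).ne
  · exact h a hi t hti h0 h1

theorem existsUnique_isDiscreteSolution (hV : ∀ K, LinearGradientGrowth (dofPotential 𝓑 T K))
    (ht : t₀ < t₁) {u₀ v₀ : T.NodalVec d} {ν₀ ξ₀ : T.NodalVec k}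
    (hcompat : CompatibleData 𝓑 T u₀ v₀ ν₀ ξ₀) (h : Θ.Nondegenerate c 𝓑.microBdry) :
    ∃ (u : ℝ → T.NodalVec d) (ν : ℝ → T.NodalVec k),
      (Θ.IsDiscreteSolution c u ν ∧ Θ.HasInitialData u₀ v₀ ν₀ ξ₀ u ν) ∧
      ∀ (u' : ℝ → T.NodalVec d) (ν' : ℝ → T.NodalVec k),
        Θ.IsDiscreteSolution c u' ν' → Θ.HasInitialData u₀ v₀ ν₀ ξ₀ u' ν' →
        EqOn u' u (Icc t₀ t₁) ∧ EqOn ν' ν (Icc t₀ t₁) := by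
  have hs := Θ.solvable_grids hV c ht h
  obtain ⟨x, hx, hx0, hxv⟩ := (Θ.grids hV c ht).exists_isTrajectory hs (T.pack u₀ ν₀)
    (T.pack v₀ ξ₀) (by
      rintro (⟨a, j⟩ | ⟨a, j⟩) hi
      · simp [((hcompat a).1 hi).1, ((hcompat a).1 hi).2]
      · simp [((hcompat a).2 hi).1, ((hcompat a).2 hi).2])
  have hpack : packed T (fun s => T.dispOf k (x s)) (fun s => T.microOf k (x s)) = x :=
    funext fun s => T.pack_dispOf_microOf (x s)
  refine ⟨fun s => T.dispOf k (x s), fun s => T.microOf k (x s), ⟨?_, ?_⟩, ?_⟩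
  · rwa [Θ.isDiscreteSolution_iff hV c ht, hpack]
  · rw [Θ.hasInitialData_iff hV c ht, hpack]
    exact ⟨hx0, hxv⟩
  · intro u' ν' h' hi'
    rw [Θ.isDiscreteSolution_iff hV c ht] at h'
    rw [Θ.hasInitialData_iff hV c ht] at hi'
    have heq := h'.eqOn hs hx (hi'.1.trans hx0.symm) fun i => (hi'.2 i).trans (hxv i).symm
    refine ⟨fun t ht => ?_, fun t ht => ?_⟩
    · rw [← T.dispOf_pack (u' t) (ν' t)]
      exact congrArg (T.dispOf k) (heq ht)
    · rw [← T.microOf_pack (u' t) (ν' t)]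
      exact congrArg (T.microOf k) (heq ht)

theorem finite_steps : Θ.steps.Finite := by
  have : Θ.steps ⊆ ⋃ K : T.Elem, (fun t => nextTime (Θ.times K) t - t) '' (Θ.times K) := by
    rintro _ ⟨K, t, ht, -, rfl⟩
    exact mem_iUnion.2 ⟨K, t, ht, rfl⟩
  exact (Set.finite_iUnion fun K => (Θ.times K).finite_toSet.image _).subset this

theorem stepLe_maxStep : (Θ.grids hV c ht).StepLe Θ.maxStep := fun K t htK ht1 =>
  le_csSup Θ.finite_steps.bddAbove ⟨K, t, htK, ht1, rfl⟩

include ht in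
theorem ratio_nonneg : 0 ≤ Θ.ratio := by
  have h : ∀ δ ∈ Θ.steps, 0 ≤ δ := by
    rintro _ ⟨K, t, htK, ht1, rfl⟩
    have hg : IsGrid (Θ.times K) t₀ t₁ := ⟨ht, Θ.start_mem K, Θ.end_mem K, Θ.subset_Icc K⟩
    exact (sub_pos.2 (hg.lt_next ht1)).le
  exact div_nonneg (Real.sSup_nonneg h) (Real.sInf_nonneg h)

end TimeSet

include hV in
theorem eventually_nondegenerate (hd : 0 < d) (ht : t₀ < t₁) {Θ : ℕ → TimeSet T t₀ t₁}
    (hΘ : Tendsto (fun h => (Θ h).maxStep) atTop (𝓝 0)) :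
    ∀ᶠ h in atTop, (Θ h).Nondegenerate c 𝓑.microBdry := by
  have hev : ∀ a : T.Node, ∀ᶠ h in atTop, ∀ t ∈ (Θ h).nodalTimes a, t₀ < t → t < t₁ →
      c.nodalDiss a * (nextTime ((Θ h).nodalTimes a) t - t) ≠ c.nodalInertia a := by
    intro a
    have hρ : 0 < c.nodalInertia a := c.nodalInertia_pos a
    have hη : 0 ≤ c.nodalDiss a := c.nodalDiss_nonneg a
    have hlim : Tendsto (fun h => c.nodalDiss a * (Θ h).maxStep) atTop (𝓝 0) := by
      simpa using hΘ.const_mul (c.nodalDiss a)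
    filter_upwards [hlim.eventually_lt_const hρ] with h hh t hta h0 h1
    -- The first displacement component, which exists since d > 0, serves to reach the grid of the
    -- node a; k may be zero.
    have := ((Θ h).stepLe_maxStep hV c ht).dof (Sum.inl (a, ⟨0, hd⟩)) t hta h1
    refine (lt_of_le_of_lt ?_ hh).ne
    exact mul_le_mul_of_nonneg_left this hη
  filter_upwards [eventually_all.2 hev] with h hh a _ using hh a

end Translation

/-! ### The semi-discrete principle -/

section Sobolev

variable {E F : Type*} [NormedAddCommGroup E] [NormedSpace ℝ E] [NormedAddCommGroup F]
  [NormedSpace ℝ F] {t₀ t₁ : ℝ}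

theorem _root_.AbsolutelyContinuousOnInterval.clm_comp {f : ℝ → E}
    (hf : AbsolutelyContinuousOnInterval f t₀ t₁) (L : E →L[ℝ] F) :
    AbsolutelyContinuousOnInterval (fun t => L (f t)) t₀ t₁ := by
  rw [absolutelyContinuousOnInterval_iff] at hf ⊢
  intro ε hε
  have hC : 0 < ‖L‖ + 1 := by positivity
  obtain ⟨δ, hδ, h⟩ := hf (ε / (‖L‖ + 1)) (by positivity)
  refine ⟨δ, hδ, fun E hE hlen => ?_⟩
  have h1 := h E hE hlen
  rw [lt_div_iff₀' hC, Finset.mul_sum] at h1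
  refine lt_of_le_of_lt (Finset.sum_le_sum fun i _ => ?_) h1
  refine (L.dist_le_opNorm _ _).trans ?_
  gcongr
  linarith

omit [NormedSpace ℝ E] in
theorem memLp_of_continuous {f : ℝ → E} (hf : Continuous f) (p : ℝ≥0∞) :
    MemLp f p (volume.restrict (Ioo t₀ t₁)) := by
  obtain ⟨C, hC⟩ := isCompact_Icc.exists_bound_of_continuousOn (hf.continuousOn (s := Icc t₀ t₁))
  refine MemLp.of_bound hf.aestronglyMeasurable C ?_
  exact (ae_restrict_iff' measurableSet_Ioo).2
    (Eventually.of_forall fun t ht => hC t (Ioo_subset_Icc_self ht))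

theorem memW1_of_hasDerivAt {u v : ℝ → E} (h : ∀ t, HasDerivAt u (v t) t) (hv : Continuous v)
    (p : ℝ≥0∞) : MemW1 p t₀ t₁ u := by
  have hd : deriv u = v := funext fun t => (h t).deriv
  refine ⟨ContDiffOn.absolutelyContinuousOnInterval (ContDiff.contDiffOn ?_), ?_⟩
  · exact contDiff_one_iff_deriv.2 ⟨fun t => (h t).differentiableAt, hd ▸ hv⟩
  · rw [hd]; exact memLp_of_continuous hv p

theorem memW2_of_hasDerivAt [FiniteDimensional ℝ E] {u v : ℝ → E}
    (h : ∀ t, HasDerivAt u (v t) t) {L : NNReal} (hv : LipschitzWith L v) :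
    MemW2 ∞ t₀ t₁ u := by
  have hd : deriv u = v := funext fun t => (h t).deriv
  have := FiniteDimensional.complete ℝ E
  refine ⟨memW1_of_hasDerivAt h hv.continuous ∞, v, ⟨?_, ?_⟩, by rw [hd]⟩
  · exact (hv.lipschitzOnWith (s := uIcc t₀ t₁)).absolutelyContinuousOnInterval
  · exact memLp_top_of_bound (aestronglyMeasurable_deriv v _) L
      (Eventually.of_forall fun t => norm_deriv_le_of_lipschitz hv)

end Sobolev

theorem intervalIntegrable_of_integrable_Ioo {f : ℝ → ℝ} {t₀ t₁ : ℝ} (ht : t₀ ≤ t₁)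
    (h : Integrable f (volume.restrict (Ioo t₀ t₁))) : IntervalIntegrable f volume t₀ t₁ := by
  rw [intervalIntegrable_iff_integrableOn_Ioc_of_le ht, integrableOn_Ioc_iff_integrableOn_Ioo]
  exact h

/-- Differentiation under the integral of a `C¹` function along a continuous curve. -/
theorem hasDerivAt_integral_comp {E : Type*} [NormedAddCommGroup E] [NormedSpace ℝ E]
    {W : E → ℝ} (hW : ContDiff ℝ 1 W) {t₀ t₁ : ℝ} (ht : t₀ ≤ t₁) {x φ : ℝ → E}
    (hx : Continuous x) (hφ : ContinuousOn φ (Icc t₀ t₁)) :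
    HasDerivAt (fun ε : ℝ => ∫ t in t₀..t₁, W (x t + ε • φ t))
      (∫ t in t₀..t₁, fderiv ℝ W (x t) (φ t)) 0 := by
  -- The curve φ is continuous on [t₀, t₁] only. Extending it by its end values changes no integral
  -- and gives joint continuity in ε and t.
  obtain ⟨η, hη, hφη⟩ : ∃ η : ℝ → E, Continuous η ∧ EqOn φ η (Icc t₀ t₁) :=
    ⟨IccExtend ht ((Icc t₀ t₁).domRestrict φ), hφ.domRestrict.Icc_extend', fun t htI => by
      rw [IccExtend_of_mem _ _ htI]; rfl⟩
  have e1 : (fun ε : ℝ => ∫ t in t₀..t₁, W (x t + ε • φ t)) =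
      fun ε : ℝ => ∫ t in t₀..t₁, W (x t + ε • η t) := by
    funext ε
    refine intervalIntegral.integral_congr fun t htI => ?_
    rw [uIcc_of_le ht] at htI
    simp only [hφη htI]
  have e2 : ∫ t in t₀..t₁, fderiv ℝ W (x t) (φ t) = ∫ t in t₀..t₁, fderiv ℝ W (x t) (η t) := by
    refine intervalIntegral.integral_congr fun t htI => ?_
    rw [uIcc_of_le ht] at htI
    simp only [hφη htI]
  rw [e1, e2]
  have hW' := hW.continuous_fderiv one_ne_zero
  have hc : Continuous fun p : ℝ × ℝ => fderiv ℝ W (x p.2 + p.1 • η p.2) (η p.2) :=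
    (hW'.comp (by fun_prop)).clm_apply (by fun_prop)
  have hcW : ∀ ε : ℝ, Continuous fun t => W (x t + ε • η t) := fun ε =>
    hW.continuous.comp (by fun_prop)
  obtain ⟨C, hC⟩ := ((isCompact_closedBall (0 : ℝ) 1).prod
    (isCompact_Icc (a := t₀) (b := t₁))).exists_bound_of_continuousOn hc.continuousOn
  have := (intervalIntegral.hasDerivAt_integral_of_dominated_loc_of_deriv_le (μ := volume)
    (a := t₀) (b := t₁) (x₀ := (0 : ℝ)) (s := Metric.ball 0 1) (bound := fun _ => C)
    (F := fun ε t => W (x t + ε • η t)) (F' := fun ε t => fderiv ℝ W (x t + ε • η t) (η t))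
    (Metric.ball_mem_nhds _ one_pos)
    (Eventually.of_forall fun ε => (hcW ε).aestronglyMeasurable)
    ((hcW 0).intervalIntegrable _ _)
    ((hc.comp (Continuous.prodMk_right 0)).aestronglyMeasurable)
    (Eventually.of_forall fun t htI ε hε => ?_)
    intervalIntegrable_const
    (Eventually.of_forall fun t _ ε _ => ?_)).2
  · simpa using this
  · rw [uIoc_of_le ht] at htI
    exact hC (ε, t) ⟨Metric.ball_subset_closedBall hε, Ioc_subset_Icc_self htI⟩
  · have h1 : HasDerivAt (fun ε : ℝ => x t + ε • η t) (η t) ε := by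
      simpa using ((hasDerivAt_id ε).smul_const (η t)).const_add (x t)
    exact (hW.differentiable one_ne_zero _).hasFDerivAt.comp_hasDerivAt ε h1

/-! ### Weak form of the limit equations -/

namespace ForceSystem.IsContinuousTrajectory

variable {ι κ : Type*} [Fintype ι] {P : ForceSystem ι κ} {t₀ t₁ : ℝ} {X V : ℝ → ι → ℝ}
  (h : P.IsContinuousTrajectory t₀ t₁ X V)

include h

theorem continuous : Continuous X :=
  continuous_iff_continuousAt.2 fun t => (h.hasDerivAt t).continuousAt

theorem continuous_velocity : Continuous V := h.lipschitz.choose_spec.continuous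

/-- The integrated balance, solved for V i, expresses it near t through X and primitives of
continuous forces, all of them differentiable. -/
theorem deriv_velocity {i : ι} (hi : ¬ P.fixed i) {t : ℝ} (ht : t ∈ Ioo t₀ t₁) :
    P.mass i * deriv (fun s => V s i) t =
      P.damp i * V t i - ∑ K ∈ P.elems i, P.force K i (X t) := by
  have hm := (P.mass_pos i).ne'
  have hXi : HasDerivAt (fun s => X s i) (V t i) t := (hasDerivAt_pi.1 (h.hasDerivAt t)) i
  have hF : ∀ K, HasDerivAt (fun s => ∫ r in t₀..s, P.force K i (X r)) (P.force K i (X t)) t := by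
    intro K
    have hc : Continuous fun r => P.force K i (X r) := (P.force_continuous K i).comp h.continuous
    exact intervalIntegral.integral_hasDerivAt_right (hc.intervalIntegrable _ _)
      hc.stronglyMeasurable.stronglyMeasurableAtFilter hc.continuousAt
  have hR : HasDerivAt (fun s => V t₀ i + (P.mass i)⁻¹ * (P.damp i * (X s i - X t₀ i)
      - ∑ K ∈ P.elems i, ∫ r in t₀..s, P.force K i (X r)))
      ((P.mass i)⁻¹ * (P.damp i * V t i - ∑ K ∈ P.elems i, P.force K i (X t))) t :=
    ((((hXi.sub_const _).const_mul _).fun_sub (HasDerivAt.fun_sum fun K _ => hF K)).const_mul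
      _).const_add _
  have hev : (fun s => V s i) =ᶠ[𝓝 t] fun s => V t₀ i + (P.mass i)⁻¹ *
      (P.damp i * (X s i - X t₀ i) - ∑ K ∈ P.elems i, ∫ r in t₀..s, P.force K i (X r)) := by
    filter_upwards [Ioo_mem_nhds ht.1 ht.2] with s hs
    rw [← h.balance i hi s ⟨hs.1.le, hs.2⟩]
    field_simp
    ring
  rw [(hR.congr_of_eventuallyEq hev).deriv, mul_inv_cancel_left₀ hm]

/-- The balance of momentum in weak form. -/
theorem weak_balance (ht : t₀ ≤ t₁) {i : ι} (hi : ¬ P.fixed i) {η : ℝ → ℝ}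
    (hη : AbsolutelyContinuousOnInterval η t₀ t₁) (h0 : η t₀ = 0) (h1 : η t₁ = 0) :
    P.mass i * (∫ t in t₀..t₁, V t i * deriv η t) + P.damp i * (∫ t in t₀..t₁, V t i * η t) =
      ∑ K ∈ P.elems i, ∫ t in t₀..t₁, P.force K i (X t) * η t := by
  obtain ⟨L, hL⟩ := h.lipschitz
  have hVi : LipschitzWith L fun t => V t i := by
    have := (LipschitzWith.eval i : LipschitzWith 1 fun x : ι → ℝ => x i).comp hL
    rwa [one_mul] at this
  have hac : AbsolutelyContinuousOnInterval (fun t => V t i) t₀ t₁ :=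
    (hVi.lipschitzOnWith (s := uIcc t₀ t₁)).absolutelyContinuousOnInterval
  have hηc : ContinuousOn η (uIcc t₀ t₁) := hη.continuousOn
  have hint : ∀ f : ℝ → ℝ, Continuous f → IntervalIntegrable (fun t => f t * η t) volume t₀ t₁ :=
    fun f hf => (hf.continuousOn.mul hηc).intervalIntegrable
  have hFc : ∀ K, Continuous fun t => P.force K i (X t) := fun K =>
    (P.force_continuous K i).comp h.continuous
  rw [hac.integral_mul_deriv_eq_deriv_mul hη, h0, h1, mul_zero, mul_zero, sub_zero, zero_sub,
    mul_neg, ← intervalIntegral.integral_const_mul, ← intervalIntegral.integral_const_mul,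
    ← intervalIntegral.integral_finsetSum fun K _ => hint _ (hFc K)]
  have e : ∫ t in t₀..t₁, P.mass i * (deriv (fun s => V s i) t * η t) =
      ∫ t in t₀..t₁, (P.damp i * (V t i * η t) - ∑ K ∈ P.elems i, P.force K i (X t) * η t) := by
    refine intervalIntegral.integral_congr_ae ?_
    -- The differential equation holds in the open interval, whereas the interval integral includes
    -- t₁.
    have hne : ∀ᵐ t : ℝ, t ≠ t₁ := by simp [ae_iff, measure_singleton]
    filter_upwards [hne] with t hne htI
    rw [uIoc_of_le ht] at htI
    rw [← mul_assoc, h.deriv_velocity hi ⟨htI.1, lt_of_le_of_ne htI.2 hne⟩, sub_mul,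
      Finset.sum_mul, mul_assoc]
  rw [e, intervalIntegral.integral_sub]
  · ring
  · exact (hint _ (hVi.continuous)).const_mul _
  · have := hint _ (continuous_finsetSum (P.elems i) fun K _ => hFc K)
    simpa only [Finset.sum_mul] using this

end ForceSystem.IsContinuousTrajectory

section Sobolev

variable {E : Type*} [NormedAddCommGroup E] [NormedSpace ℝ E] {t₀ t₁ : ℝ} {p : ℝ≥0∞}
  {u φ : ℝ → E}

theorem MemW1.ae_differentiableAt [FiniteDimensional ℝ E] (hu : MemW1 p t₀ t₁ u) (ht : t₀ ≤ t₁) :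
    ∀ᵐ t ∂volume.restrict (Ioo t₀ t₁), DifferentiableAt ℝ u t := by
  refine (ae_restrict_iff' measurableSet_Ioo).2 ?_
  filter_upwards [hu.1.boundedVariationOn.ae_differentiableAt_of_mem_uIcc] with t h hti
  exact h (uIcc_of_le ht ▸ Ioo_subset_Icc_self hti)

theorem MemW1.deriv_add_smul [FiniteDimensional ℝ E] (hu : MemW1 p t₀ t₁ u)
    (hφ : MemW1 p t₀ t₁ φ) (ht : t₀ ≤ t₁) (ε : ℝ) :
    deriv (u + ε • φ) =ᵐ[volume.restrict (Ioo t₀ t₁)] deriv u + ε • deriv φ := by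
  filter_upwards [hu.ae_differentiableAt ht, hφ.ae_differentiableAt ht] with t h1 h2
  exact (h1.hasDerivAt.add (h2.hasDerivAt.const_smul ε)).deriv

theorem MemW1.add_smul [FiniteDimensional ℝ E] (hu : MemW1 p t₀ t₁ u)
    (hφ : MemW1 p t₀ t₁ φ) (ht : t₀ ≤ t₁) (ε : ℝ) : MemW1 p t₀ t₁ (u + ε • φ) :=
  ⟨hu.1.add (hφ.1.const_smul ε),
    (hu.2.add (hφ.2.const_smul ε)).ae_eq (hu.deriv_add_smul hφ ht ε).symm⟩

end Sobolev

/-- The first variation of the kinetic energy. -/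
theorem hasDerivAt_integral_sq {t₀ t₁ : ℝ} (ht : t₀ ≤ t₁) {v w : ℝ → ℝ}
    (hv : MemLp v 2 (volume.restrict (Ioo t₀ t₁))) (hw : MemLp w 2 (volume.restrict (Ioo t₀ t₁))) :
    HasDerivAt (fun ε : ℝ => ∫ t in t₀..t₁, (v t + ε * w t) ^ 2)
      (2 * ∫ t in t₀..t₁, v t * w t) 0 := by
  have h1 : IntervalIntegrable (fun t => v t ^ 2) volume t₀ t₁ :=
    intervalIntegrable_of_integrable_Ioo ht hv.integrable_sq
  have h2 : IntervalIntegrable (fun t => v t * w t) volume t₀ t₁ :=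
    intervalIntegrable_of_integrable_Ioo ht (hv.integrable_mul hw)
  have h3 : IntervalIntegrable (fun t => w t ^ 2) volume t₀ t₁ :=
    intervalIntegrable_of_integrable_Ioo ht hw.integrable_sq
  -- Since v and w are square integrable, the integral is a quadratic polynomial in ε with finite
  -- coefficients.
  have e : (fun ε : ℝ => ∫ t in t₀..t₁, (v t + ε * w t) ^ 2) = fun ε : ℝ =>
      (∫ t in t₀..t₁, v t ^ 2) + ε * (2 * ∫ t in t₀..t₁, v t * w t)
        + ε ^ 2 * ∫ t in t₀..t₁, w t ^ 2 := by
    funext ε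
    rw [← intervalIntegral.integral_const_mul, ← intervalIntegral.integral_const_mul,
      ← intervalIntegral.integral_const_mul, ← intervalIntegral.integral_add h1
        ((h2.const_mul _).const_mul _), ← intervalIntegral.integral_add
        (h1.add ((h2.const_mul _).const_mul _)) (h3.const_mul _)]
    refine intervalIntegral.integral_congr fun t _ => ?_
    ring
  rw [e]
  have := (((hasDerivAt_id (0 : ℝ)).mul_const (2 * ∫ t in t₀..t₁, v t * w t)).const_add
    (∫ t in t₀..t₁, v t ^ 2)).add (((hasDerivAt_id (0 : ℝ)).pow 2).mul_const
      (∫ t in t₀..t₁, w t ^ 2))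
  refine this.congr_deriv ?_
  simp

section SemiDiscrete

variable {d k : ℕ} {𝓑 : ComplexBody d k} {T : Tessellation 𝓑.domain} {t₀ t₁ : ℝ}

instance finiteDimensional_nodalVec {B : Set (Vec d)} (T : Tessellation B) (n : ℕ) :
    FiniteDimensional ℝ (T.NodalVec n) :=
  Module.Finite.equiv (PiLp.continuousLinearEquiv 2 ℝ
    (fun _ : T.Node => Vec n)).symm.toLinearEquiv

/-- A component of the nodal values. -/
def nodalCoord {B : Set (Vec d)} (T : Tessellation B) {n : ℕ} (a : T.Node) (j : Fin n) :
    T.NodalVec n →L[ℝ] ℝ :=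
  EuclideanSpace.proj j ∘L PiLp.proj 2 (fun _ : T.Node => Vec n) a

variable {u φ : ℝ → T.NodalVec d} {ν ψ : ℝ → T.NodalVec k}

theorem memLp_packed {p : ℝ≥0∞} {μ : Measure ℝ} (hu : MemLp u p μ) (hν : MemLp ν p μ)
    (i : T.Dof k) : MemLp (fun t => packed T u ν t i) p μ := by
  rcases i with ⟨a, j⟩ | ⟨a, j⟩
  · exact (nodalCoord T a j).comp_memLp' hu
  · exact (nodalCoord T a j).comp_memLp' hν

theorem absolutelyContinuous_packed (hu : AbsolutelyContinuousOnInterval u t₀ t₁)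
    (hν : AbsolutelyContinuousOnInterval ν t₀ t₁) (i : T.Dof k) :
    AbsolutelyContinuousOnInterval (fun t => packed T u ν t i) t₀ t₁ := by
  rcases i with ⟨a, j⟩ | ⟨a, j⟩
  · exact hu.clm_comp (nodalCoord T a j)
  · exact hν.clm_comp (nodalCoord T a j)

theorem continuousOn_packed (hu : AbsolutelyContinuousOnInterval u t₀ t₁)
    (hν : AbsolutelyContinuousOnInterval ν t₀ t₁) :
    ContinuousOn (packed T u ν) (uIcc t₀ t₁) :=
  continuousOn_pi.2 fun i => (absolutelyContinuous_packed hu hν i).continuousOn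

theorem deriv_packed {t : ℝ} (hu : DifferentiableAt ℝ u t) (hν : DifferentiableAt ℝ ν t)
    (i : T.Dof k) : deriv (fun s => packed T u ν s i) t = packed T (deriv u) (deriv ν) t i := by
  rcases i with ⟨a, j⟩ | ⟨a, j⟩
  · exact ((nodalCoord T a j).hasFDerivAt.comp_hasDerivAt t hu.hasDerivAt).deriv
  · exact ((nodalCoord T a j).hasFDerivAt.comp_hasDerivAt t hν.hasDerivAt).deriv

variable (hV : ∀ K, LinearGradientGrowth (dofPotential 𝓑 T K)) (c : T.Coefficients)

/-- The elemental inertia of a degree of freedom. -/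
def elemInertia (K : T.Elem) : T.Dof k → ℝ :=
  Sum.elim (fun p => c.mass K p.1) fun p => c.inertia K p.1

theorem sum_elemInertia (i : T.Dof k) :
    ∑ K ∈ (nodalSystem hV c).elems i, elemInertia c K i = (nodalSystem hV c).mass i := by
  rcases i with ⟨a, j⟩ | ⟨a, j⟩ <;> rfl

theorem sum_nodesOf_eq (K : T.Elem) (v : T.NodalVec d) (ξ : T.NodalVec k) :
    (∑ a ∈ T.nodesOf K, (c.mass K a / 2 * ‖v a‖ ^ 2 + c.inertia K a / 2 * ‖ξ a‖ ^ 2)) =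
      ∑ i, if K ∈ (nodalSystem hV c).elems i then elemInertia c K i / 2 * T.pack v ξ i ^ 2
        else 0 := by
  rw [Fintype.sum_sum_type, Fintype.sum_prod_type, Fintype.sum_prod_type,
    ← Finset.sum_add_distrib, Tessellation.nodesOf, Finset.sum_filter]
  refine Finset.sum_congr rfl fun a _ => ?_
  have hmem : ∀ i : T.Dof k, K ∈ (nodalSystem hV c).elems i ↔ (Tessellation.Dof.node i).1 ∈ K.1 :=
    fun i => by simp [nodalSystem, Tessellation.elemsAt]
  simp only [hmem]
  change _ = (∑ j, if a.1 ∈ K.1 then c.mass K a / 2 * v a j ^ 2 else 0) +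
    ∑ j, if a.1 ∈ K.1 then c.inertia K a / 2 * ξ a j ^ 2 else 0
  split_ifs with ha
  · rw [EuclideanSpace.real_norm_sq_eq, EuclideanSpace.real_norm_sq_eq, Finset.mul_sum,
      Finset.mul_sum]
  · simp

/-- Square integrability of the derivatives allows the integral to be split into its kinetic and
potential parts. Exchanging the sums over elements and degrees of freedom assembles the masses. -/
theorem action_eq (ht : t₀ ≤ t₁) (hu : MemW1 2 t₀ t₁ u) (hν : MemW1 2 t₀ t₁ ν) :
    action c t₀ t₁ u ν =
      (∑ i, (nodalSystem hV c).mass i / 2 *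
        ∫ t in t₀..t₁, packed T (deriv u) (deriv ν) t i ^ 2)
      - ∑ K, ∫ t in t₀..t₁, dofPotential 𝓑 T K (packed T u ν t) := by
  have hI : ∀ i, IntervalIntegrable (fun t => packed T (deriv u) (deriv ν) t i ^ 2) volume t₀ t₁ :=
    fun i => intervalIntegrable_of_integrable_Ioo ht (memLp_packed hu.2 hν.2 i).integrable_sq
  have hW : ∀ K, IntervalIntegrable (fun t => dofPotential 𝓑 T K (packed T u ν t)) volume t₀ t₁ :=
    fun K => ((hV K).contDiff.continuous.comp_continuousOn
      (continuousOn_packed hu.1 hν.1)).intervalIntegrable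
  have hIK : ∀ K i, IntervalIntegrable (fun t => if K ∈ (nodalSystem hV c).elems i then
      elemInertia c K i / 2 * packed T (deriv u) (deriv ν) t i ^ 2 else 0) volume t₀ t₁ := by
    intro K i
    split_ifs
    · exact (hI i).const_mul _
    · exact intervalIntegrable_const
  have e : ∀ K, ∫ t in t₀..t₁, ((∑ a ∈ T.nodesOf K, (c.mass K a / 2 * ‖deriv u t a‖ ^ 2
        + c.inertia K a / 2 * ‖deriv ν t a‖ ^ 2)) - elemPotential 𝓑 T K (u t) (ν t)) =
      (∑ i, if K ∈ (nodalSystem hV c).elems i then elemInertia c K i / 2 *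
        ∫ t in t₀..t₁, packed T (deriv u) (deriv ν) t i ^ 2 else 0)
      - ∫ t in t₀..t₁, dofPotential 𝓑 T K (packed T u ν t) := by
    intro K
    simp only [sum_nodesOf_eq hV c K]
    have h1 := intervalIntegral.integral_sub (μ := volume) (a := t₀) (b := t₁)
      (IntervalIntegrable.sum Finset.univ fun i _ => hIK K i) (hW K)
    simp only [Finset.sum_apply] at h1
    refine h1.trans ?_
    congr 1
    rw [intervalIntegral.integral_finsetSum fun i _ => hIK K i]
    refine Finset.sum_congr rfl fun i _ => ?_
    split_ifs
    · exact intervalIntegral.integral_const_mul _ _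
    · simp
  unfold action
  rw [Finset.sum_congr rfl fun K _ => e K, Finset.sum_sub_distrib, Finset.sum_comm]
  congr 1
  refine Finset.sum_congr rfl fun i _ => ?_
  rw [← sum_elemInertia hV c i, Finset.sum_div, Finset.sum_mul, Finset.sum_ite_mem,
    Finset.univ_inter]

/-- As in the discrete case, u and φ are arbitrary because displacement components are undamped. -/
theorem dissipation_eq {v : ℝ → T.NodalVec k} (hv : Continuous v) (hd : deriv ν = v)
    (hψ : AbsolutelyContinuousOnInterval ψ t₀ t₁) :
    dissipation c t₀ t₁ ν ψ = ∑ i, (nodalSystem hV c).damp i *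
      ∫ t in t₀..t₁, packed T u (deriv ν) t i * packed T φ ψ t i := by
  subst hd
  have hI : ∀ (a : T.Node) (j : Fin k), IntervalIntegrable (fun t => deriv ν t a j * ψ t a j)
      volume t₀ t₁ := fun a j =>
    (((nodalCoord T a j).continuous.comp hv).continuousOn.mul
      (hψ.clm_comp (nodalCoord T a j)).continuousOn).intervalIntegrable
  rw [Fintype.sum_sum_type, Fintype.sum_prod_type, Fintype.sum_prod_type]
  have h0 : ∀ p : T.Node × Fin d, (nodalSystem hV c).damp (Sum.inl p) = 0 := fun _ => rfl
  simp only [h0, zero_mul, Finset.sum_const_zero, zero_add]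
  change _ = ∑ a, ∑ j, (∑ K ∈ T.elemsAt a, c.diss K a) *
    ∫ t in t₀..t₁, deriv ν t a j * ψ t a j
  have e : ∀ K : T.Elem, ∫ t in t₀..t₁, ∑ a ∈ T.nodesOf K,
      c.diss K a * inner ℝ (deriv ν t a) (ψ t a) =
      ∑ a ∈ T.nodesOf K, ∑ j, c.diss K a * ∫ t in t₀..t₁, deriv ν t a j * ψ t a j := by
    intro K
    have e1 : ∀ t, ∑ a ∈ T.nodesOf K, c.diss K a * inner ℝ (deriv ν t a) (ψ t a) =
        ∑ a ∈ T.nodesOf K, ∑ j, c.diss K a * (deriv ν t a j * ψ t a j) := fun t => by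
      refine Finset.sum_congr rfl fun a _ => ?_
      rw [PiLp.inner_apply, Finset.mul_sum]
      refine Finset.sum_congr rfl fun j _ => ?_
      simp [mul_comm]
    simp only [e1]
    have hI' : ∀ a j, IntervalIntegrable (fun t => c.diss K a * (deriv ν t a j * ψ t a j))
      volume t₀ t₁ := fun a j => (hI a j).const_mul _
    rw [intervalIntegral.integral_finsetSum fun a _ => by
      have := IntervalIntegrable.sum Finset.univ fun j _ => hI' a j
      simpa only [Finset.sum_fn] using this]
    refine Finset.sum_congr rfl fun a _ => ?_
    rw [intervalIntegral.integral_finsetSum fun j _ => hI' a j]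
    simp only [intervalIntegral.integral_const_mul]
  unfold dissipation
  rw [Finset.sum_congr rfl fun K _ => e K,
    Finset.sum_comm' (t' := Finset.univ) (s' := fun a => T.elemsAt a) (fun K a => by
      simp [Tessellation.nodesOf, Tessellation.elemsAt])]
  refine Finset.sum_congr rfl fun a _ => ?_
  rw [Finset.sum_comm]
  simp only [Finset.sum_mul]

end SemiDiscrete

section Sobolev

variable {E F : Type*} [NormedAddCommGroup E] [NormedSpace ℝ E] [NormedAddCommGroup F]
  [NormedSpace ℝ F] {t₀ t₁ : ℝ}

theorem hasDerivAt_clm (L : E →L[ℝ] F) {x : ℝ → E} {v : E} {t : ℝ} (h : HasDerivAt x v t) :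
    HasDerivAt (fun s => L (x s)) (L v) t :=
  L.hasFDerivAt.comp_hasDerivAt t h

theorem deriv_clm (L : E →L[ℝ] F) {x v : ℝ → E} (h : ∀ t, HasDerivAt x (v t) t) :
    deriv (fun s => L (x s)) = fun s => L (v s) :=
  funext fun t => (hasDerivAt_clm L (h t)).deriv

theorem memW1_clm (L : E →L[ℝ] F) {x v : ℝ → E} (h : ∀ t, HasDerivAt x (v t) t)
    (hv : Continuous v) (p : ℝ≥0∞) : MemW1 p t₀ t₁ fun s => L (x s) :=
  memW1_of_hasDerivAt (fun t => hasDerivAt_clm L (h t)) (L.continuous.comp hv) p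

theorem memW2_clm [FiniteDimensional ℝ F] (L : E →L[ℝ] F) {x v : ℝ → E}
    (h : ∀ t, HasDerivAt x (v t) t) {C : NNReal} (hv : LipschitzWith C v) :
    MemW2 ∞ t₀ t₁ fun s => L (x s) :=
  memW2_of_hasDerivAt (fun t => hasDerivAt_clm L (h t)) (L.lipschitz.comp hv)

end Sobolev

section SemiDiscrete

variable {d k : ℕ} {𝓑 : ComplexBody d k} {T : Tessellation 𝓑.domain} {t₀ t₁ : ℝ}
  {hV : ∀ K, LinearGradientGrowth (dofPotential 𝓑 T K)} {c : T.Coefficients}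
  {X V : ℝ → T.Dof k → ℝ}

namespace ForceSystem.IsContinuousTrajectory

variable (h : (nodalSystem hV c).IsContinuousTrajectory t₀ t₁ X V)

include h

/-- The first variation is a sum over degrees of freedom. For a free one, equality with minus the
dissipation is the weak balance of momentum; for a fixed one, every term contains a test component
that vanishes identically. -/
theorem isStationary (ht : t₀ ≤ t₁) :
    IsStationary c t₀ t₁ (fun t => T.dispOf k (X t)) fun t => T.microOf k (X t) := by
  set u : ℝ → T.NodalVec d := fun t => T.dispOf k (X t) with hu
  set ν : ℝ → T.NodalVec k := fun t => T.microOf k (X t) with hν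
  have hcV := h.continuous_velocity
  have hdu : deriv u = fun t => T.dispOf k (V t) := deriv_clm (T.dispOf k) h.hasDerivAt
  have hdν : deriv ν = fun t => T.microOf k (V t) := deriv_clm (T.microOf k) h.hasDerivAt
  have huW : MemW1 2 t₀ t₁ u :=
    memW1_clm (T.dispOf k) h.hasDerivAt hcV 2
  have hνW : MemW1 2 t₀ t₁ ν :=
    memW1_clm (T.microOf k) h.hasDerivAt hcV 2
  have hX : packed T u ν = X := funext fun t => T.pack_dispOf_microOf (X t)
  have hVp : packed T (deriv u) (deriv ν) = V := by
    rw [hdu, hdν]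
    exact funext fun t => T.pack_dispOf_microOf (V t)
  refine ⟨huW, hνW, fun t hti a => ⟨fun ha => ?_, fun ha => ?_⟩, fun φ ψ hφ hψ hbc => ?_⟩
  · ext j
    exact h.fixed (Sum.inl (a, j)) ha t hti
  · ext j
    exact h.fixed (Sum.inr (a, j)) ha t hti
  have hVL : ∀ i, MemLp (fun t => V t i) 2 (volume.restrict (Ioo t₀ t₁)) := fun i =>
    memLp_of_continuous ((continuous_apply i).comp hcV) 2
  have hωL := memLp_packed hφ.1.2 hψ.1.2
  have hac := absolutelyContinuous_packed hφ.1.1 hψ.1.1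
  have hcϕ := continuousOn_packed hφ.1.1 hψ.1.1
  have hact : (fun ε : ℝ => action c t₀ t₁ (u + ε • φ) (ν + ε • ψ)) = fun ε : ℝ =>
      (∑ i, (nodalSystem hV c).mass i / 2 *
        ∫ t in t₀..t₁, (V t i + ε * packed T (deriv φ) (deriv ψ) t i) ^ 2)
      - ∑ K, ∫ t in t₀..t₁, dofPotential 𝓑 T K (X t + ε • packed T φ ψ t) := by
    funext ε
    rw [action_eq hV c ht (huW.add_smul hφ.1 ht ε) (hνW.add_smul hψ.1 ht ε)]
    simp only [packed_add_smul, hX]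
    congr 1
    refine Finset.sum_congr rfl fun i _ => ?_
    congr 1
    -- The derivative of u + ε φ splits only almost everywhere in the open interval, since φ is
    -- merely absolutely continuous.
    rw [intervalIntegral.integral_of_le ht, intervalIntegral.integral_of_le ht,
      integral_Ioc_eq_integral_Ioo, integral_Ioc_eq_integral_Ioo]
    refine integral_congr_ae ?_
    filter_upwards [huW.deriv_add_smul hφ.1 ht ε, hνW.deriv_add_smul hψ.1 ht ε] with t e1 e2
    have e3 : packed T (deriv (u + ε • φ)) (deriv (ν + ε • ψ)) t =
        packed T (deriv u + ε • deriv φ) (deriv ν + ε • deriv ψ) t := by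
      rw [packed, e1, e2]
      rfl
    rw [e3, packed_add_smul, hVp]
    rfl
  have hder : HasDerivAt (fun ε : ℝ => action c t₀ t₁ (u + ε • φ) (ν + ε • ψ))
      ((∑ i, (nodalSystem hV c).mass i / 2 *
        (2 * ∫ t in t₀..t₁, V t i * packed T (deriv φ) (deriv ψ) t i))
      - ∑ K, ∫ t in t₀..t₁, fderiv ℝ (dofPotential 𝓑 T K) (X t) (packed T φ ψ t)) 0 := by
    rw [hact]
    exact HasDerivAt.fun_sub (HasDerivAt.fun_sum fun i _ =>
      (hasDerivAt_integral_sq ht (hVL i) (hωL i)).const_mul _)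
      (HasDerivAt.fun_sum fun K _ => hasDerivAt_integral_comp (hV K).contDiff ht h.continuous
        (uIcc_of_le ht ▸ hcϕ))
  refine hder.congr_deriv ?_
  rw [dissipation_eq (u := deriv u) (φ := φ) hV c ((T.microOf k).continuous.comp hcV) hdν hψ.1.1,
    hVp]
  have hint : ∀ K i, IntervalIntegrable
      (fun t => (nodalSystem hV c).force K i (X t) * packed T φ ψ t i) volume t₀ t₁ := fun K i =>
    ((((nodalSystem hV c).force_continuous K i).comp h.continuous).continuousOn.mul
      (hac i).continuousOn).intervalIntegrable
  have eF : ∑ K, ∫ t in t₀..t₁, fderiv ℝ (dofPotential 𝓑 T K) (X t) (packed T φ ψ t) =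
      ∑ i, ∑ K ∈ (nodalSystem hV c).elems i,
        ∫ t in t₀..t₁, (nodalSystem hV c).force K i (X t) * packed T φ ψ t i := by
    simp only [fderiv_dofPotential_apply hV c]
    rw [Finset.sum_congr rfl fun K _ =>
      intervalIntegral.integral_finsetSum fun i _ => hint K i, Finset.sum_comm]
    refine Finset.sum_congr rfl fun i _ => ?_
    symm
    refine Finset.sum_subset (Finset.subset_univ _) fun K _ hK => ?_
    simp [nodalSystem_force_eq_zero hV c K i _ hK]
  rw [eF, ← Finset.sum_neg_distrib, ← Finset.sum_sub_distrib]
  refine Finset.sum_congr rfl fun i _ => ?_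
  have eω : ∫ t in t₀..t₁, V t i * packed T (deriv φ) (deriv ψ) t i =
      ∫ t in t₀..t₁, V t i * deriv (fun s => packed T φ ψ s i) t := by
    rw [intervalIntegral.integral_of_le ht, intervalIntegral.integral_of_le ht,
      integral_Ioc_eq_integral_Ioo, integral_Ioc_eq_integral_Ioo]
    refine integral_congr_ae ?_
    filter_upwards [hφ.1.ae_differentiableAt ht, hψ.1.ae_differentiableAt ht] with t e1 e2
    rw [deriv_packed e1 e2]
  rw [eω]
  by_cases hi : (nodalSystem hV c).fixed i
  · have hz : ∀ t ∈ Icc t₀ t₁, packed T φ ψ t i = 0 := by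
      rcases i with ⟨a, j⟩ | ⟨a, j⟩
      · intro t hti
        exact congrArg (fun v : Vec d => v j) ((hbc t hti a).1 hi)
      · intro t hti
        exact congrArg (fun v : Vec k => v j) ((hbc t hti a).2 hi)
    -- A test component that vanishes on [t₀, t₁] has zero derivative in the interior, where it
    -- vanishes in a neighbourhood.
    have z1 : ∫ t in t₀..t₁, V t i * deriv (fun s => packed T φ ψ s i) t = 0 := by
      rw [intervalIntegral.integral_of_le ht, integral_Ioc_eq_integral_Ioo]
      refine setIntegral_eq_zero_of_forall_eq_zero fun t hti => ?_
      have : (fun s => packed T φ ψ s i) =ᶠ[𝓝 t] fun _ => 0 := by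
        filter_upwards [Ioo_mem_nhds hti.1 hti.2] with s hs using hz s (Ioo_subset_Icc_self hs)
      rw [this.deriv_eq, deriv_const, mul_zero]
    have z2 : ∀ f : ℝ → ℝ, ∫ t in t₀..t₁, f t * packed T φ ψ t i = 0 := fun f => by
      rw [intervalIntegral.integral_of_le ht]
      refine setIntegral_eq_zero_of_forall_eq_zero fun t hti => ?_
      rw [hz t (Ioc_subset_Icc_self hti), mul_zero]
    simp [z1, z2]
  · have hends : ∀ t, φ t = 0 → ψ t = 0 → packed T φ ψ t i = 0 := fun t h1 h2 => by
      rcases i with p | p <;> simp [packed, h1, h2]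
    rw [← h.weak_balance ht hi (hac i) (hends _ hφ.2.1 hψ.2.1) (hends _ hφ.2.2 hψ.2.2)]
    ring

end ForceSystem.IsContinuousTrajectory

theorem ForceSystem.Grids.velocity_start {ι κ : Type*} [Fintype ι] {P : ForceSystem ι κ}
    (Θ : P.Grids t₀ t₁) (x : ℝ → ι → ℝ) (i : ι) :
    Θ.velocity x t₀ i = rate (Θ.dofTimes i) (fun r => x r i) t₀ := by
  rw [velocity, stepRate, lastTime_of_mem (Θ.dof_grid i).start_mem]

/-- Away from the instants of the grids the derivative of a trajectory is its velocity. -/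
theorem ForceSystem.Grids.IsTrajectory.ae_hasDerivAt {ι κ : Type*} [Fintype ι]
    {P : ForceSystem ι κ} {Θ : P.Grids t₀ t₁} {x : ℝ → ι → ℝ} (hx : Θ.IsTrajectory x) :
    ∀ᵐ t ∂volume.restrict (Ioo t₀ t₁), HasDerivAt x (Θ.velocity x t) t := by
  refine (ae_restrict_iff' measurableSet_Ioo).2 ?_
  have hne : ∀ᵐ t : ℝ, ∀ i, t ∉ Θ.dofTimes i := by
    refine ae_all_iff.2 fun i => ?_
    exact (Θ.dofTimes i).finite_toSet.countable.ae_notMem volume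
  filter_upwards [hne] with t hti ht
  exact hasDerivAt_pi.2 fun i => (hx.affine i).hasDerivAt (Θ.dof_grid i) ht (hti i)

theorem norm_pack_le {B : Set (Vec d)} (T : Tessellation B) (v : T.NodalVec d)
    (ξ : T.NodalVec k) : ‖T.pack v ξ‖ ≤ ‖v‖ + ‖ξ‖ := by
  refine (pi_norm_le_iff_of_nonneg (by positivity)).2 ?_
  rintro (⟨a, j⟩ | ⟨a, j⟩)
  · have h1 := PiLp.norm_apply_le v a
    have h2 := PiLp.norm_apply_le (v a) j
    simp only [T.pack_inl]
    linarith [norm_nonneg ξ]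
  · have h1 := PiLp.norm_apply_le ξ a
    have h2 := PiLp.norm_apply_le (ξ a) j
    simp only [T.pack_inr]
    linarith [norm_nonneg v]

/-- Uniform convergence of the derivatives outside null sets gives convergence in `Lᵖ`. -/
theorem tendsto_eLpNorm_deriv_sub {E F : Type*} [NormedAddCommGroup E] [NormedSpace ℝ E]
    [NormedAddCommGroup F] [NormedSpace ℝ F] (L : E →L[ℝ] F) {w : ℕ → ℝ → E} {V : ℝ → E}
    {x : ℕ → ℝ → E} {X : ℝ → E}
    (hw : TendstoUniformlyOn w V atTop (Ico t₀ t₁))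
    (hx : ∀ᶠ n in atTop, ∀ᵐ t ∂volume.restrict (Ioo t₀ t₁), HasDerivAt (x n) (w n t) t)
    (hX : ∀ t, HasDerivAt X (V t) t) (p : ℝ≥0∞) :
    Tendsto (fun n => eLpNorm (deriv (fun t => L (x n t)) - deriv fun t => L (X t)) p
      (volume.restrict (Ioo t₀ t₁)))
      atTop (𝓝 0) := by
  have hLw : TendstoUniformlyOn (fun n t => L (w n t)) (fun t => L (V t)) atTop (Ico t₀ t₁) :=
    L.uniformContinuous.comp_tendstoUniformlyOn hw
  -- The factor |I|^{1/p} between the essential supremum and the Lᵖ norm on the bounded interval;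
  -- for p = ∞ the exponent is 0 and the factor is 1.
  set M : ℝ≥0∞ := volume.restrict (Ioo t₀ t₁) univ ^ p.toReal⁻¹ with hM
  have hMtop : M ≠ ∞ := by
    refine ENNReal.rpow_ne_top_of_nonneg (by positivity) ?_
    simp
  have hbound : ∀ ε : ℝ, 0 < ε → ∀ᶠ n in atTop,
      eLpNorm (deriv (fun t => L (x n t)) - deriv fun t => L (X t)) p
      (volume.restrict (Ioo t₀ t₁)) ≤ M * ENNReal.ofReal ε := by
    intro ε hε
    filter_upwards [hx, Metric.tendstoUniformlyOn_iff.1 hLw ε hε] with n h1 h2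
    refine eLpNorm_le_of_ae_bound ?_
    filter_upwards [h1, ae_restrict_mem measurableSet_Ioo] with t h3 hti
    rw [Pi.sub_apply, (hasDerivAt_clm L h3).deriv, (hasDerivAt_clm L (hX t)).deriv, ← dist_eq_norm, dist_comm]
    exact (h2 t (Ioo_subset_Ico_self hti)).le
  refine ENNReal.tendsto_nhds_zero.2 fun δ hδ => ?_
  obtain ⟨ε, hε, hεδ⟩ : ∃ ε : ℝ, 0 < ε ∧ M * ENNReal.ofReal ε ≤ δ := by
    have : Tendsto (fun ε : ℝ => M * ENNReal.ofReal ε) (𝓝[>] 0) (𝓝 0) := by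
      have h1 : Tendsto (fun ε : ℝ => M * ENNReal.ofReal ε) (𝓝 0) (𝓝 (M * ENNReal.ofReal 0)) :=
        ENNReal.Tendsto.const_mul (ENNReal.continuous_ofReal.tendsto 0) (Or.inr hMtop)
      rw [ENNReal.ofReal_zero, mul_zero] at h1
      exact h1.mono_left nhdsWithin_le_nhds
    obtain ⟨ε, h1, h2⟩ := ((ENNReal.tendsto_nhds_zero.1 this δ hδ).and
      self_mem_nhdsWithin).exists
    exact ⟨ε, h2, h1⟩
  filter_upwards [hbound ε hε] with n hn using hn.trans hεδ

end SemiDiscrete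

end AVI

end

/-! ### Proof of the theorem -/

theorem theorem2 {d k : ℕ} (hd : 0 < d) (𝓑 : AVI.ComplexBody d k)
    (hB : 𝓑.IsBoundedDomain) (hA1 : 𝓑.A1) (hA2 : 𝓑.A2) (hA3 : 𝓑.A3)
    (T : AVI.Tessellation 𝓑.domain) (c : T.Coefficients)
    (t₀ t₁ : ℝ) (ht : t₀ < t₁)
    (Θ : ℕ → AVI.TimeSet T t₀ t₁)
    (hΘ : Tendsto (fun h => (Θ h).maxStep) atTop (𝓝 0))
    (u₀ v₀ : ℕ → T.NodalVec d) (ν₀ ξ₀ : ℕ → T.NodalVec k)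
    (hcompat : ∀ h, AVI.CompatibleData 𝓑 T (u₀ h) (v₀ h) (ν₀ h) (ξ₀ h))
    (hbdd : BddAbove (range fun h =>
      (Θ h).ratio + ‖u₀ h‖ + ‖ν₀ h‖ + ‖v₀ h‖ + ‖ξ₀ h‖)) :
    -- existence and uniqueness of the discrete solutions
    (∀ h, (Θ h).Nondegenerate c 𝓑.microBdry →
      ∃ (u : ℝ → T.NodalVec d) (ν : ℝ → T.NodalVec k),
        ((Θ h).IsDiscreteSolution c u ν ∧
          (Θ h).HasInitialData (u₀ h) (v₀ h) (ν₀ h) (ξ₀ h) u ν) ∧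
        ∀ (u' : ℝ → T.NodalVec d) (ν' : ℝ → T.NodalVec k),
          (Θ h).IsDiscreteSolution c u' ν' →
          (Θ h).HasInitialData (u₀ h) (v₀ h) (ν₀ h) (ξ₀ h) u' ν' →
          EqOn u' u (Icc t₀ t₁) ∧ EqOn ν' ν (Icc t₀ t₁)) ∧
    (∀ᶠ h in atTop, (Θ h).Nondegenerate c 𝓑.microBdry) ∧
    -- convergence
    (∀ (u_ : ℕ → ℝ → T.NodalVec d) (ν_ : ℕ → ℝ → T.NodalVec k),
      (∀ᶠ h in atTop, (Θ h).IsDiscreteSolution c (u_ h) (ν_ h) ∧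
        (Θ h).HasInitialData (u₀ h) (v₀ h) (ν₀ h) (ξ₀ h) (u_ h) (ν_ h)) →
      ∃ (u : ℝ → T.NodalVec d) (ν : ℝ → T.NodalVec k),
        AVI.MemW2 ∞ t₀ t₁ u ∧ AVI.MemW2 ∞ t₀ t₁ ν ∧
        AVI.IsStationary c t₀ t₁ u ν ∧
        ∃ σ : ℕ → ℕ, StrictMono σ ∧
          TendstoUniformlyOn (fun n => u_ (σ n)) u atTop (Icc t₀ t₁) ∧
          TendstoUniformlyOn (fun n => ν_ (σ n)) ν atTop (Icc t₀ t₁) ∧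
          ∀ p : ℝ≥0∞, 1 ≤ p → p ≠ ∞ →
            Tendsto (fun n => eLpNorm (deriv (u_ (σ n)) - deriv u) p
              (volume.restrict (Ioo t₀ t₁))) atTop (𝓝 0) ∧
            Tendsto (fun n => eLpNorm (deriv (ν_ (σ n)) - deriv ν) p
              (volume.restrict (Ioo t₀ t₁))) atTop (𝓝 0)) := by
  have hV := AVI.linearGradientGrowth_dofPotential T hB hA2 hA3
  refine ⟨fun h hnd => (Θ h).existsUnique_isDiscreteSolution c hV ht (hcompat h) hnd,
    AVI.eventually_nondegenerate hV c hd ht hΘ, fun u_ ν_ hsol => ?_⟩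
  obtain ⟨M, hM⟩ := hbdd
  have hsol' : ∀ᶠ h in atTop,
      ((Θ h).grids hV c ht).IsTrajectory (AVI.packed T (u_ h) (ν_ h)) ∧
      1 + ‖AVI.packed T (u_ h) (ν_ h) t₀‖ +
        ‖((Θ h).grids hV c ht).velocity (AVI.packed T (u_ h) (ν_ h)) t₀‖ ≤ 1 + M := by
    filter_upwards [hsol] with h hh
    refine ⟨((Θ h).isDiscreteSolution_iff hV c ht).1 hh.1, ?_⟩
    obtain ⟨h1, h2⟩ := ((Θ h).hasInitialData_iff hV c ht).1 hh.2
    have h3 : ((Θ h).grids hV c ht).velocity (AVI.packed T (u_ h) (ν_ h)) t₀ =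
        T.pack (v₀ h) (ξ₀ h) :=
      funext fun i => (AVI.ForceSystem.Grids.velocity_start _ _ i).trans (h2 i)
    rw [h1, h3]
    have := hM (mem_range_self h)
    have := AVI.norm_pack_le T (u₀ h) (ν₀ h)
    have := AVI.norm_pack_le T (v₀ h) (ξ₀ h)
    -- The ratio is nonnegative, so the bound on the whole sum bounds the norms of the initial data.
    have := (Θ h).ratio_nonneg ht
    linarith
  obtain ⟨X, V, σ, hXV, hσ, hX, hVσ⟩ := (AVI.nodalSystem hV c).exists_limit ht
    (fun n => (Θ n).stepLe_maxStep hV c ht) hΘ hsol'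
  -- Almost everywhere the step velocities, which converge uniformly, are the derivatives of the
  -- discrete motions.
  have hder : ∀ᶠ n in atTop, ∀ᵐ t ∂volume.restrict (Ioo t₀ t₁),
      HasDerivAt (AVI.packed T (u_ (σ n)) (ν_ (σ n)))
        (((Θ (σ n)).grids hV c ht).velocity (AVI.packed T (u_ (σ n)) (ν_ (σ n))) t) t :=
    (hσ.tendsto_atTop.eventually hsol').mono fun n hn => hn.1.ae_hasDerivAt
  obtain ⟨L, hL⟩ := hXV.lipschitz
  exact ⟨fun t => T.dispOf k (X t), fun t => T.microOf k (X t),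
    AVI.memW2_clm (T.dispOf k) hXV.hasDerivAt hL, AVI.memW2_clm (T.microOf k) hXV.hasDerivAt hL,
    hXV.isStationary ht.le, σ, hσ,
    (T.dispOf k).uniformContinuous.comp_tendstoUniformlyOn hX,
    (T.microOf k).uniformContinuous.comp_tendstoUniformlyOn hX, fun p _ _ =>
      ⟨AVI.tendsto_eLpNorm_deriv_sub (T.dispOf k) hVσ hder hXV.hasDerivAt p,
        AVI.tendsto_eLpNorm_deriv_sub (T.microOf k) hVσ hder hXV.hasDerivAt p⟩⟩
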